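/- For a prime power $q$ let $\mathcal{M}$ be the set of monic polynomials in $\mathbb{F}_q[t]$ and $\mathcal{M}_N$ the set of those of degree $N$. A Steinhaus random multiplicative function over $\mathbb{F}_q[t]$ is a random function $f:\mathcal{M}\to\mathbb{C}$ such that the values $f(P)$ at monic irreducible polynomials $P$ are independent and uniformly distributed on the unit circle $\{|z|=1\}$, and $f(P_1^{a_1}\cdots P_r^{a_r})=f(P_1)^{a_1}\cdots f(P_r)^{a_r}$ for distinct monic irreducibles $P_1,\dots,P_r$ (so $f(1)=1$). Theorem. Let $q\ge 2$ be a prime power, let $N\ge 3$ and $1\le h\le N-2$ be integers, let $K\in\mathcal{M}_N$, and let $f$ be a Steinhaus random multiplicative function over $\mathbb{F}_q[t]$. Put $$\mathcal{A}=\mathcal{I}(K,h)=\{F\in\mathcal{M}_N:\deg(F-K)\le h\}\qquad(\deg 0=-\infty).$$ Then $$\frac{1}{\sqrt{|\mathcal{A}|}}\sum_{F\in\mathcal{A}}f(F)\ \xrightarrow{d}\ \mathcal{CN}(0,1)$$ in both of the following cases: (a) as $q^h\to\infty$, provided $q^{h+1}=o(q^N/N)$; (b) as $h\to\infty$, provided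 $q^{h+1}=o(q^N/N^c)$ for some fixed $c>2\log 2-1$. Here $\mathcal{CN}(0,1)$ is the law of $X+iY$ with $X,Y$ independent real normal variables of mean $0$ and variance $1/2$. The parameters $q,N,h,K$ (and the probability space carrying $f$) may vary and depend on each other arbitrarily in these limits: the assertion is that for every family of such data, indexed by any set, and every filter on the index set along which $q^h\to\infty$ and $q^{h+1}=o(q^N/N)$ (respectively $h\to\infty$ and $q^{h+1}=o(q^N/N^c)$), the normalized sums converge in distribution to $\mathcal{CN}(0,1)$ along that filter. -/

import Mathlib

open MeasureTheory ProbabilityTheory Filter Asymptotics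
open scoped Polynomial

noncomputable section

/-- The monic irreducible polynomials ("primes") of `k[t]`. -/
abbrev MonicPrime (k : Type*) [Field k] : Type _ :=
  {P : k[X] // P.Monic ∧ Irreducible P}

/-- The uniform probability distribution on the unit circle of `ℂ`: the law of `exp (i θ)` with
`θ` uniformly distributed on `(0, 2π]`. -/
def unitCircleUniform : Measure ℂ :=
  (cond (volume : Measure ℝ) (Set.Ioc 0 (2 * Real.pi))).map
    (fun θ : ℝ => Complex.exp ((θ : ℂ) * Complex.I))

/-- `f` is a Steinhaus random multiplicative function over `k[t]` on the probability space
`(Ω, μ)`: the values at monic irreducibles are independent and uniformly distributed on the unit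
circle, and `f (P₁ ^ a₁ ⋯ P_r ^ a_r) = f(P₁) ^ a₁ ⋯ f(P_r) ^ a_r` for distinct monic irreducibles
`P₁, …, P_r` (for `r = 0` this says `f 1 = 1`). Only the values of `f` at monic polynomials
matter; no condition is put on the others. -/
structure IsSteinhaus {k Ω : Type*} [Field k] [MeasurableSpace Ω]
    (f : k[X] → Ω → ℂ) (μ : Measure Ω) : Prop where
  measurable : ∀ P : MonicPrime k, Measurable (f P.1)
  law : ∀ P : MonicPrime k, μ.map (f P.1) = unitCircleUniform
  indep : iIndepFun (fun P : MonicPrime k => f P.1) μ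
  multiplicative : ∀ (s : Finset (MonicPrime k)) (a : MonicPrime k → ℕ) (ω : Ω),
    f (∏ P ∈ s, P.1 ^ a P) ω = ∏ P ∈ s, f P.1 ω ^ a P

/-- The monic polynomials `F` of degree `N` with `deg (F - K) ≤ h` (where `deg 0 = -∞`). -/
def polyIntervalSet {k : Type*} [Field k] (N : ℕ) (K : k[X]) (h : ℕ) : Set k[X] :=
  {F | F.Monic ∧ F.natDegree = N ∧ (F - K).degree ≤ (h : WithBot ℕ)}

theorem polyIntervalSet_finite {k : Type*} [Field k] [Finite k] (N : ℕ) (K : k[X]) (h : ℕ) :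
    (polyIntervalSet N K h).Finite := by
  have : Finite (Polynomial.degreeLT k (N + 1)) :=
    Finite.of_equiv _ (Polynomial.degreeLTEquiv k (N + 1)).toEquiv.symm
  refine Set.Finite.subset
    (Set.toFinite ((Polynomial.degreeLT k (N + 1) : Submodule k k[X]) : Set k[X])) ?_
  rintro F ⟨-, hF, -⟩
  rw [SetLike.mem_coe, Polynomial.mem_degreeLT]
  exact lt_of_le_of_lt Polynomial.degree_le_natDegree (by rw [hF]; exact_mod_cast Nat.lt_succ_self N)

/-- The interval `𝓘(K, h)` in the monic polynomials of degree `N`, as a finite set. -/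
def polyInterval {k : Type*} [Field k] [Finite k] (N : ℕ) (K : k[X]) (h : ℕ) : Finset k[X] :=
  (polyIntervalSet_finite N K h).toFinset

/-- The normalized partial sum `|A|^{-1/2} ∑_{F ∈ A} f(F)`. -/
def normalizedSum {k Ω : Type*} [Field k] (f : k[X] → Ω → ℂ) (A : Finset k[X]) (ω : Ω) : ℂ :=
  ((Real.sqrt (A.card : ℝ))⁻¹ : ℂ) * ∑ F ∈ A, f F ω

/-- The standard complex normal distribution `𝒞𝒩(0,1)`: the law of `X + iY` with `X`, `Y`
independent real normal variables of mean `0` and variance `1/2`. -/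
def stdComplexNormal : Measure ℂ :=
  ((gaussianReal 0 (1 / 2)).prod (gaussianReal 0 (1 / 2))).map
    (fun p : ℝ × ℝ => (p.1 : ℂ) + (p.2 : ℂ) * Complex.I)

instance stdComplexNormal_isProbabilityMeasure : IsProbabilityMeasure stdComplexNormal :=
  Measure.isProbabilityMeasure_map (by fun_prop)

end

/-! By unique factorization the values f(F), F in the interval, are distinct monomials in
independent uniform points of the unit circle, one for each prime of degree at most N. The assertion
thus becomes a central limit theorem for Y = Re(conj t · Σ z^{e(F)}) on a torus. It is proved
through characteristic functions by a Stein-type argument. Attach to each F a prime p(F) dividing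
it. The summand of F is an angular derivative in the coordinate p(F), so rotation invariance gives
φ'(s) = -s E[Γ e^{isY}], where Γ is a sum over pairs (F, G) with p(F) ∣ G. If Γ is L¹-close to the
constant v = |t|²|S|/2, then φ(1) is close to e^{-v/2}; this is `norm_integral_exp_torusSum_sub_le`.
By orthogonality of monomials, the variance of Γ is controlled by |S|, the number of pairs F ≠ G
with p(F) ∣ G, and the number of nontrivial solutions of F₁F₂ = G₁G₂. It suffices that the two
counts are small compared with |A|², for a subset S of A with |A \ S| = o(|A|)
(`norm_integral_exp_torusSum_sub_le_of_subset`).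

Pairs: if p(F) always has degree greater than D, a proportion at most q^{-(D+1)} of all pairs is
linked. The integration by parts also needs p(F) to have equal exponents in F and in G. Since two
elements of the interval differ by a polynomial of degree at most h, only primes of degree at most h
matter, and for those it is enough that they occur to the first power. Almost every F qualifies
(`exists_regularSet`): if h is large, D is taken fixed and large; if q is large, D = 0.

Solutions: F₁F₂ = G₁G₂ forces F₁ = AB, F₂ = CD, G₁ = AC, G₂ = BD with deg A, deg B ≤ h. For each
value of deg A there are at most q^{3(h+1)-N} quadruples, which gives N q^{3(h+1)-N} in total and
case (a). For case (b), S is restricted further to F with at most about (1+ε) log N small prime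
factors, and each quadruple is weighted by 2^{-ω} of its four factors. The restriction costs
4^{(1+ε) log N} = N^{(1+ε) 2 log 2}. By Brun's sieve the mean of 2^{-ω} over a ball of size q^x is
about x^{-1/2} up to logarithms, so the four weights and the sum over deg A together contribute
N^{-1} up to logarithms. The exponent is 2 log 2 - 1. A weight z^ω would give 4z - 3 - 2 log z for z
≥ 1/2, which is smallest at z = 1/2. -/

noncomputable section

open Classical UniqueFactorizationMonoid

/-! ### Balls in k[t] and their divisibility counts. -/

section Balls

variable {k : Type*} [Field k]

theorem polyBall_finite [Finite k] (C : k[X]) (x : ℕ) :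
    {F : k[X] | (F - C).degree < (x : WithBot ℕ)}.Finite := by
  have : Finite (Polynomial.degreeLT k x) :=
    Finite.of_equiv _ (Polynomial.degreeLTEquiv k x).toEquiv.symm
  refine (Set.toFinite ((· + C) '' ((Polynomial.degreeLT k x : Submodule k k[X]) : Set k[X]))).subset ?_
  intro F hF
  exact ⟨F - C, Polynomial.mem_degreeLT.2 hF, by simp⟩

/-- The polynomials `F` with `deg (F - C) < x`. -/
def polyBall [Finite k] (C : k[X]) (x : ℕ) : Finset k[X] := (polyBall_finite C x).toFinset

variable [Finite k]

theorem mem_polyBall {C F : k[X]} {x : ℕ} :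
    F ∈ polyBall C x ↔ (F - C).degree < (x : WithBot ℕ) := by
  simp [polyBall]

theorem card_polyBall (C : k[X]) (x : ℕ) : (polyBall C x).card = Nat.card k ^ x := by
  have e : (polyBall C x : Set k[X]) ≃ Polynomial.degreeLT k x :=
    { toFun := fun F => ⟨F.1 - C, Polynomial.mem_degreeLT.2 (mem_polyBall.1 F.2)⟩
      invFun := fun G => ⟨G.1 + C, mem_polyBall.2 (by
        simpa using Polynomial.mem_degreeLT.1 G.2)⟩
      left_inv := fun F => by simp
      right_inv := fun G => by simp }
  have h1 : Nat.card (polyBall C x : Set k[X]) = (polyBall C x).card := by simp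
  rw [← h1, Nat.card_congr e, Nat.card_congr (Polynomial.degreeLTEquiv k x).toEquiv,
    Nat.card_fun, Nat.card_fin]

theorem one_lt_natCard : 1 < Nat.card k := Finite.one_lt_card

/-- The remainder of C modulo A has degree below deg A ≤ x, so discarding it does not affect the
condition. Multiples of A in a ball therefore form a ball again, and counts of multiples are exact
with no error term. -/
theorem mul_mem_polyBall_iff {A B C : k[X]} {x : ℕ} (hA : A.Monic) (hx : A.natDegree ≤ x) :
    A * B ∈ polyBall C x ↔ B ∈ polyBall (C /ₘ A) (x - A.natDegree) := by
  rw [mem_polyBall, mem_polyBall]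
  have h1 : A * B - C = A * (B - C /ₘ A) - C %ₘ A := by
    conv_lhs => rw [← Polynomial.modByMonic_add_div C A]
    ring
  have h2 : (C %ₘ A).degree < (x : WithBot ℕ) :=
    (Polynomial.degree_modByMonic_lt C hA).trans_le
      (Polynomial.degree_le_natDegree.trans (by exact_mod_cast hx))
  have h3 : (A * B - C).degree < (x : WithBot ℕ) ↔
      (A * (B - C /ₘ A)).degree < (x : WithBot ℕ) := by
    rw [h1]
    constructor
    · intro h
      rw [← sub_add_cancel (A * (B - C /ₘ A)) (C %ₘ A)]
      exact (Polynomial.degree_add_le _ _).trans_lt (max_lt h h2)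
    · intro h
      exact (Polynomial.degree_sub_le _ _).trans_lt (max_lt h h2)
  rw [h3, Polynomial.degree_mul, Polynomial.degree_eq_natDegree hA.ne_zero]
  by_cases h0 : B - C /ₘ A = 0
  · simp [h0]
  · rw [Polynomial.degree_eq_natDegree h0]
    norm_cast
    omega

theorem filter_dvd_polyBall {D : k[X]} (hD : D.Monic) (C : k[X]) {x : ℕ} (hx : D.natDegree ≤ x) :
    (polyBall C x).filter (D ∣ ·) =
      (polyBall (C /ₘ D) (x - D.natDegree)).image (D * ·) := by
  ext F
  simp only [Finset.mem_filter, Finset.mem_image]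
  constructor
  · rintro ⟨hF, B, rfl⟩
    exact ⟨B, (mul_mem_polyBall_iff hD hx).1 hF, rfl⟩
  · rintro ⟨B, hB, rfl⟩
    exact ⟨(mul_mem_polyBall_iff hD hx).2 hB, dvd_mul_right _ _⟩

theorem card_filter_dvd_polyBall {D : k[X]} (hD : D.Monic) (C : k[X]) {x : ℕ}
    (hx : D.natDegree ≤ x) :
    ((polyBall C x).filter (D ∣ ·)).card = Nat.card k ^ (x - D.natDegree) := by
  rw [filter_dvd_polyBall hD C hx, Finset.card_image_of_injective _
    (mul_right_injective₀ hD.ne_zero), card_polyBall]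

theorem sub_degree_lt_of_mem_polyBall {C F G : k[X]} {x : ℕ} (hF : F ∈ polyBall C x)
    (hG : G ∈ polyBall C x) : (F - G).degree < (x : WithBot ℕ) := by
  rw [mem_polyBall] at hF hG
  have : F - G = (F - C) - (G - C) := by ring
  rw [this]
  exact (Polynomial.degree_sub_le _ _).trans_lt (max_lt hF hG)

/-- The divisor D divides the nonzero difference F - G, whose degree is below x. This limits every
multiplicative interaction inside an interval to divisors of small degree. -/
theorem natDegree_lt_of_dvd_of_mem_polyBall {C F G D : k[X]} {x : ℕ} (hF : F ∈ polyBall C x)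
    (hG : G ∈ polyBall C x) (hne : F ≠ G) (h1 : D ∣ F) (h2 : D ∣ G) : D.natDegree < x := by
  have h0 : F - G ≠ 0 := sub_ne_zero.2 hne
  have h3 := sub_degree_lt_of_mem_polyBall hF hG
  rw [Polynomial.degree_eq_natDegree h0] at h3
  exact (Polynomial.natDegree_le_of_dvd (dvd_sub h1 h2) h0).trans_lt (by exact_mod_cast h3)

theorem card_filter_dvd_polyBall_le_one {D : k[X]} (C : k[X]) {x : ℕ}
    (hx : x ≤ D.natDegree) :
    ((polyBall C x).filter (D ∣ ·)).card ≤ 1 := by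
  refine Finset.card_le_one.2 fun F hF G hG => ?_
  rw [Finset.mem_filter] at hF hG
  by_contra hne
  exact absurd (natDegree_lt_of_dvd_of_mem_polyBall hF.1 hG.1 hne hF.2 hG.2) (by omega)

theorem monic_natDegree_of_mem_polyBall {K F : k[X]} {x : ℕ} (hK : K.Monic)
    (hx : x ≤ K.natDegree) (hF : F ∈ polyBall K x) : F.Monic ∧ F.natDegree = K.natDegree := by
  rw [mem_polyBall] at hF
  have h1 : (F - K).degree < K.degree :=
    hF.trans_le (by rw [Polynomial.degree_eq_natDegree hK.ne_zero]; exact_mod_cast hx)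
  have h2 : F = (F - K) + K := by ring
  constructor
  · rw [h2]; exact hK.add_of_right h1
  · rw [h2]; exact Polynomial.natDegree_add_eq_right_of_degree_lt h1

theorem polyInterval_eq_polyBall {K : k[X]} {N h : ℕ} (hK : K.Monic) (hN : K.natDegree = N)
    (hh : h + 1 ≤ N) : polyInterval N K h = polyBall K (h + 1) := by
  ext F
  have hlt : (F - K).degree < ((h + 1 : ℕ) : WithBot ℕ) ↔ (F - K).degree ≤ (h : WithBot ℕ) := by
    by_cases h0 : F - K = 0
    · simp [h0]
    · rw [Polynomial.degree_eq_natDegree h0]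
      norm_cast
      omega
  simp only [polyInterval, Set.Finite.mem_toFinset, polyIntervalSet, Set.mem_ofPred_eq]
  constructor
  · rintro ⟨-, -, h3⟩
    exact mem_polyBall.2 (hlt.2 h3)
  · intro hF
    obtain ⟨h1, h2⟩ := monic_natDegree_of_mem_polyBall hK (by omega) hF
    exact ⟨h1, h2.trans hN, hlt.1 (mem_polyBall.1 hF)⟩

/-- The monic polynomials of degree `n` form a ball around `X ^ n`. -/
theorem mem_polyBall_X_pow {F : k[X]} (hF : F.Monic) :
    F ∈ polyBall (Polynomial.X ^ F.natDegree) F.natDegree := by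
  rw [mem_polyBall]
  refine (Polynomial.degree_sub_lt_left ?_ hF.ne_zero ?_).trans_le Polynomial.degree_le_natDegree
  · rw [Polynomial.degree_X_pow, Polynomial.degree_eq_natDegree hF.ne_zero]
  · rw [hF.leadingCoeff, Polynomial.leadingCoeff_X_pow]

end Balls

/-! ### Counting monic irreducible polynomials. -/

section Primes

variable {k : Type*} [Field k]

theorem monicPrime_natDegree_pos (P : MonicPrime k) : 0 < P.1.natDegree :=
  P.2.2.natDegree_pos

theorem coprime_monicPrime {P Q : MonicPrime k} (h : P ≠ Q) : IsCoprime P.1 Q.1 := by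
  refine (P.2.2.coprime_iff_not_dvd).2 fun hd => h ?_
  exact Subtype.ext (Polynomial.eq_of_monic_of_associated P.2.1 Q.2.1
    (P.2.2.associated_of_dvd Q.2.2 hd))

theorem prod_monicPrime_dvd_iff (T : Finset (MonicPrime k)) (F : k[X]) :
    (∏ P ∈ T, P.1) ∣ F ↔ ∀ P ∈ T, P.1 ∣ F := by
  constructor
  · exact fun h P hP => (Finset.dvd_prod_of_mem (fun P : MonicPrime k => P.1) hP).trans h
  · exact fun h => Finset.prod_dvd_of_coprime
      (fun P _ Q _ hPQ => coprime_monicPrime hPQ) h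

theorem monic_prod_monicPrime (T : Finset (MonicPrime k)) : (∏ P ∈ T, P.1).Monic :=
  Polynomial.monic_prod_of_monic _ _ fun P _ => P.2.1

theorem natDegree_prod_monicPrime (T : Finset (MonicPrime k)) :
    (∏ P ∈ T, P.1).natDegree = ∑ P ∈ T, P.1.natDegree :=
  Polynomial.natDegree_prod_of_monic _ _ fun P _ => P.2.1

variable [Finite k]

theorem finite_monicPrime_le (y : ℕ) : {P : MonicPrime k | P.1.natDegree ≤ y}.Finite := by
  refine Set.Finite.of_finite_image (f := Subtype.val) ?_ Subtype.val_injective.injOn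
  refine (polyBall_finite (0 : k[X]) (y + 1)).subset ?_
  rintro _ ⟨P, hP, rfl⟩
  simp only [Set.mem_ofPred_eq, sub_zero] at hP ⊢
  exact Polynomial.degree_le_natDegree.trans_lt (by exact_mod_cast Nat.lt_succ_of_le hP)

variable (k) in
/-- The monic irreducible polynomials `P` with `m < deg P ≤ y`. -/
def primesIoc (m y : ℕ) : Finset (MonicPrime k) :=
  (finite_monicPrime_le (k := k) y).toFinset.filter (m < ·.1.natDegree)

theorem mem_primesIoc {m y : ℕ} {P : MonicPrime k} :
    P ∈ primesIoc k m y ↔ m < P.1.natDegree ∧ P.1.natDegree ≤ y := by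
  simp [primesIoc, and_comm]

/-- X^(q^n) - X is squarefree and its monic irreducible factors are exactly those of degree dividing
n; comparing degrees gives the identity. -/
theorem sum_natDegree_primes_dvd {n : ℕ} (hn : n ≠ 0) :
    ∑ P ∈ (primesIoc k 0 n).filter (fun P => P.1.natDegree ∣ n), P.1.natDegree
      = Nat.card k ^ n := by
  obtain ⟨p, hp⟩ := CharP.exists k
  have : Fact p.Prime := ⟨CharP.char_is_prime k p⟩
  set q := Nat.card k with hq
  have hq1 : 1 < q := one_lt_natCard
  set Q : k[X] := Polynomial.X ^ q ^ n - Polynomial.X with hQ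
  have hQm : Q.Monic := Polynomial.monic_X_pow_sub (by
    rw [Polynomial.degree_X]; exact_mod_cast Nat.one_lt_pow hn hq1)
  have hQd : Q.natDegree = q ^ n := FiniteField.X_pow_card_pow_sub_X_natDegree_eq k hn hq1
  have hpq : p ∣ q ^ n := by
    have h1 : p ∣ q := by
      have := Fintype.ofFinite k
      obtain ⟨m, -, hm⟩ := FiniteField.card k p
      rw [hq, Nat.card_eq_fintype_card, hm]
      exact dvd_pow_self _ m.ne_zero
    exact h1.trans (dvd_pow_self _ hn)
  have hsq : Squarefree Q := (galois_poly_separable p (q ^ n) hpq).squarefree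
  have hnd : (normalizedFactors Q).Nodup :=
    (squarefree_iff_nodup_normalizedFactors hQm.ne_zero).1 hsq
  have hmem : ∀ P ∈ normalizedFactors Q, P.Monic ∧ Irreducible P ∧ P ∣ Q := fun P hP =>
    ⟨by simpa [normalize_normalized_factor P hP] using
      Polynomial.monic_normalize (irreducible_of_normalized_factor P hP).ne_zero,
      irreducible_of_normalized_factor P hP, dvd_of_mem_normalizedFactors hP⟩
  have hdeg : ((normalizedFactors Q).map Polynomial.natDegree).sum = q ^ n := by
    rw [← Polynomial.natDegree_multiset_prod_of_monic _ (fun P hP => (hmem P hP).1),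
      prod_normalizedFactors_eq hQm.ne_zero, hQm.normalize_eq_self, hQd]
  have h2 : ∑ P ∈ (normalizedFactors Q).toFinset, P.natDegree = q ^ n := by
    rw [← hdeg, Finset.sum, Multiset.toFinset_val, hnd.dedup]
  rw [← h2]
  refine Finset.sum_bij (fun P _ => P.1) ?_ (fun _ _ _ _ h => Subtype.ext h) ?_ (fun _ _ => rfl)
  · intro P hP
    rw [Finset.mem_filter] at hP
    rw [Multiset.mem_toFinset]
    exact (mem_normalizedFactors_iff' hQm.ne_zero).2 ⟨P.2.2, P.2.1.normalize_eq_self,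
      P.2.2.natDegree_dvd_iff_dvd_X_pow_card_pow_sub_X.1 hP.2⟩
  · intro P hP
    rw [Multiset.mem_toFinset] at hP
    obtain ⟨h3, h4, h5⟩ := hmem P hP
    refine ⟨⟨P, h3, h4⟩, ?_, rfl⟩
    have h6 := h4.natDegree_dvd_of_dvd_X_pow_card_pow_sub_X h5
    exact Finset.mem_filter.2 ⟨mem_primesIoc.2 ⟨h4.natDegree_pos,
      Nat.le_of_dvd (Nat.pos_of_ne_zero hn) h6⟩, h6⟩

variable (k) in
/-- The monic irreducible polynomials of degree `n`. -/
abbrev primesEq (n : ℕ) : Finset (MonicPrime k) :=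
  (primesIoc k 0 n).filter (·.1.natDegree = n)

theorem mem_primesEq {n : ℕ} {P : MonicPrime k} : P ∈ primesEq k n ↔ P.1.natDegree = n := by
  have := monicPrime_natDegree_pos P
  simp only [primesEq, Finset.mem_filter, mem_primesIoc]
  omega

theorem mul_card_primesEq_le {n : ℕ} (hn : n ≠ 0) :
    n * (primesEq k n).card ≤ Nat.card k ^ n := by
  rw [← sum_natDegree_primes_dvd hn, mul_comm, ← smul_eq_mul,
    ← Finset.sum_const]
  calc _ = ∑ P ∈ primesEq k n, P.1.natDegree :=
        Finset.sum_congr rfl fun P hP => (mem_primesEq.1 hP).symm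
    _ ≤ _ := Finset.sum_le_sum_of_subset fun P hP => by
        have h := mem_primesEq.1 hP
        exact Finset.mem_filter.2 ⟨(Finset.mem_filter.1 hP).1, h ▸ dvd_rfl⟩

theorem sum_primesIoc_eq {M : Type*} [AddCommMonoid M] (m y : ℕ) (g : MonicPrime k → M) :
    ∑ P ∈ primesIoc k m y, g P = ∑ n ∈ Finset.Ioc m y, ∑ P ∈ primesEq k n, g P := by
  rw [← Finset.sum_fiberwise_of_maps_to (s := primesIoc k m y) (t := Finset.Ioc m y)
    (g := fun P => P.1.natDegree) (fun P hP => Finset.mem_Ioc.2 (mem_primesIoc.1 hP))]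
  refine Finset.sum_congr rfl fun n hn => Finset.sum_congr ?_ fun _ _ => rfl
  ext P
  rw [Finset.mem_filter, mem_primesIoc, mem_primesEq]
  have := Finset.mem_Ioc.1 hn
  omega

/-- In the exact formula for q^n, every degree other than n is a proper divisor of n, hence at most
n / 2. Those degrees contribute at most a geometric sum dominated by its last term. -/
theorem card_pow_le_mul_card_primesEq {n : ℕ} (hn : n ≠ 0) :
    Nat.card k ^ n ≤ n * (primesEq k n).card + 2 * Nat.card k ^ (n / 2) := by
  set q := Nat.card k with hq
  have hq1 : 1 < q := one_lt_natCard
  have hgeo : ∀ m, ∑ i ∈ Finset.Ioc 0 m, q ^ i ≤ 2 * q ^ m := by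
    intro m
    induction m with
    | zero => simp
    | succ m ih =>
      rw [Finset.sum_Ioc_succ_top (Nat.zero_le m), pow_succ]
      nlinarith [Nat.zero_le (q ^ m)]
  conv_lhs => rw [hq, ← sum_natDegree_primes_dvd hn]
  calc _ ≤ ∑ P ∈ primesEq k n ∪ primesIoc k 0 (n / 2), P.1.natDegree := by
        refine Finset.sum_le_sum_of_subset fun P hP => ?_
        obtain ⟨h1, h2⟩ := Finset.mem_filter.1 hP
        rw [Finset.mem_union, mem_primesEq, mem_primesIoc]
        have h3 := monicPrime_natDegree_pos P
        by_cases h4 : P.1.natDegree = n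
        · exact Or.inl h4
        · refine Or.inr ⟨h3, ?_⟩
          obtain ⟨c, hc⟩ := h2
          have : 2 ≤ c := by
            rcases c with _ | _ | c
            · omega
            · omega
            · omega
          rw [Nat.le_div_iff_mul_le (by norm_num)]
          nlinarith
    _ ≤ ∑ P ∈ primesEq k n, P.1.natDegree + ∑ P ∈ primesIoc k 0 (n / 2), P.1.natDegree :=
        (Nat.le_add_right _ _).trans_eq Finset.sum_union_inter
    _ ≤ _ := by
        gcongr
        · rw [Finset.sum_congr rfl fun P hP => (mem_primesEq.1 hP), Finset.sum_const, smul_eq_mul,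
            mul_comm]
        · rw [sum_primesIoc_eq]
          refine le_trans (Finset.sum_le_sum fun i hi => ?_) (hgeo _)
          rw [Finset.sum_congr rfl fun P hP => (mem_primesEq.1 hP), Finset.sum_const, smul_eq_mul,
            mul_comm]
          exact mul_card_primesEq_le (by have := Finset.mem_Ioc.1 hi; omega)

end Primes
end

noncomputable section

open Classical UniqueFactorizationMonoid

/-! ### Mertens-type sums over primes, uniform in q. -/

section PrimeSums

variable {k : Type*} [Field k]

/-- The inverse `|P|⁻¹` of the norm of a monic irreducible polynomial. -/
def invNorm (P : MonicPrime k) : ℝ := ((Nat.card k : ℝ) ^ P.1.natDegree)⁻¹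

theorem invNorm_nonneg (P : MonicPrime k) : 0 ≤ invNorm P := by
  unfold invNorm; positivity

variable [Finite k]

variable (k) in
theorem two_le_natCard_real : (2 : ℝ) ≤ Nat.card k := by
  exact_mod_cast (one_lt_natCard (k := k))

variable (k) in
theorem natCard_real_pos : (0 : ℝ) < Nat.card k := by
  linarith [two_le_natCard_real k]

theorem invNorm_le_half (P : MonicPrime k) : invNorm P ≤ 1 / 2 := by
  unfold invNorm
  rw [one_div]
  refine inv_anti₀ (by norm_num) ?_
  exact (two_le_natCard_real k).trans
    (le_self_pow₀ (by linarith [two_le_natCard_real k]) (monicPrime_natDegree_pos P).ne')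

theorem sum_primesEq_invNorm_pow (n j : ℕ) :
    ∑ P ∈ primesEq k n, invNorm P ^ j
      = (primesEq k n).card * (((Nat.card k : ℝ) ^ n)⁻¹) ^ j := by
  rw [Finset.sum_congr rfl fun P hP => by rw [invNorm, mem_primesEq.1 hP], Finset.sum_const,
    nsmul_eq_mul]

theorem card_primesEq_le {n : ℕ} (hn : n ≠ 0) :
    ((primesEq k n).card : ℝ) ≤ (Nat.card k : ℝ) ^ n / n := by
  rw [le_div_iff₀ (by positivity), mul_comm]
  exact_mod_cast mul_card_primesEq_le hn

theorem sum_invNorm_le_log (y : ℕ) :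
    ∑ P ∈ primesIoc k 0 y, invNorm P ≤ 1 + Real.log y := by
  refine le_trans ?_ (harmonic_le_one_add_log y)
  rw [sum_primesIoc_eq, harmonic_eq_sum_Icc, ← Finset.Icc_add_one_left_eq_Ioc]
  push_cast
  refine Finset.sum_le_sum fun n hn => ?_
  have hn0 : n ≠ 0 := by have := Finset.mem_Icc.1 hn; omega
  have h := sum_primesEq_invNorm_pow (k := k) n 1
  simp only [pow_one] at h
  rw [h]
  have hq := natCard_real_pos k
  calc _ ≤ (Nat.card k : ℝ) ^ n / n * ((Nat.card k : ℝ) ^ n)⁻¹ := by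
        gcongr; exact card_primesEq_le hn0
    _ = _ := by field_simp

/-- Passing from n to n + 2 halves the left side, and 1/2 ≤ (3/4)². It turns the relative error
q^(n/2) / q^n of the prime count into a summable sequence independent of q. -/
theorem half_pow_sub_half_le (n : ℕ) : ((2 : ℝ) ^ (n - n / 2))⁻¹ ≤ (3 / 4) ^ n := by
  induction n using Nat.strong_induction_on with
  | _ n ih =>
    rcases n with _ | _ | n
    · norm_num
    · norm_num
    · have h1 : n + 1 + 1 - (n + 1 + 1) / 2 = (n - n / 2) + 1 := by omega
      rw [h1, pow_succ, mul_inv, pow_succ, pow_succ]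
      have := ih n (by omega)
      have h3 : (0 : ℝ) < (3 / 4) ^ n := by positivity
      nlinarith

/-- Degree n contributes at least 1/n - 2(3/4)^n, and the geometric errors total at most 6. The
constant does not depend on the field, as required when q varies. -/
theorem log_le_sum_invNorm (y : ℕ) :
    Real.log (y + 1) - 8 ≤ ∑ P ∈ primesIoc k 0 y, invNorm P := by
  have hlog := log_add_one_le_harmonic y
  have hq := two_le_natCard_real k
  have hgeo : ∀ m : ℕ, ∑ n ∈ Finset.Icc 1 m, 2 * (3 / 4 : ℝ) ^ n ≤ 6 - 6 * (3 / 4) ^ m := by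
    intro m
    induction m with
    | zero => simp
    | succ m ih =>
      rw [Finset.sum_Icc_succ_top (by omega), pow_succ]
      linarith
  have h1 : ∀ n ∈ Finset.Icc 1 y, ((n : ℝ))⁻¹ - 2 * (3 / 4 : ℝ) ^ n
      ≤ ∑ P ∈ primesEq k n, invNorm P := by
    intro n hn
    have hn1 : 1 ≤ n := (Finset.mem_Icc.1 hn).1
    have hn1' : (1 : ℝ) ≤ n := by exact_mod_cast hn1
    have h := sum_primesEq_invNorm_pow (k := k) n 1
    simp only [pow_one] at h
    rw [h]
    have hc : (Nat.card k : ℝ) ^ n ≤ n * (primesEq k n).card + 2 * (Nat.card k : ℝ) ^ (n / 2) := by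
      exact_mod_cast card_pow_le_mul_card_primesEq (k := k) (n := n) (by omega)
    set c : ℝ := ((primesEq k n).card : ℝ)
    set q : ℝ := (Nat.card k : ℝ)
    have hqn : 0 < q ^ n := by positivity
    have h3 : q ^ (n / 2) * (q ^ n)⁻¹ ≤ (3 / 4) ^ n := by
      have : q ^ n = q ^ (n / 2) * q ^ (n - n / 2) := by rw [← pow_add]; congr 1; omega
      rw [this, mul_inv, ← mul_assoc, mul_inv_cancel₀ (by positivity), one_mul]
      refine le_trans ?_ (half_pow_sub_half_le n)
      gcongr
    have h4 : (1 : ℝ) ≤ n * (c * (q ^ n)⁻¹) + 2 * (3 / 4) ^ n := by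
      have := mul_le_mul_of_nonneg_right hc (inv_nonneg.2 hqn.le)
      rw [mul_inv_cancel₀ hqn.ne'] at this
      nlinarith
    have h5 : (n : ℝ)⁻¹ * 1 ≤ (n : ℝ)⁻¹ * (n * (c * (q ^ n)⁻¹) + 2 * (3 / 4) ^ n) := by
      gcongr
    have h6 : (n : ℝ)⁻¹ * (n * (c * (q ^ n)⁻¹) + 2 * (3 / 4) ^ n)
        = c * (q ^ n)⁻¹ + (n : ℝ)⁻¹ * (2 * (3 / 4) ^ n) := by field_simp
    have h7 : (n : ℝ)⁻¹ * (2 * (3 / 4) ^ n) ≤ 1 * (2 * (3 / 4) ^ n) := by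
      gcongr
      exact inv_le_one_of_one_le₀ hn1'
    linarith
  rw [sum_primesIoc_eq, ← Finset.Icc_add_one_left_eq_Ioc, zero_add]
  have h2 := Finset.sum_le_sum h1
  rw [Finset.sum_sub_distrib] at h2
  rw [harmonic_eq_sum_Icc] at hlog
  push_cast at hlog
  have := hgeo y
  have h3 : (0 : ℝ) < (3 / 4) ^ y := by positivity
  linarith

theorem log_sub_log_le_sum_invNorm {m y : ℕ} (hm : m ≤ y) :
    Real.log (y + 1) - 9 - Real.log m ≤ ∑ P ∈ primesIoc k m y, invNorm P := by
  have h1 := log_le_sum_invNorm (k := k) y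
  have h2 := sum_invNorm_le_log (k := k) m
  rw [sum_primesIoc_eq] at h1 h2 ⊢
  rw [← Finset.sum_Ioc_consecutive _ (Nat.zero_le m) hm] at h1
  linarith

theorem sum_invNorm_sq_le (m y : ℕ) :
    ∑ P ∈ primesIoc k m y, invNorm P ^ 2 ≤ 2 * ((Nat.card k : ℝ) ^ (m + 1))⁻¹ := by
  have hq := two_le_natCard_real k
  have hgeo : ∀ d : ℕ, ∑ n ∈ Finset.Ioc m (m + d), ((Nat.card k : ℝ) ^ n)⁻¹ ≤
      2 * ((Nat.card k : ℝ) ^ (m + 1))⁻¹ - 2 * ((Nat.card k : ℝ) ^ (m + d + 1))⁻¹ := by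
    intro d
    induction d with
    | zero => simp
    | succ d ih =>
      rw [← add_assoc, Finset.sum_Ioc_succ_top (by omega)]
      have h1 : ((Nat.card k : ℝ) ^ (m + d + 1 + 1))⁻¹ ≤ ((Nat.card k : ℝ) ^ (m + d + 1))⁻¹ / 2 := by
        rw [pow_succ _ (m + d + 1), mul_inv, div_eq_mul_inv]
        gcongr
      linarith
  rcases le_total m y with hmy | hmy
  · obtain ⟨d, rfl⟩ := Nat.exists_eq_add_of_le hmy
    rw [sum_primesIoc_eq]
    refine le_trans (Finset.sum_le_sum fun n hn => ?_) ((hgeo d).trans ?_)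
    · have hn0 : n ≠ 0 := by have := Finset.mem_Ioc.1 hn; omega
      have hn1 : (1 : ℝ) ≤ n := by exact_mod_cast Nat.pos_of_ne_zero hn0
      rw [sum_primesEq_invNorm_pow]
      calc _ ≤ (Nat.card k : ℝ) ^ n / 1 * (((Nat.card k : ℝ) ^ n)⁻¹) ^ 2 := by
            gcongr
            exact (card_primesEq_le hn0).trans (by gcongr)
        _ = _ := by field_simp
    · have : (0 : ℝ) ≤ ((Nat.card k : ℝ) ^ (m + d + 1))⁻¹ := by positivity
      linarith
  · have : primesIoc k m y = ∅ := by
      ext P; simp only [mem_primesIoc, Finset.notMem_empty, iff_false]; omega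
    rw [this, Finset.sum_empty]
    positivity

end PrimeSums

/-! ### Second moment of the number of prime factors on a ball. -/

section Moments

variable {k : Type*} [Field k]

/-- The number of primes in `s` dividing `F`. -/
def omegaOn (s : Finset (MonicPrime k)) (F : k[X]) : ℕ := (s.filter (·.1 ∣ F)).card

theorem omegaOn_mono {s t : Finset (MonicPrime k)} (h : s ⊆ t) (F : k[X]) :
    omegaOn s F ≤ omegaOn t F :=
  Finset.card_le_card (Finset.filter_subset_filter _ h)

variable [Finite k]

theorem card_filter_dvd_polyBall_real {D : k[X]} (hD : D.Monic) (C : k[X]) {x : ℕ}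
    (hx : D.natDegree ≤ x) :
    (((polyBall C x).filter (D ∣ ·)).card : ℝ)
      = (Nat.card k : ℝ) ^ x * ((Nat.card k : ℝ) ^ D.natDegree)⁻¹ := by
  rw [card_filter_dvd_polyBall hD C hx]
  have hq := natCard_real_pos k
  push_cast
  rw [pow_sub₀ _ hq.ne' hx]

theorem card_filter_forall_dvd {T : Finset (MonicPrime k)} (C : k[X]) {x : ℕ}
    (hx : ∑ P ∈ T, P.1.natDegree ≤ x) :
    (((polyBall C x).filter (fun F => ∀ P ∈ T, P.1 ∣ F)).card : ℝ)
      = (Nat.card k : ℝ) ^ x * ∏ P ∈ T, invNorm P := by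
  have h1 : (polyBall C x).filter (fun F => ∀ P ∈ T, P.1 ∣ F)
      = (polyBall C x).filter ((∏ P ∈ T, P.1) ∣ ·) :=
    Finset.filter_congr fun F _ => (prod_monicPrime_dvd_iff T F).symm
  rw [h1, card_filter_dvd_polyBall_real (monic_prod_monicPrime T) C
    (by rwa [natDegree_prod_monicPrime]), natDegree_prod_monicPrime, ← Finset.prod_pow_eq_pow_sum,
    ← Finset.prod_inv_distrib]
  rfl

/-- A Turán–Kubilius inequality. Since 2y ≤ x, divisibility by one prime or by two distinct primes
of s has exactly the expected frequency, so the variance comes only from the diagonal terms. -/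
theorem sum_omegaOn_sub_sq_le (s : Finset (MonicPrime k)) {y x : ℕ}
    (hs : ∀ P ∈ s, P.1.natDegree ≤ y) (hx : 2 * y ≤ x) (C : k[X]) :
    ∑ F ∈ polyBall C x, ((omegaOn s F : ℝ) - ∑ P ∈ s, invNorm P) ^ 2
      ≤ (Nat.card k : ℝ) ^ x * ∑ P ∈ s, invNorm P := by
  set L := ∑ P ∈ s, invNorm P with hL
  set Q := (Nat.card k : ℝ) ^ x with hQ
  have hom : ∀ F, (omegaOn s F : ℝ) = ∑ P ∈ s, if P.1 ∣ F then (1 : ℝ) else 0 := by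
    intro F; simp [omegaOn]
  have h1 : ∑ F ∈ polyBall C x, (omegaOn s F : ℝ) = Q * L := by
    simp_rw [hom]
    rw [Finset.sum_comm, hL, Finset.mul_sum]
    refine Finset.sum_congr rfl fun P hP => ?_
    have := card_filter_dvd_polyBall_real P.2.1 C (x := x) (by have := hs P hP; omega)
    rw [Finset.sum_boole, this]; rfl
  have h2 : ∑ F ∈ polyBall C x, (omegaOn s F : ℝ) ^ 2 ≤ Q * (L ^ 2 + L) := by
    simp_rw [hom, sq, Finset.sum_mul_sum]
    rw [Finset.sum_comm]
    have : ∀ P ∈ s, ∑ F ∈ polyBall C x, ∑ P' ∈ s,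
        (if P.1 ∣ F then (1 : ℝ) else 0) * (if P'.1 ∣ F then (1 : ℝ) else 0)
        ≤ Q * (invNorm P * L + invNorm P) := by
      intro P hP
      rw [Finset.sum_comm]
      have h3 : ∀ P' ∈ s, ∑ F ∈ polyBall C x,
          (if P.1 ∣ F then (1 : ℝ) else 0) * (if P'.1 ∣ F then (1 : ℝ) else 0)
          ≤ Q * (invNorm P * invNorm P' + if P = P' then invNorm P else 0) := by
        intro P' hP'
        have hd := hs P hP
        have hd' := hs P' hP'
        by_cases hPP : P = P'
        · subst hPP
          have h4 := card_filter_dvd_polyBall_real P.2.1 C (x := x) (by omega)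
          simp only [ite_mul, one_mul, zero_mul, ← ite_and, and_self, if_true]
          rw [Finset.sum_boole, h4]
          have h5 := mul_nonneg (invNorm_nonneg P) (invNorm_nonneg P)
          have hQ0 : 0 ≤ Q := by positivity
          rw [mul_add]
          have := mul_nonneg hQ0 h5
          have h6 : Q * ((Nat.card k : ℝ) ^ P.1.natDegree)⁻¹ = Q * invNorm P := rfl
          rw [← hQ, h6]
          linarith
        · have h4 := card_filter_forall_dvd (T := {P, P'}) C (x := x) (by
            rw [Finset.sum_pair hPP]; omega)
          rw [Finset.prod_pair hPP] at h4
          rw [if_neg hPP, add_zero, hQ, ← h4]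
          simp only [ite_mul, one_mul, zero_mul, ← ite_and]
          rw [Finset.sum_boole]
          simp
      refine (Finset.sum_le_sum h3).trans_eq ?_
      rw [← Finset.mul_sum, Finset.sum_add_distrib, ← Finset.mul_sum]
      simp [hP, hL]
    refine (Finset.sum_le_sum this).trans_eq ?_
    rw [← Finset.mul_sum, Finset.sum_add_distrib, ← Finset.sum_mul]
  have h3 : ∑ F ∈ polyBall C x, (L ^ 2 : ℝ) = Q * L ^ 2 := by
    rw [Finset.sum_const, card_polyBall, nsmul_eq_mul]; push_cast; rfl
  calc _ = ∑ F ∈ polyBall C x, (omegaOn s F : ℝ) ^ 2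
        - 2 * L * ∑ F ∈ polyBall C x, (omegaOn s F : ℝ) + ∑ F ∈ polyBall C x, (L ^ 2 : ℝ) := by
        rw [Finset.mul_sum, ← Finset.sum_sub_distrib, ← Finset.sum_add_distrib]
        exact Finset.sum_congr rfl fun F _ => by ring
    _ ≤ _ := by rw [h1, h3]; nlinarith

end Moments

/-! ### Brun's sieve for the mean of 2^(-ω). -/

section Sieve

/-- By Pascal's rule the truncation error satisfies E(n+1, J+1) = E(n, J+1) - E(n, J)/2, so
alternating signs in J propagate by induction on n. -/
theorem bonferroni_half (n J : ℕ) :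
    0 ≤ (-1 : ℝ) ^ J * (∑ j ∈ Finset.range (J + 1), (n.choose j : ℝ) * (-(1 / 2)) ^ j
      - (1 / 2) ^ n) := by
  induction n generalizing J with
  | zero =>
    rw [Finset.sum_range_succ']
    simp
  | succ n ih =>
    rcases J with _ | J
    · simp only [pow_zero, zero_add, Finset.range_one, Finset.sum_singleton, Nat.choose_zero_right,
        Nat.cast_one, mul_one, one_mul, sub_nonneg]
      exact pow_le_one₀ (by norm_num) (by norm_num)
    · have h1 := ih (J + 1)
      have h2 := ih J
      have h3 : ∑ j ∈ Finset.range (J + 1 + 1), ((n + 1).choose j : ℝ) * (-(1 / 2)) ^ j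
          = ∑ j ∈ Finset.range (J + 1 + 1), (n.choose j : ℝ) * (-(1 / 2)) ^ j
            - 1 / 2 * ∑ j ∈ Finset.range (J + 1), (n.choose j : ℝ) * (-(1 / 2)) ^ j := by
        rw [Finset.sum_range_succ' _ (J + 1), Finset.sum_range_succ' _ (J + 1), Finset.mul_sum,
          add_sub_right_comm, ← Finset.sum_sub_distrib]
        congr 1
        · refine Finset.sum_congr rfl fun j _ => ?_
          rw [Nat.choose_succ_succ]
          push_cast
          ring
        · simp
      rw [h3]
      rw [pow_succ (-1 : ℝ) J] at h1 ⊢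
      rw [pow_succ (1 / 2 : ℝ) n]
      nlinarith

theorem half_pow_card_le_sum_powerset {α : Type*} (s : Finset α) {J : ℕ} (hJ : Even J) :
    (1 / 2 : ℝ) ^ s.card ≤ ∑ T ∈ s.powerset.filter (·.card ≤ J), (-(1 / 2) : ℝ) ^ T.card := by
  have h := bonferroni_half s.card J
  rw [hJ.neg_one_pow, one_mul, sub_nonneg] at h
  refine h.trans_eq ?_
  rw [Finset.sum_filter, Finset.sum_powerset_apply_card
    (fun j => if j ≤ J then (-(1 / 2) : ℝ) ^ j else 0)]
  simp only [nsmul_eq_mul, mul_ite, mul_zero]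
  rw [← Finset.sum_filter]
  refine Finset.sum_subset_zero_on_sdiff ?_ ?_ ?_ |>.symm
  · intro j hj
    rw [Finset.mem_filter] at hj
    exact Finset.mem_range.2 (by omega)
  · intro j hj
    simp only [Finset.mem_sdiff, Finset.mem_filter, Finset.mem_range] at hj
    rw [Nat.choose_eq_zero_of_lt (by omega)]
    simp
  · intros; rfl

variable {k : Type*} [Field k] [Finite k]

/-- Brun's pure sieve for the weight `2 ^ (-ω)` on a ball. -/
theorem sum_half_pow_omegaOn_le (s : Finset (MonicPrime k)) {y J x : ℕ}
    (hs : ∀ P ∈ s, P.1.natDegree ≤ y) (hJ : Even J) (hx : J * y ≤ x) (C : k[X]) :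
    ∑ F ∈ polyBall C x, (1 / 2 : ℝ) ^ omegaOn s F
      ≤ (Nat.card k : ℝ) ^ x *
        (∏ P ∈ s, (1 - invNorm P / 2) + (1 / 4) ^ J * ∏ P ∈ s, (1 + 2 * invNorm P)) := by
  have hset : ∀ F : k[X], (s.filter (·.1 ∣ F)).powerset.filter (·.card ≤ J)
      = (s.powerset.filter (·.card ≤ J)).filter (fun T => ∀ P ∈ T, P.1 ∣ F) := by
    intro F
    ext T
    simp only [Finset.mem_filter, Finset.mem_powerset, Finset.subset_iff]
    constructor
    · exact fun ⟨h, h'⟩ => ⟨⟨fun P hP => (h hP).1, h'⟩, fun P hP => (h hP).2⟩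
    · exact fun ⟨⟨h, h'⟩, h''⟩ => ⟨fun P hP => ⟨h hP, h'' P hP⟩, h'⟩
  have h1 : ∑ F ∈ polyBall C x, (1 / 2 : ℝ) ^ omegaOn s F
      ≤ ∑ T ∈ s.powerset.filter (·.card ≤ J),
        (Nat.card k : ℝ) ^ x * ((-(1 / 2) : ℝ) ^ T.card * ∏ P ∈ T, invNorm P) := by
    calc _ ≤ ∑ F ∈ polyBall C x, ∑ T ∈ s.powerset.filter (·.card ≤ J),
          if ∀ P ∈ T, P.1 ∣ F then (-(1 / 2) : ℝ) ^ T.card else 0 := by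
          refine Finset.sum_le_sum fun F _ => ?_
          have h := half_pow_card_le_sum_powerset (s.filter (·.1 ∣ F)) hJ
          rw [hset F] at h
          refine h.trans_eq ?_
          rw [← Finset.sum_filter]
      _ = _ := by
          rw [Finset.sum_comm]
          refine Finset.sum_congr rfl fun T hT => ?_
          obtain ⟨hTs, hTJ⟩ := Finset.mem_filter.1 hT
          rw [Finset.mem_powerset] at hTs
          have hdeg : ∑ P ∈ T, P.1.natDegree ≤ x := by
            calc _ ≤ T.card * y := by
                  rw [← smul_eq_mul]
                  exact Finset.sum_le_card_nsmul _ _ _ fun P hP => hs P (hTs hP)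
              _ ≤ J * y := Nat.mul_le_mul_right _ hTJ
              _ ≤ x := hx
          rw [← Finset.sum_filter, Finset.sum_const, nsmul_eq_mul, card_filter_forall_dvd C hdeg]
          ring
  refine h1.trans ?_
  rw [← Finset.mul_sum]
  refine mul_le_mul_of_nonneg_left ?_ (by positivity)
  have h2 : ∏ P ∈ s, (1 - invNorm P / 2)
      = ∑ T ∈ s.powerset, (-(1 / 2) : ℝ) ^ T.card * ∏ P ∈ T, invNorm P := by
    have : ∀ P : MonicPrime k, 1 - invNorm P / 2 = -(1 / 2) * invNorm P + 1 := fun P => by ring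
    simp_rw [this]
    rw [Finset.prod_add_one]
    exact Finset.sum_congr rfl fun T _ => by rw [Finset.prod_mul_distrib, Finset.prod_const]
  have h3 : ∏ P ∈ s, (1 + 2 * invNorm P)
      = ∑ T ∈ s.powerset, (2 : ℝ) ^ T.card * ∏ P ∈ T, invNorm P := by
    rw [Finset.prod_one_add]
    exact Finset.sum_congr rfl fun T _ => by rw [Finset.prod_mul_distrib, Finset.prod_const]
  rw [h2, h3, Finset.mul_sum, Finset.sum_filter, ← Finset.sum_add_distrib]
  refine Finset.sum_le_sum fun T _ => ?_
  have h4 : 0 ≤ ∏ P ∈ T, invNorm P := Finset.prod_nonneg fun P _ => invNorm_nonneg P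
  split_ifs with h
  · have : 0 ≤ (1 / 4 : ℝ) ^ J * (2 ^ T.card * ∏ P ∈ T, invNorm P) := by positivity
    linarith
  -- The sets with more than J elements must be restored to complete the Euler product. For them
  -- (1/2)^|T| = (1/4)^|T| 2^|T| ≤ (1/4)^J 2^|T|, which is the second product.
  · rw [← mul_assoc, ← add_mul]
    refine mul_nonneg ?_ h4
    have h5 : (1 / 4 : ℝ) ^ T.card ≤ (1 / 4) ^ J :=
      pow_le_pow_of_le_one (by norm_num) (by norm_num) (by omega)
    have h6 : (1 / 2 : ℝ) ^ T.card ≤ (1 / 4) ^ J * 2 ^ T.card := by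
      calc (1 / 2 : ℝ) ^ T.card = (1 / 4) ^ T.card * 2 ^ T.card := by rw [← mul_pow]; norm_num
        _ ≤ _ := by gcongr
    have h7 : -(1 / 2 : ℝ) ^ T.card ≤ (-(1 / 2)) ^ T.card := by
      have := neg_abs_le ((-(1 / 2) : ℝ) ^ T.card)
      rwa [abs_pow, abs_neg, abs_of_pos (by norm_num : (0 : ℝ) < 1 / 2)] at this
    linarith

/-- Sieving by primes of degree at most y = x / J keeps every product of J primes within degree x.
The Euler product is then of order y^(-1/2), and sieving by more primes only decreases the left
side. A J of order log N makes the truncation error negligible at a logarithmic cost. -/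
theorem sum_half_pow_omegaOn_le_sqrt {N J x Y : ℕ} (hJ : Even J) (hJN : 4 * Real.log N + 8 ≤ J)
    (hx : 1 ≤ x) (hxN : x ≤ N) (hxY : x / J ≤ Y) (C : k[X]) :
    ∑ F ∈ polyBall C x, (1 / 2 : ℝ) ^ omegaOn (primesIoc k 0 Y) F
      ≤ (Nat.card k : ℝ) ^ x * ((Real.exp 4 + 1) * Real.sqrt (J / x)) := by
  set y := x / J with hy
  have hN1 : (1 : ℝ) ≤ N := by exact_mod_cast hx.trans hxN
  have hx1 : (1 : ℝ) ≤ x := by exact_mod_cast hx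
  have hlogN : 0 ≤ Real.log N := Real.log_nonneg hN1
  have hJ8 : (8 : ℝ) ≤ J := by linarith
  set s := primesIoc k 0 y
  set L := ∑ P ∈ s, invNorm P with hL
  have hsub : s ⊆ primesIoc k 0 Y := fun P hP => by
    have := mem_primesIoc.1 hP
    exact mem_primesIoc.2 (by omega)
  have h1 : ∑ F ∈ polyBall C x, (1 / 2 : ℝ) ^ omegaOn (primesIoc k 0 Y) F
      ≤ ∑ F ∈ polyBall C x, (1 / 2 : ℝ) ^ omegaOn s F :=
    Finset.sum_le_sum fun F _ => pow_le_pow_of_le_one (by norm_num) (by norm_num)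
      (omegaOn_mono hsub F)
  refine (h1.trans (sum_half_pow_omegaOn_le s (y := y) (fun P hP => (mem_primesIoc.1 hP).2) hJ
    (Nat.mul_div_le x J) C)).trans ?_
  refine mul_le_mul_of_nonneg_left ?_ (by positivity)
  have hyN : (y : ℝ) ≤ N := by exact_mod_cast (Nat.div_le_self x J).trans hxN
  have hLu : L ≤ 1 + Real.log N := by
    refine (sum_invNorm_le_log y).trans ?_
    rcases Nat.eq_zero_or_pos y with h0 | h0
    · rw [h0]; simp; exact hlogN
    · gcongr
  have hLl := log_le_sum_invNorm (k := k) y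
  have hJx : (x : ℝ) / J ≤ y + 1 := by
    rw [div_le_iff₀ (by linarith)]
    exact_mod_cast (Nat.lt_mul_of_div_lt (Nat.lt_succ_self y) (by
      exact_mod_cast (by linarith : (0 : ℝ) < J)) : x < (y + 1) * J).le
  have hp1 : ∏ P ∈ s, (1 - invNorm P / 2) ≤ Real.exp 4 * Real.sqrt (J / x) := by
    calc _ ≤ ∏ P ∈ s, Real.exp (-(invNorm P / 2)) := by
          refine Finset.prod_le_prod (fun P _ => by linarith [invNorm_le_half P]) fun P _ => ?_
          linarith [Real.add_one_le_exp (-(invNorm P / 2))]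
      _ = Real.exp (-(L / 2)) := by
          rw [← Real.exp_sum, Finset.sum_neg_distrib, ← Finset.sum_div]
      _ ≤ Real.exp (4 + Real.log (J / x) / 2) := by
          rw [Real.exp_le_exp]
          have : Real.log (x / J) ≤ Real.log (y + 1) := Real.log_le_log (by positivity) hJx
          have h5 : Real.log (J / x) = -Real.log (x / J) := by rw [← Real.log_inv, inv_div]
          rw [h5]
          linarith
      _ = _ := by
          rw [Real.exp_add, ← Real.log_sqrt (by positivity), Real.exp_log (by positivity)]
  -- Since L ≤ 1 + log N, the hypothesis J ≥ 4 log N + 8 gives -J + 2L ≤ -log N, so this error is at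
  -- most 1/N ≤ 1/x.
  have hp2 : (1 / 4 : ℝ) ^ J * ∏ P ∈ s, (1 + 2 * invNorm P) ≤ Real.sqrt (J / x) := by
    have h4 : (1 / 4 : ℝ) ≤ Real.exp (-1) := by
      rw [Real.exp_neg, one_div]
      refine inv_anti₀ (Real.exp_pos 1) ?_
      linarith [Real.exp_one_lt_d9]
    calc _ ≤ Real.exp (-1) ^ J * ∏ P ∈ s, Real.exp (2 * invNorm P) := by
          refine mul_le_mul (pow_le_pow_left₀ (by norm_num) h4 J) (Finset.prod_le_prod
            (fun P _ => by linarith [invNorm_nonneg P]) fun P _ => ?_)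
            (Finset.prod_nonneg fun P _ => by linarith [invNorm_nonneg P]) (by positivity)
          linarith [Real.add_one_le_exp (2 * invNorm P)]
      _ = Real.exp (-J + 2 * L) := by
          rw [← Real.exp_sum, ← Finset.mul_sum, ← Real.exp_nat_mul, ← Real.exp_add, hL]
          ring_nf
      _ ≤ Real.exp (-Real.log N) := by
          rw [Real.exp_le_exp]; linarith
      _ = (N : ℝ)⁻¹ := by rw [Real.exp_neg, Real.exp_log (by linarith)]
      _ ≤ (x : ℝ)⁻¹ := by gcongr
      _ ≤ Real.sqrt (J / x) := by
          refine Real.le_sqrt_of_sq_le ?_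
          rw [sq, div_eq_mul_inv]
          gcongr
          exact (inv_le_one_of_one_le₀ hx1).trans (by linarith)
  linarith

end Sieve
end

noncomputable section

open Classical UniqueFactorizationMonoid

/-! ### Monomials on the torus: orthogonality and integration by parts. -/

section Torus

open ComplexConjugate

variable {σ : Type*} [Fintype σ]

/-- The monomial `∏ i, z i ^ e i`. -/
def torusMonomial (e : σ → ℕ) (z : σ → ℂ) : ℂ := ∏ i, z i ^ e i

/-- Rotation of the coordinate `i` by the angle `u`. -/
def torusRotation (i : σ) (u : ℝ) (z : σ → ℂ) : σ → ℂ :=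
  Function.update z i (Complex.exp (u * Complex.I) * z i)

/-- A measure on `ℂ ^ σ` supported on the torus and invariant under the rotation of each
coordinate. -/
structure IsToral (ν : Measure (σ → ℂ)) : Prop where
  rotation : ∀ i u, MeasurePreserving (torusRotation i u) ν ν
  ae_norm : ∀ᵐ z ∂ν, ∀ i, ‖z i‖ = 1

theorem torusMonomial_rotation (e : σ → ℕ) (i : σ) (u : ℝ) (z : σ → ℂ) :
    torusMonomial e (torusRotation i u z)
      = Complex.exp ((u * e i : ℝ) * Complex.I) * torusMonomial e z := by
  unfold torusMonomial torusRotation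
  rw [← Finset.mul_prod_erase _ _ (Finset.mem_univ i), ← Finset.mul_prod_erase Finset.univ
    (fun j => z j ^ e j) (Finset.mem_univ i), Function.update_self, mul_pow, ← Complex.exp_nat_mul]
  have : ∏ x ∈ Finset.univ.erase i, Function.update z i (Complex.exp (u * Complex.I) * z i) x ^ e x
      = ∏ x ∈ Finset.univ.erase i, z x ^ e x :=
    Finset.prod_congr rfl fun j hj => by
      rw [Function.update_of_ne (Finset.ne_of_mem_erase hj)]
  have h2 : Complex.exp (e i * (u * Complex.I)) = Complex.exp ((u * e i : ℝ) * Complex.I) := by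
    push_cast
    ring_nf
  rw [this, h2, mul_assoc]

theorem torusMonomial_add (e g : σ → ℕ) (z : σ → ℂ) :
    torusMonomial (e + g) z = torusMonomial e z * torusMonomial g z := by
  simp [torusMonomial, pow_add, Finset.prod_mul_distrib]

theorem norm_torusMonomial (e : σ → ℕ) {z : σ → ℂ} (hz : ∀ i, ‖z i‖ = 1) :
    ‖torusMonomial e z‖ = 1 := by
  simp [torusMonomial, norm_prod, hz]

@[fun_prop]
theorem continuous_torusMonomial (e : σ → ℕ) : Continuous (torusMonomial e) := by
  unfold torusMonomial; fun_prop

variable {ν : Measure (σ → ℂ)}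

theorem integrable_of_continuous_of_bound {E : Type*} [NormedAddCommGroup E]
    [MeasurableSpace E] [BorelSpace E] [SecondCountableTopology E]
    [IsFiniteMeasure ν] (hν : IsToral ν) {F : (σ → ℂ) → E} (hF : Continuous F) (B : ℝ)
    (hB : ∀ z, (∀ i, ‖z i‖ = 1) → ‖F z‖ ≤ B) : Integrable F ν :=
  Integrable.of_bound hF.aestronglyMeasurable B (hν.ae_norm.mono hB)

theorem integral_comp_rotation {E : Type*} [NormedAddCommGroup E] [NormedSpace ℝ E]
    [MeasurableSpace E] [BorelSpace E] [SecondCountableTopology E]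
    (hν : IsToral ν) (i : σ) (u : ℝ) {F : (σ → ℂ) → E} (hF : Continuous F) :
    ∫ z, F (torusRotation i u z) ∂ν = ∫ z, F z ∂ν := by
  have h := hν.rotation i u
  conv_rhs => rw [← h.map_eq]
  rw [integral_map h.measurable.aemeasurable hF.aestronglyMeasurable]

variable [IsProbabilityMeasure ν]

/-- If the exponents differ at i, rotating coordinate i by π / (e i - g i) changes the sign of the
integrand while preserving the measure. -/
theorem integral_torusMonomial_mul_conj (hν : IsToral ν) (e g : σ → ℕ) :
    ∫ z, torusMonomial e z * conj (torusMonomial g z) ∂ν = if e = g then 1 else 0 := by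
  split_ifs with h
  · subst h
    have : ∀ᵐ z ∂ν, torusMonomial e z * conj (torusMonomial e z) = 1 := by
      filter_upwards [hν.ae_norm] with z hz
      rw [Complex.mul_conj', norm_torusMonomial e hz]
      norm_num
    rw [integral_congr_ae this]
    simp
  · obtain ⟨i, hi⟩ := Function.ne_iff.1 h
    have hi' : ((e i : ℝ) - g i) ≠ 0 := sub_ne_zero.2 (by exact_mod_cast hi)
    set u : ℝ := Real.pi / ((e i : ℝ) - g i) with hu
    have h1 := integral_comp_rotation hν i u
      (F := fun z => torusMonomial e z * conj (torusMonomial g z)) (by fun_prop)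
    have h2 : ∀ z, torusMonomial e (torusRotation i u z)
        * conj (torusMonomial g (torusRotation i u z))
        = -(torusMonomial e z * conj (torusMonomial g z)) := by
      intro z
      rw [torusMonomial_rotation, torusMonomial_rotation, map_mul, ← Complex.exp_conj, map_mul,
        Complex.conj_I, Complex.conj_ofReal]
      have h3 : Complex.exp ((u * e i : ℝ) * Complex.I) * Complex.exp ((u * g i : ℝ) * -Complex.I)
          = -1 := by
        rw [← Complex.exp_add, ← Complex.exp_pi_mul_I]
        congr 1
        have : Real.pi = u * e i - u * g i := by rw [hu]; field_simp
        rw [this]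
        push_cast
        ring
      linear_combination (torusMonomial e z * conj (torusMonomial g z)) * h3
    simp only [h2, integral_neg] at h1
    linear_combination (-1 / 2 : ℂ) * h1

theorem integral_norm_sq_sum_torusMonomial (hν : IsToral ν) {τ : Type*} (T : Finset τ)
    (a b : τ → σ → ℕ) :
    ∫ z, ‖∑ x ∈ T, torusMonomial (a x) z * conj (torusMonomial (b x) z)‖ ^ 2 ∂ν
      = ((T ×ˢ T).filter (fun x => a x.1 + b x.2 = a x.2 + b x.1)).card := by
  have h1 : ∀ z, ((‖∑ x ∈ T, torusMonomial (a x) z * conj (torusMonomial (b x) z)‖ ^ 2 : ℝ) : ℂ)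
      = ∑ x ∈ T ×ˢ T, torusMonomial (a x.1 + b x.2) z * conj (torusMonomial (a x.2 + b x.1) z) := by
    intro z
    push_cast
    rw [← Complex.mul_conj', map_sum, Finset.sum_mul_sum, ← Finset.sum_product']
    refine Finset.sum_congr rfl fun x _ => ?_
    simp only [torusMonomial_add, map_mul, Complex.conj_conj]
    ring
  have h2 : ((∫ z, ‖∑ x ∈ T, torusMonomial (a x) z * conj (torusMonomial (b x) z)‖ ^ 2 ∂ν : ℝ) : ℂ)
      = (((T ×ˢ T).filter (fun x => a x.1 + b x.2 = a x.2 + b x.1)).card : ℂ) := by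
    rw [← integral_complex_ofReal]
    simp_rw [h1]
    rw [integral_finsetSum]
    · simp_rw [integral_torusMonomial_mul_conj hν]
      rw [Finset.sum_boole]
    · intro x _
      refine integrable_of_continuous_of_bound hν (by fun_prop) 1 fun z hz => ?_
      rw [norm_mul, RCLike.norm_conj, norm_torusMonomial _ hz, norm_torusMonomial _ hz, one_mul]
  exact_mod_cast h2

theorem integral_norm_le_sqrt_integral_sq {Ω E : Type*} [MeasurableSpace Ω]
    [NormedAddCommGroup E] {μ : Measure Ω} [IsProbabilityMeasure μ] {F : Ω → E}
    (hF : MemLp F 2 μ) : ∫ ω, ‖F ω‖ ∂μ ≤ Real.sqrt (∫ ω, ‖F ω‖ ^ 2 ∂μ) := by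
  refine Real.le_sqrt_of_sq_le ?_
  have h := variance_nonneg (fun ω => ‖F ω‖) μ
  rw [variance_eq_sub hF.norm] at h
  simpa using h

/-- The linear statistic `Re (conj t * ∑ a ∈ S, z ^ (e a))`. -/
def torusSum {α : Type*} (S : Finset α) (e : α → σ → ℕ) (t : ℂ) (z : σ → ℂ) : ℝ :=
  (conj t * ∑ a ∈ S, torusMonomial (e a) z).re

theorem torusSum_eq {α : Type*} (S : Finset α) (e : α → σ → ℕ) (t : ℂ) (z : σ → ℂ) :
    torusSum S e t z = ∑ a ∈ S, (conj t * torusMonomial (e a) z).re := by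
  rw [torusSum, Finset.mul_sum, Complex.re_sum]

@[fun_prop]
theorem continuous_torusSum {α : Type*} (S : Finset α) (e : α → σ → ℕ) (t : ℂ) :
    Continuous (torusSum S e t) := by
  unfold torusSum; fun_prop

theorem abs_re_conj_mul_torusMonomial_le (g : σ → ℕ) (t c : ℂ) {z : σ → ℂ}
    (hz : ∀ i, ‖z i‖ = 1) : |(c * (conj t * torusMonomial g z)).re| ≤ ‖c‖ * ‖t‖ := by
  refine (Complex.abs_re_le_norm _).trans_eq ?_
  rw [norm_mul, norm_mul, norm_torusMonomial g hz, RCLike.norm_conj, mul_one]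

/-- Integration by parts in one angular coordinate. -/
theorem integral_torusMonomial_mul_exp (hν : IsToral ν) {α : Type*} (S : Finset α)
    (e : α → σ → ℕ) (t : ℂ) (s : ℝ) (a : α) (p : σ) (hp : e a p ≠ 0) :
    ∫ z, ((conj t * torusMonomial (e a) z).re : ℂ)
        * Complex.exp ((s * torusSum S e t z : ℝ) * Complex.I) ∂ν
      = s * Complex.I * ∫ z, (((Complex.I * (conj t * torusMonomial (e a) z)).re
          * ∑ b ∈ S, (e b p / e a p : ℝ) * (Complex.I * (conj t * torusMonomial (e b) z)).re : ℝ) : ℂ)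
        * Complex.exp ((s * torusSum S e t z : ℝ) * Complex.I) ∂ν := by
  set v : ℝ := (e a p : ℝ) with hv
  have hv0 : v ≠ 0 := by rw [hv]; exact_mod_cast hp
  -- the rotated monomials
  set c : (σ → ℕ) → ℝ → (σ → ℂ) → ℂ := fun g u z =>
    Complex.exp ((u * g p : ℝ) * Complex.I) * (conj t * torusMonomial g z) with hc
  have hcrot : ∀ g u z, conj t * torusMonomial g (torusRotation p u z) = c g u z := by
    intro g u z
    rw [torusMonomial_rotation, hc]
    ring
  have hcnorm : ∀ g u z, (∀ i, ‖z i‖ = 1) → ‖c g u z‖ = ‖t‖ := by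
    intro g u z hz
    simp only [hc]
    rw [norm_mul, Complex.norm_exp_ofReal_mul_I, norm_mul, norm_torusMonomial g hz,
      RCLike.norm_conj]
    ring
  have hcder : ∀ g u z, HasDerivAt (fun u => c g u z) ((g p : ℝ) * Complex.I * c g u z) u := by
    intro g u z
    have h1 : HasDerivAt (fun u : ℝ => ((u * g p : ℝ) : ℂ) * Complex.I)
        ((g p : ℝ) * Complex.I) u := by
      have := ((hasDerivAt_id u).mul_const (g p : ℝ)).ofReal_comp.mul_const Complex.I
      simpa using this
    refine (h1.cexp.mul_const (conj t * torusMonomial g z)).congr_deriv ?_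
    simp only [hc]
    ring
  have hrecder : ∀ (w : ℂ) g u z, HasDerivAt (fun u => (w * c g u z).re)
      ((w * ((g p : ℝ) * Complex.I * c g u z)).re) u := fun w g u z =>
    (Complex.reCLM.hasFDerivAt.comp_hasDerivAt u ((hcder g u z).const_mul w))
  -- W is an antiderivative in the angle u of the summand of a: differentiation multiplies the
  -- monomial by i v, and the factor -i / v cancels this.
  set W : ℝ → (σ → ℂ) → ℝ := fun u z => ((-Complex.I / v) * c (e a) u z).re with hW
  set Y : ℝ → (σ → ℂ) → ℝ := fun u z => ∑ b ∈ S, (1 * c (e b) u z).re with hY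
  set Y' : ℝ → (σ → ℂ) → ℝ := fun u z =>
    ∑ b ∈ S, (1 * ((e b p : ℝ) * Complex.I * c (e b) u z)).re with hY'
  have hWder : ∀ u z, HasDerivAt (fun u => W u z) ((c (e a) u z).re) u := by
    intro u z
    have h := hrecder (-Complex.I / v) (e a) u z
    have h2 : (-Complex.I / (v : ℂ)) * (((e a p : ℕ) : ℝ) * Complex.I * c (e a) u z)
        = c (e a) u z := by
      rw [← hv]
      have : (v : ℂ) ≠ 0 := by exact_mod_cast hv0
      field_simp
      rw [Complex.I_sq]; ring
    rwa [h2] at h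
  have hYder : ∀ u z, HasDerivAt (fun u => Y u z) (Y' u z) u := fun u z =>
    HasDerivAt.fun_sum fun b _ => hrecder 1 (e b) u z
  set F : ℝ → (σ → ℂ) → ℂ := fun u z =>
    (W u z : ℂ) * Complex.exp ((s * Y u z : ℝ) * Complex.I) with hF
  set F' : ℝ → (σ → ℂ) → ℂ := fun u z =>
    ((c (e a) u z).re : ℂ) * Complex.exp ((s * Y u z : ℝ) * Complex.I)
      + (W u z : ℂ) * (Complex.exp ((s * Y u z : ℝ) * Complex.I) * ((s * Y' u z : ℝ) * Complex.I))
    with hF'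
  have hFder : ∀ u z, HasDerivAt (fun u => F u z) (F' u z) u := by
    intro u z
    have h1 := (hWder u z).ofReal_comp
    have h2 := (((hYder u z).const_mul s).ofReal_comp.mul_const Complex.I).cexp
    exact h1.mul h2
  have hccont : ∀ g u, Continuous (c g u) := by
    intro g u; simp only [hc]; fun_prop
  have hWcont : ∀ u, Continuous (W u) := by
    intro u; have := hccont (e a) u; simp only [hW]; fun_prop
  have hYcont : ∀ u, Continuous (Y u) := by
    intro u; have := fun b => hccont (e b) u; simp only [hY]; fun_prop
  have hYcont' : ∀ u, Continuous (Y' u) := by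
    intro u; have := fun b => hccont (e b) u; simp only [hY']; fun_prop
  have hFcont : ∀ u, Continuous (F u) := by
    intro u; have := hWcont u; have := hYcont u; simp only [hF]; fun_prop
  have hFcont' : ∀ u, Continuous (F' u) := by
    intro u; have := hWcont u; have := hYcont u; have := hYcont' u; have := hccont (e a) u
    simp only [hF']; fun_prop
  have hWbd : ∀ u z, (∀ i, ‖z i‖ = 1) → |W u z| ≤ ‖t‖ / |v| := by
    intro u z hz
    refine (Complex.abs_re_le_norm _).trans_eq ?_
    rw [norm_mul, hcnorm _ _ _ hz]
    simp
    ring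
  set B : ℝ := ‖t‖ + ‖t‖ / |v| * (|s| * ∑ b ∈ S, (e b p : ℝ) * ‖t‖) with hB
  have hFbd' : ∀ u z, (∀ i, ‖z i‖ = 1) → ‖F' u z‖ ≤ B := by
    intro u z hz
    have h1 : |(c (e a) u z).re| ≤ ‖t‖ :=
      (Complex.abs_re_le_norm _).trans_eq (hcnorm _ _ _ hz)
    have h2 : |Y' u z| ≤ ∑ b ∈ S, (e b p : ℝ) * ‖t‖ := by
      refine (Finset.abs_sum_le_sum_abs _ _).trans (Finset.sum_le_sum fun b _ => ?_)
      refine (Complex.abs_re_le_norm _).trans_eq ?_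
      rw [one_mul, norm_mul, norm_mul, hcnorm _ _ _ hz]
      simp
    refine (norm_add_le _ _).trans ?_
    rw [norm_mul, norm_mul, norm_mul, norm_mul, Complex.norm_exp_ofReal_mul_I, Complex.norm_real,
      Complex.norm_real, Complex.norm_real, Complex.norm_I, Real.norm_eq_abs, Real.norm_eq_abs,
      Real.norm_eq_abs, abs_mul]
    simp only [mul_one, one_mul]
    exact add_le_add h1 (mul_le_mul (hWbd u z hz) (mul_le_mul_of_nonneg_left h2 (abs_nonneg s))
      (by positivity) (by positivity))
  have hder := (hasDerivAt_integral_of_dominated_loc_of_deriv_le (μ := ν) (F := F) (F' := F')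
    (x₀ := (0 : ℝ)) (s := Set.univ) (bound := fun _ => B) Filter.univ_mem
    (Eventually.of_forall fun u => (hFcont u).aestronglyMeasurable)
    (integrable_of_continuous_of_bound hν (hFcont 0) (‖t‖ / |v|) (fun z hz => by
      rw [hF, norm_mul, Complex.norm_exp_ofReal_mul_I, mul_one, Complex.norm_real]
      exact hWbd 0 z hz))
    (hFcont' 0).aestronglyMeasurable
    (hν.ae_norm.mono fun z hz u _ => hFbd' u z hz) (integrable_const B)
    (Eventually.of_forall fun z u _ => hFder u z)).2
  -- F u is F 0 composed with a rotation, so its integral is constant in u and the integral of the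
  -- derivative vanishes. The product rule for F' then yields the formula.
  have hconst : ∀ u, ∫ z, F u z ∂ν = ∫ z, F 0 z ∂ν := by
    have hrot : ∀ u z, F u z = F 0 (torusRotation p u z) := by
      intro u z
      have h1 : ∀ g, c g 0 (torusRotation p u z) = c g u z := by
        intro g
        rw [← hcrot g u z]
        simp [hc]
      simp only [hF, hW, hY, h1]
    intro u
    simp_rw [hrot u]
    exact integral_comp_rotation hν p u (hFcont 0)
  have hzero : ∫ z, F' 0 z ∂ν = 0 := by
    have h0 : HasDerivAt (fun u => ∫ z, F u z ∂ν) 0 0 := by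
      simp_rw [hconst]
      exact hasDerivAt_const _ _
    exact hder.unique h0
  have hc0 : ∀ g z, c g 0 z = conj t * torusMonomial g z := fun g z => by simp [hc]
  have hY0 : ∀ z, Y 0 z = torusSum S e t z := fun z => by
    simp only [hY, hc0, one_mul, torusSum_eq]
  have hsplit : ∀ z, F' 0 z = ((conj t * torusMonomial (e a) z).re : ℂ)
        * Complex.exp ((s * torusSum S e t z : ℝ) * Complex.I)
      - s * Complex.I * ((((Complex.I * (conj t * torusMonomial (e a) z)).re
          * ∑ b ∈ S, (e b p / e a p : ℝ) * (Complex.I * (conj t * torusMonomial (e b) z)).re : ℝ) : ℂ)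
        * Complex.exp ((s * torusSum S e t z : ℝ) * Complex.I)) := by
    intro z
    have hWz : W 0 z = -(Complex.I * (conj t * torusMonomial (e a) z)).re / v := by
      simp only [hW, hc0]
      have h1 : -Complex.I / (v : ℂ) * (conj t * torusMonomial (e a) z)
          = ((-(1 / v) : ℝ) : ℂ) * (Complex.I * (conj t * torusMonomial (e a) z)) := by
        push_cast; ring
      rw [h1, Complex.re_ofReal_mul]
      ring
    have hYz : Y' 0 z = v * ∑ b ∈ S, (e b p / e a p : ℝ)
        * (Complex.I * (conj t * torusMonomial (e b) z)).re := by
      simp only [hY', hc0]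
      rw [Finset.mul_sum]
      refine Finset.sum_congr rfl fun b _ => ?_
      rw [one_mul, mul_assoc, Complex.re_ofReal_mul, ← hv]
      field_simp
    simp only [hF', hc0, hY0]
    rw [hWz, hYz]
    have : (v : ℂ) ≠ 0 := by exact_mod_cast hv0
    push_cast
    field_simp
    ring
  simp_rw [hsplit] at hzero
  rw [integral_sub, integral_const_mul, sub_eq_zero] at hzero
  · exact hzero
  · refine integrable_of_continuous_of_bound hν (by fun_prop) ‖t‖ fun z hz => ?_
    rw [norm_mul, Complex.norm_exp_ofReal_mul_I, mul_one, Complex.norm_real, ← hc0]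
    exact (Complex.abs_re_le_norm _).trans_eq (hcnorm _ _ _ hz)
  · refine Integrable.const_mul (integrable_of_continuous_of_bound hν (by fun_prop)
      (‖t‖ * ∑ b ∈ S, |(e b p / e a p : ℝ)| * ‖t‖) fun z hz => ?_) _
    rw [norm_mul, Complex.norm_exp_ofReal_mul_I, mul_one, Complex.norm_real, Real.norm_eq_abs,
      abs_mul]
    have h1 : ∀ g, |(Complex.I * (conj t * torusMonomial g z)).re| ≤ ‖t‖ := fun g => by
      simpa using abs_re_conj_mul_torusMonomial_le g t Complex.I hz
    refine mul_le_mul (h1 _) ?_ (abs_nonneg _) (norm_nonneg _)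
    refine (Finset.abs_sum_le_sum_abs _ _).trans (Finset.sum_le_sum fun b _ => ?_)
    rw [abs_mul]
    exact mul_le_mul_of_nonneg_left (h1 _) (abs_nonneg _)

end Torus
end

noncomputable section

open Classical UniqueFactorizationMonoid

/-! ### The central limit theorem on the torus. -/

section TorusCLT

open ComplexConjugate

variable {σ : Type*} {α : Type*}

/-- The pairs `(a, b)` such that the distinguished coordinate of `a` occurs in `b`. -/
def linkedPairs (S : Finset α) (e : α → σ → ℕ) (p : α → σ) : Finset (α × α) :=
  (S ×ˢ S).filter (fun x => e x.2 (p x.1) ≠ 0)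

/-- The off-diagonal linked pairs. -/
def linkedOffDiag (S : Finset α) (e : α → σ → ℕ) (p : α → σ) : Finset (α × α) :=
  (S ×ˢ S).filter (fun x => x.1 ≠ x.2 ∧ e x.2 (p x.1) ≠ 0)

/-- The nontrivial solutions of `e a + e b = e c + e d`. -/
def nontrivialQuads (S : Finset α) (e : α → σ → ℕ) : Finset ((α × α) × (α × α)) :=
  ((S ×ˢ S) ×ˢ (S ×ˢ S)).filter (fun x => e x.1.1 + e x.1.2 = e x.2.1 + e x.2.2 ∧
    x.1.1 ≠ x.2.1 ∧ x.1.1 ≠ x.2.2)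

theorem card_linkedPairs {S : Finset α} {e : α → σ → ℕ} {p : α → σ}
    (hp : ∀ a ∈ S, e a (p a) ≠ 0) :
    (linkedPairs S e p).card = S.card + (linkedOffDiag S e p).card := by
  rw [← Finset.card_filter_add_card_filter_not (s := linkedPairs S e p) (fun x => x.1 = x.2)]
  congr 1
  · refine Finset.card_bij' (fun x _ => x.1) (fun a _ => (a, a)) ?_ ?_ ?_ ?_
    · intro x hx
      simp only [linkedPairs, Finset.mem_filter, Finset.mem_product] at hx
      exact hx.1.1.1
    · intro a ha
      simp [linkedPairs, ha, hp a ha]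
    · intro x hx
      exact Prod.ext rfl (Finset.mem_filter.1 hx).2
    · intro a _; rfl
  · congr 1
    ext x
    simp only [linkedPairs, linkedOffDiag, Finset.mem_filter]
    tauto

variable [Fintype σ]

/-- For pairs (a, b), (c, d) with e a + e d = e c + e b: if a = c, injectivity of e gives b = d, so
the first pair determines the second. Otherwise a ≠ c, and a ≠ b off the diagonal, so the solution
is nontrivial. -/
theorem card_filter_linkedOffDiag_le {S : Finset α} {e : α → σ → ℕ} (p : α → σ)
    (hinj : Set.InjOn e S) :
    ((linkedOffDiag S e p ×ˢ linkedOffDiag S e p).filter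
      (fun x => e x.1.1 + e x.2.2 = e x.2.1 + e x.1.2)).card
      ≤ (linkedOffDiag S e p).card + (nontrivialQuads S e).card := by
  rw [← Finset.card_filter_add_card_filter_not
    (s := (linkedOffDiag S e p ×ˢ linkedOffDiag S e p).filter
      (fun x => e x.1.1 + e x.2.2 = e x.2.1 + e x.1.2)) (fun x => x.1.1 = x.2.1)]
  refine Nat.add_le_add ?_ ?_
  · refine Finset.card_le_card_of_injOn (fun x => x.1) ?_ ?_
    · intro x hx
      simp only [Finset.coe_filter, Set.mem_ofPred_eq, Finset.mem_filter, Finset.mem_product] at hx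
      exact hx.1.1.1
    · rintro ⟨⟨a, b⟩, c, d⟩ hx ⟨⟨a', b'⟩, c', d'⟩ hx' h
      simp only [Finset.coe_filter, Set.mem_ofPred_eq, Finset.mem_filter, Finset.mem_product,
        linkedOffDiag, Prod.mk.injEq] at hx hx' h ⊢
      obtain ⟨rfl, rfl⟩ := h
      obtain ⟨⟨⟨⟨⟨h1, h2⟩, _⟩, ⟨h3, h4⟩, _⟩, h5⟩, rfl⟩ := hx
      obtain ⟨⟨⟨_, ⟨h3', h4'⟩, _⟩, h5'⟩, rfl⟩ := hx'
      exact ⟨⟨rfl, rfl⟩, rfl,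
        hinj h4 h4' ((add_left_cancel h5).trans (add_left_cancel h5').symm)⟩
  · refine Finset.card_le_card_of_injOn (fun x => ((x.1.1, x.2.2), (x.2.1, x.1.2))) ?_ ?_
    · intro x hx
      simp only [Finset.coe_filter, Set.mem_ofPred_eq, Finset.mem_filter, Finset.mem_product,
        linkedOffDiag, nontrivialQuads] at hx ⊢
      tauto
    · rintro ⟨⟨a, b⟩, c, d⟩ hx ⟨⟨a', b'⟩, c', d'⟩ hx' h
      simp only [Prod.mk.injEq] at h ⊢
      tauto

/-- A solution that is not nontrivial repeats the pair (a, b) or swaps it, which accounts for the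
factor 2. -/
theorem card_filter_linkedPairs_le {S : Finset α} {e : α → σ → ℕ} (p : α → σ)
    (hinj : Set.InjOn e S) :
    ((linkedPairs S e p ×ˢ linkedPairs S e p).filter
      (fun x => e x.1.1 + e x.1.2 = e x.2.1 + e x.2.2)).card
      ≤ 2 * (linkedPairs S e p).card + (nontrivialQuads S e).card := by
  have hsub : (linkedPairs S e p ×ˢ linkedPairs S e p).filter
      (fun x => e x.1.1 + e x.1.2 = e x.2.1 + e x.2.2) ⊆
      ((linkedPairs S e p).image (fun x => (x, x)) ∪
        (linkedPairs S e p).image (fun x => (x, (x.2, x.1)))) ∪ nontrivialQuads S e := by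
    rintro ⟨⟨a, b⟩, c, d⟩ hx
    simp only [Finset.mem_filter, Finset.mem_product, linkedPairs] at hx
    obtain ⟨⟨⟨⟨ha, hb⟩, hab⟩, ⟨hc, hd⟩, hcd⟩, h5⟩ := hx
    rw [Finset.mem_union, Finset.mem_union]
    by_cases h1 : a = c
    · subst h1
      have := hinj hb hd (add_left_cancel h5)
      subst this
      exact Or.inl (Or.inl (Finset.mem_image.2 ⟨(a, b), by simp [linkedPairs, ha, hb, hab], rfl⟩))
    by_cases h2 : a = d
    · subst h2
      have := hinj hb hc (add_left_cancel (h5.trans (add_comm _ _)))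
      subst this
      exact Or.inl (Or.inr (Finset.mem_image.2 ⟨(a, b), by simp [linkedPairs, ha, hb, hab], rfl⟩))
    · right
      simp [nontrivialQuads, ha, hb, hc, hd, h1, h2, h5]
  refine (Finset.card_le_card hsub).trans ((Finset.card_union_le _ _).trans ?_)
  refine Nat.add_le_add_right ((Finset.card_union_le _ _).trans ?_) _
  have h1 := Finset.card_image_le (s := linkedPairs S e p) (f := fun x => (x, x))
  have h2 := Finset.card_image_le (s := linkedPairs S e p) (f := fun x => (x, (x.2, x.1)))
  omega

variable {ν : Measure (σ → ℂ)} [IsProbabilityMeasure ν]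

/-- The carré du champ `∑ ρ(a, b) ∂X_a ∂X_b`. -/
def torusGamma (S : Finset α) (e : α → σ → ℕ) (p : α → σ) (t : ℂ) (z : σ → ℂ) : ℝ :=
  ∑ x ∈ linkedPairs S e p, (Complex.I * (conj t * torusMonomial (e x.1) z)).re
    * (Complex.I * (conj t * torusMonomial (e x.2) z)).re

@[fun_prop]
theorem continuous_torusGamma (S : Finset α) (e : α → σ → ℕ) (p : α → σ) (t : ℂ) :
    Continuous (torusGamma S e p t) := by
  unfold torusGamma; fun_prop

theorem abs_torusSum_le (S : Finset α) (e : α → σ → ℕ) (t : ℂ) {z : σ → ℂ}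
    (hz : ∀ i, ‖z i‖ = 1) : |torusSum S e t z| ≤ S.card * ‖t‖ := by
  rw [torusSum_eq, ← nsmul_eq_mul]
  refine (Finset.abs_sum_le_sum_abs _ _).trans (Finset.sum_le_card_nsmul _ _ _ fun b _ => ?_)
  simpa using abs_re_conj_mul_torusMonomial_le (e b) t 1 hz

theorem abs_torusGamma_le (S : Finset α) (e : α → σ → ℕ) (p : α → σ) (t : ℂ) {z : σ → ℂ}
    (hz : ∀ i, ‖z i‖ = 1) : |torusGamma S e p t z| ≤ (linkedPairs S e p).card * ‖t‖ ^ 2 := by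
  rw [torusGamma, ← nsmul_eq_mul]
  refine (Finset.abs_sum_le_sum_abs _ _).trans (Finset.sum_le_card_nsmul _ _ _ fun b _ => ?_)
  have h1 : ∀ g, |(Complex.I * (conj t * torusMonomial g z)).re| ≤ ‖t‖ := fun g => by
    simpa using abs_re_conj_mul_torusMonomial_le g t Complex.I hz
  rw [abs_mul, sq]
  exact mul_le_mul (h1 _) (h1 _) (abs_nonneg _) (norm_nonneg _)

/-- Integration by parts is applied to each a in its own coordinate p a. By `hpp` the exponent
ratios that arise are 0 or 1, so the sum is exactly Γ with coefficient one on each linked pair. -/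
theorem integral_torusSum_mul_exp (hν : IsToral ν) {S : Finset α} {e : α → σ → ℕ} {p : α → σ}
    (hp : ∀ a ∈ S, e a (p a) ≠ 0)
    (hpp : ∀ a ∈ S, ∀ b ∈ S, e b (p a) ≠ 0 → e b (p a) = e a (p a)) (t : ℂ) (s : ℝ) :
    ∫ z, (torusSum S e t z : ℂ) * Complex.exp ((s * torusSum S e t z : ℝ) * Complex.I) ∂ν
      = s * Complex.I * ∫ z, (torusGamma S e p t z : ℂ)
        * Complex.exp ((s * torusSum S e t z : ℝ) * Complex.I) ∂ν := by
  have h1 : ∀ g, ∀ z : σ → ℂ, (∀ i, ‖z i‖ = 1) →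
      |(Complex.I * (conj t * torusMonomial g z)).re| ≤ ‖t‖ := fun g z hz => by
    simpa using abs_re_conj_mul_torusMonomial_le g t Complex.I hz
  have hL : ∀ z, (torusSum S e t z : ℂ) * Complex.exp ((s * torusSum S e t z : ℝ) * Complex.I)
      = ∑ a ∈ S, ((conj t * torusMonomial (e a) z).re : ℂ)
        * Complex.exp ((s * torusSum S e t z : ℝ) * Complex.I) := by
    intro z
    rw [← Finset.sum_mul, ← Complex.ofReal_sum, ← torusSum_eq]
  have hR : ∀ z, (torusGamma S e p t z : ℂ)
        * Complex.exp ((s * torusSum S e t z : ℝ) * Complex.I)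
      = ∑ a ∈ S, (((Complex.I * (conj t * torusMonomial (e a) z)).re
          * ∑ b ∈ S, (e b (p a) / e a (p a) : ℝ) * (Complex.I * (conj t * torusMonomial (e b) z)).re
            : ℝ) : ℂ)
        * Complex.exp ((s * torusSum S e t z : ℝ) * Complex.I) := by
    intro z
    rw [← Finset.sum_mul, ← Complex.ofReal_sum]
    congr 2
    rw [torusGamma, linkedPairs, Finset.sum_filter, Finset.sum_product]
    refine Finset.sum_congr rfl fun a ha => ?_
    rw [Finset.mul_sum]
    refine Finset.sum_congr rfl fun b hb => ?_
    dsimp only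
    by_cases h : e b (p a) = 0
    · simp [h]
    · have h2 : (e a (p a) : ℝ) ≠ 0 := by exact_mod_cast hp a ha
      rw [if_pos h, hpp a ha b hb h, div_self h2, one_mul]
  simp_rw [hL, hR]
  rw [integral_finsetSum, integral_finsetSum, Finset.mul_sum]
  · exact Finset.sum_congr rfl fun a ha =>
      integral_torusMonomial_mul_exp hν S e t s a (p a) (hp a ha)
  · intro a _
    refine integrable_of_continuous_of_bound hν (by fun_prop)
      (‖t‖ * ∑ b ∈ S, |(e b (p a) / e a (p a) : ℝ)| * ‖t‖) fun z hz => ?_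
    rw [norm_mul, Complex.norm_exp_ofReal_mul_I, mul_one, Complex.norm_real, Real.norm_eq_abs,
      abs_mul]
    refine mul_le_mul (h1 _ z hz) ?_ (abs_nonneg _) (norm_nonneg _)
    refine (Finset.abs_sum_le_sum_abs _ _).trans (Finset.sum_le_sum fun b _ => ?_)
    rw [abs_mul]
    exact mul_le_mul_of_nonneg_left (h1 _ z hz) (abs_nonneg _)
  · intro a _
    refine integrable_of_continuous_of_bound hν (by fun_prop) ‖t‖ fun z hz => ?_
    rw [norm_mul, Complex.norm_exp_ofReal_mul_I, mul_one, Complex.norm_real]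
    simpa using abs_re_conj_mul_torusMonomial_le (e a) t 1 hz

/-- From Im α · Im β = (Re(α conj β) - Re(αβ)) / 2, the diagonal of the first part is the constant
‖t‖²|S|/2. What remains is U, from off-diagonal α conj β, and V, from αβ. Their L² norms are counts
of multiplicative coincidences, and Cauchy–Schwarz passes to L¹. -/
theorem integral_abs_torusGamma_sub_le (hν : IsToral ν) {S : Finset α} {e : α → σ → ℕ} {p : α → σ}
    (hinj : Set.InjOn e S) (hp : ∀ a ∈ S, e a (p a) ≠ 0) (t : ℂ) :
    ∫ z, |torusGamma S e p t z - ‖t‖ ^ 2 * S.card / 2| ∂ν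
      ≤ ‖t‖ ^ 2 * Real.sqrt (2 * (S.card + (linkedOffDiag S e p).card : ℝ)
          + (nontrivialQuads S e).card) := by
  set U : (σ → ℂ) → ℂ := fun z => ∑ x ∈ linkedOffDiag S e p,
    torusMonomial (e x.1) z * conj (torusMonomial (e x.2) z) with hU
  set V : (σ → ℂ) → ℂ := fun z => ∑ x ∈ linkedPairs S e p,
    torusMonomial (e x.1 + e x.2) z * conj (torusMonomial 0 z) with hV
  set Q : ℝ := 2 * (S.card + (linkedOffDiag S e p).card : ℝ) + (nontrivialQuads S e).card with hQ
  have hUc : Continuous U := by simp only [hU]; fun_prop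
  have hVc : Continuous V := by simp only [hV]; fun_prop
  have hUb : ∀ z : σ → ℂ, (∀ i, ‖z i‖ = 1) → ‖U z‖ ≤ (linkedOffDiag S e p).card := by
    intro z hz
    rw [← nsmul_one]
    refine (norm_sum_le _ _).trans (Finset.sum_le_card_nsmul _ _ _ fun x _ => ?_)
    rw [norm_mul, RCLike.norm_conj, norm_torusMonomial _ hz, norm_torusMonomial _ hz, one_mul]
  have hVb : ∀ z : σ → ℂ, (∀ i, ‖z i‖ = 1) → ‖V z‖ ≤ (linkedPairs S e p).card := by
    intro z hz
    rw [← nsmul_one]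
    refine (norm_sum_le _ _).trans (Finset.sum_le_card_nsmul _ _ _ fun x _ => ?_)
    rw [norm_mul, RCLike.norm_conj, norm_torusMonomial _ hz, norm_torusMonomial _ hz, one_mul]
  have hU2 : ∫ z, ‖U z‖ ∂ν ≤ Real.sqrt Q := by
    refine (integral_norm_le_sqrt_integral_sq (MemLp.of_bound hUc.aestronglyMeasurable _
      (hν.ae_norm.mono hUb))).trans (Real.sqrt_le_sqrt ?_)
    simp only [hU]
    rw [integral_norm_sq_sum_torusMonomial hν]
    have h : (((linkedOffDiag S e p ×ˢ linkedOffDiag S e p).filter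
      (fun x => e x.1.1 + e x.2.2 = e x.2.1 + e x.1.2)).card : ℝ)
      ≤ (linkedOffDiag S e p).card + (nontrivialQuads S e).card := by
      exact_mod_cast card_filter_linkedOffDiag_le p hinj
    refine h.trans ?_
    rw [hQ]
    have : (0 : ℝ) ≤ (linkedOffDiag S e p).card := by positivity
    have : (0 : ℝ) ≤ S.card := by positivity
    linarith
  have hV2 : ∫ z, ‖V z‖ ∂ν ≤ Real.sqrt Q := by
    refine (integral_norm_le_sqrt_integral_sq (MemLp.of_bound hVc.aestronglyMeasurable _
      (hν.ae_norm.mono hVb))).trans (Real.sqrt_le_sqrt ?_)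
    simp only [hV]
    rw [integral_norm_sq_sum_torusMonomial hν (linkedPairs S e p) (fun x => e x.1 + e x.2)
      (fun _ => 0)]
    simp only [add_zero]
    have h : (((linkedPairs S e p ×ˢ linkedPairs S e p).filter
      (fun x => e x.1.1 + e x.1.2 = e x.2.1 + e x.2.2)).card : ℝ)
      ≤ 2 * (linkedPairs S e p).card + (nontrivialQuads S e).card := by
      exact_mod_cast card_filter_linkedPairs_le p hinj
    rw [card_linkedPairs hp] at h
    push_cast at h
    exact h
  have hpt : ∀ z : σ → ℂ, (∀ i, ‖z i‖ = 1) →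
      |torusGamma S e p t z - ‖t‖ ^ 2 * S.card / 2| ≤ ‖t‖ ^ 2 / 2 * (‖U z‖ + ‖V z‖) := by
    intro z hz
    have h1 : (torusGamma S e p t z : ℝ) = ‖t‖ ^ 2 / 2 * (∑ x ∈ linkedPairs S e p,
        torusMonomial (e x.1) z * conj (torusMonomial (e x.2) z)).re
        - (conj t ^ 2 * V z).re / 2 := by
      rw [torusGamma]
      simp only [hV]
      rw [Finset.mul_sum, Complex.re_sum, Complex.re_sum, Finset.mul_sum, Finset.sum_div,
        ← Finset.sum_sub_distrib]
      refine Finset.sum_congr rfl fun x _ => ?_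
      have h0 : torusMonomial (0 : σ → ℕ) z = 1 := by simp [torusMonomial]
      rw [h0, torusMonomial_add, map_one, mul_one]
      set a := torusMonomial (e x.1) z
      set b := torusMonomial (e x.2) z
      rw [← Complex.normSq_eq_norm_sq, Complex.normSq_apply]
      simp only [Complex.mul_re, Complex.mul_im, Complex.conj_re, Complex.conj_im, Complex.I_re,
        Complex.I_im, sq]
      ring
    have h2 : ∑ x ∈ linkedPairs S e p, torusMonomial (e x.1) z * conj (torusMonomial (e x.2) z)
        = S.card + U z := by
      simp only [hU]
      rw [← Finset.sum_filter_add_sum_filter_not (linkedPairs S e p) (fun x => x.1 = x.2)]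
      congr 1
      · rw [← nsmul_one, ← Finset.sum_const]
        symm
        refine Finset.sum_bij (fun a _ => (a, a)) ?_ ?_ ?_ ?_
        · intro a ha
          simp [linkedPairs, ha, hp a ha]
        · intro a _ b _ h; exact (Prod.mk.inj h).1
        · rintro ⟨a, b⟩ hx
          simp only [linkedPairs, Finset.mem_filter, Finset.mem_product] at hx
          exact ⟨a, hx.1.1.1, Prod.ext rfl hx.2⟩
        · intro a _
          rw [Complex.mul_conj', norm_torusMonomial _ hz]
          norm_num
      · refine Finset.sum_congr ?_ fun _ _ => rfl
        ext x
        simp only [linkedPairs, linkedOffDiag, Finset.mem_filter]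
        tauto
    rw [h1, h2, Complex.add_re, Complex.natCast_re]
    have h3 : ‖t‖ ^ 2 / 2 * ((S.card : ℝ) + (U z).re) - (conj t ^ 2 * V z).re / 2
        - ‖t‖ ^ 2 * S.card / 2 = ‖t‖ ^ 2 / 2 * (U z).re - (conj t ^ 2 * V z).re / 2 := by ring
    rw [h3]
    refine (abs_sub _ _).trans ?_
    rw [abs_mul, abs_of_nonneg (by positivity : (0 : ℝ) ≤ ‖t‖ ^ 2 / 2), abs_div _ (2 : ℝ)]
    have h4 := Complex.abs_re_le_norm (U z)
    have h5 := Complex.abs_re_le_norm (conj t ^ 2 * V z)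
    rw [norm_mul, norm_pow, RCLike.norm_conj] at h5
    have h6 : |(2 : ℝ)| = 2 := by norm_num
    rw [h6]
    have := mul_le_mul_of_nonneg_left h4 (by positivity : (0 : ℝ) ≤ ‖t‖ ^ 2 / 2)
    linarith
  have hUi : Integrable (fun z => ‖U z‖) ν :=
    (integrable_of_continuous_of_bound hν hUc _ hUb).norm
  have hVi : Integrable (fun z => ‖V z‖) ν :=
    (integrable_of_continuous_of_bound hν hVc _ hVb).norm
  calc _ ≤ ∫ z, ‖t‖ ^ 2 / 2 * (‖U z‖ + ‖V z‖) ∂ν :=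
        integral_mono_of_nonneg (Eventually.of_forall fun _ => abs_nonneg _)
          ((hUi.add hVi).const_mul _) (hν.ae_norm.mono hpt)
    _ = ‖t‖ ^ 2 / 2 * (∫ z, ‖U z‖ ∂ν + ∫ z, ‖V z‖ ∂ν) := by
        rw [integral_const_mul, integral_add hUi hVi]
    _ ≤ ‖t‖ ^ 2 / 2 * (Real.sqrt Q + Real.sqrt Q) := by gcongr
    _ = _ := by ring

theorem hasDerivAt_integral_exp_torusSum (hν : IsToral ν) (S : Finset α) (e : α → σ → ℕ) (t : ℂ)
    (s : ℝ) :
    HasDerivAt (fun s : ℝ => ∫ z, Complex.exp ((s * torusSum S e t z : ℝ) * Complex.I) ∂ν)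
      (Complex.I * ∫ z, (torusSum S e t z : ℂ)
        * Complex.exp ((s * torusSum S e t z : ℝ) * Complex.I) ∂ν) s := by
  have hbd : ∀ (s : ℝ) (z : σ → ℂ), (∀ i, ‖z i‖ = 1) →
      ‖Complex.I * ((torusSum S e t z : ℂ)
        * Complex.exp ((s * torusSum S e t z : ℝ) * Complex.I))‖ ≤ S.card * ‖t‖ := by
    intro s z hz
    rw [norm_mul, norm_mul, Complex.norm_exp_ofReal_mul_I, mul_one, Complex.norm_I, one_mul,
      Complex.norm_real]
    exact abs_torusSum_le S e t hz
  have h := (hasDerivAt_integral_of_dominated_loc_of_deriv_le (μ := ν)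
    (F := fun s z => Complex.exp ((s * torusSum S e t z : ℝ) * Complex.I))
    (F' := fun s z => Complex.I * ((torusSum S e t z : ℂ)
        * Complex.exp ((s * torusSum S e t z : ℝ) * Complex.I)))
    (x₀ := s) (s := Set.univ) (bound := fun _ => S.card * ‖t‖) Filter.univ_mem
    (Eventually.of_forall fun u => (by fun_prop : Continuous _).aestronglyMeasurable)
    (integrable_of_continuous_of_bound hν (by fun_prop) 1 (fun z hz => by
      rw [Complex.norm_exp_ofReal_mul_I]))
    (by fun_prop : Continuous _).aestronglyMeasurable
    (hν.ae_norm.mono fun z hz u _ => hbd u z hz) (integrable_const _)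
    (Eventually.of_forall fun z u _ => by
      have h1 := (((hasDerivAt_id u).mul_const (torusSum S e t z)).ofReal_comp.mul_const
        Complex.I).cexp
      refine h1.congr_deriv ?_
      simp only [id, one_mul]
      ring)).2
  rwa [integral_const_mul] at h

/-- The quantitative central limit theorem on the torus. -/
theorem norm_integral_exp_torusSum_sub_le (hν : IsToral ν) {S : Finset α} {e : α → σ → ℕ}
    {p : α → σ} (hinj : Set.InjOn e S) (hp : ∀ a ∈ S, e a (p a) ≠ 0)
    (hpp : ∀ a ∈ S, ∀ b ∈ S, e b (p a) ≠ 0 → e b (p a) = e a (p a)) (t : ℂ) :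
    ‖∫ z, Complex.exp (torusSum S e t z * Complex.I) ∂ν
        - (Real.exp (-(‖t‖ ^ 2 * S.card / 4)) : ℂ)‖
      ≤ ‖t‖ ^ 2 * Real.sqrt (2 * (S.card + (linkedOffDiag S e p).card : ℝ)
          + (nontrivialQuads S e).card) := by
  set D : ℝ := ‖t‖ ^ 2 * Real.sqrt (2 * (S.card + (linkedOffDiag S e p).card : ℝ)
          + (nontrivialQuads S e).card) with hD
  set v : ℝ := ‖t‖ ^ 2 * S.card / 2 with hv
  have hv0 : 0 ≤ v := by positivity
  set φ : ℝ → ℂ := fun s => ∫ z, Complex.exp ((s * torusSum S e t z : ℝ) * Complex.I) ∂ν with hφ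
  have hD' : ∫ z, |torusGamma S e p t z - v| ∂ν ≤ D := integral_abs_torusGamma_sub_le hν hinj hp t
  have hexpi : ∀ s : ℝ, Integrable
      (fun z => Complex.exp ((s * torusSum S e t z : ℝ) * Complex.I)) ν := fun s =>
    integrable_of_continuous_of_bound hν (by fun_prop) 1 (fun z hz => by
      rw [Complex.norm_exp_ofReal_mul_I])
  have hgi : ∀ s : ℝ, Integrable (fun z => (torusGamma S e p t z : ℂ)
      * Complex.exp ((s * torusSum S e t z : ℝ) * Complex.I)) ν := fun s =>
    integrable_of_continuous_of_bound hν (by fun_prop) _ (fun z hz => by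
      rw [norm_mul, Complex.norm_exp_ofReal_mul_I, mul_one, Complex.norm_real]
      exact abs_torusGamma_le S e p t hz)
  have hder : ∀ s : ℝ, HasDerivAt φ (-(s : ℂ) * ∫ z, (torusGamma S e p t z : ℂ)
      * Complex.exp ((s * torusSum S e t z : ℝ) * Complex.I) ∂ν) s := by
    intro s
    refine (hasDerivAt_integral_exp_torusSum hν S e t s).congr_deriv ?_
    rw [integral_torusSum_mul_exp hν hp hpp]
    rw [← mul_assoc]
    congr 1
    linear_combination (s : ℂ) * Complex.I_mul_I
  -- With the integrating factor e^(s²v/2) the derivative involves only Γ - v. Its norm on [0, 1] is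
  -- at most e^(v/2) D, and this exponential cancels when multiplying back by e^(-v/2).
  have hψ : ∀ s : ℝ, HasDerivAt (fun s : ℝ => ((Real.exp (s ^ 2 * v / 2) : ℝ) : ℂ) * φ s)
      (((Real.exp (s ^ 2 * v / 2) : ℝ) : ℂ) * (-(s : ℂ) * ∫ z, ((torusGamma S e p t z - v : ℝ) : ℂ)
      * Complex.exp ((s * torusSum S e t z : ℝ) * Complex.I) ∂ν)) s := by
    intro s
    have h1 : HasDerivAt (fun s : ℝ => s ^ 2 * v / 2) (s * v) s := by
      have := ((hasDerivAt_pow 2 s).mul_const v).div_const 2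
      refine this.congr_deriv ?_
      simp
      ring
    refine (h1.exp.ofReal_comp.mul (hder s)).congr_deriv ?_
    have h2 : ∫ z, ((torusGamma S e p t z - v : ℝ) : ℂ)
        * Complex.exp ((s * torusSum S e t z : ℝ) * Complex.I) ∂ν
        = ∫ z, (torusGamma S e p t z : ℂ)
          * Complex.exp ((s * torusSum S e t z : ℝ) * Complex.I) ∂ν - v * φ s := by
      rw [hφ, ← integral_const_mul, ← integral_sub (hgi s) ((hexpi s).const_mul _)]
      congr 1
      ext z
      push_cast
      ring
    rw [h2]
    push_cast
    ring
  have hbound : ∀ s ∈ Set.Ico (0 : ℝ) 1,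
      ‖((Real.exp (s ^ 2 * v / 2) : ℝ) : ℂ) * (-(s : ℂ) * ∫ z, ((torusGamma S e p t z - v : ℝ) : ℂ)
      * Complex.exp ((s * torusSum S e t z : ℝ) * Complex.I) ∂ν)‖ ≤ Real.exp (v / 2) * D := by
    intro s hs
    rw [norm_mul, norm_mul, norm_neg, Complex.norm_real, Complex.norm_real,
      Real.norm_of_nonneg (Real.exp_pos _).le, Real.norm_of_nonneg hs.1]
    have h1 : ‖∫ z, ((torusGamma S e p t z - v : ℝ) : ℂ)
        * Complex.exp ((s * torusSum S e t z : ℝ) * Complex.I) ∂ν‖ ≤ D := by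
      refine (norm_integral_le_integral_norm _).trans ?_
      simp_rw [norm_mul, Complex.norm_exp_ofReal_mul_I, mul_one, Complex.norm_real,
        Real.norm_eq_abs]
      exact hD'
    have h2 : s ^ 2 * v / 2 ≤ v / 2 := by
      have : s ^ 2 ≤ 1 := pow_le_one₀ hs.1 hs.2.le
      nlinarith
    have h3 : s * ‖∫ z, ((torusGamma S e p t z - v : ℝ) : ℂ)
        * Complex.exp ((s * torusSum S e t z : ℝ) * Complex.I) ∂ν‖ ≤ 1 * D :=
      mul_le_mul hs.2.le h1 (norm_nonneg _) zero_le_one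
    rw [one_mul] at h3
    exact mul_le_mul (Real.exp_le_exp.2 h2) h3 (mul_nonneg hs.1 (norm_nonneg _))
      (Real.exp_pos _).le
  have hmv := norm_image_sub_le_of_norm_deriv_le_segment_01'
    (fun s _ => (hψ s).hasDerivWithinAt) hbound
  have hφ0 : φ 0 = 1 := by simp [hφ]
  have hφ1 : φ 1 = ∫ z, Complex.exp (torusSum S e t z * Complex.I) ∂ν := by simp [hφ]
  have hve : -(‖t‖ ^ 2 * S.card / 4) = -(v / 2) := by rw [hv]; ring
  rw [← hφ1, hve]
  simp only [one_pow, one_mul, hφ0] at hmv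
  norm_num at hmv
  have hfac : φ 1 - (Real.exp (-(v / 2)) : ℂ)
      = ((Real.exp (-(v / 2)) : ℝ) : ℂ) * (((Real.exp (v / 2) : ℝ) : ℂ) * φ 1 - 1) := by
    rw [mul_sub, ← mul_assoc, ← Complex.ofReal_mul, ← Real.exp_add]
    simp
  rw [hfac, norm_mul, Complex.norm_real, Real.norm_of_nonneg (Real.exp_pos _).le]
  calc _ ≤ Real.exp (-(v / 2)) * (Real.exp (v / 2) * D) := by
        gcongr
        simpa using hmv
    _ = D := by rw [← mul_assoc, ← Real.exp_add]; simp

end TorusCLT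
end

noncomputable section

open Classical UniqueFactorizationMonoid

/-! ### Rotation invariance of the uniform law on the circle. -/

section CircleMeasure

/-- Rewriting the law as an image of Haar measure on the additive circle makes rotation invariance a
consequence of translation invariance. The value of the constant c plays no role. -/
theorem unitCircleUniform_eq [Fact (0 < 2 * Real.pi)] :
    ∃ c : ENNReal, unitCircleUniform = c • (volume : Measure (AddCircle (2 * Real.pi))).map
      (fun x => ((AddCircle.toCircle x : Circle) : ℂ)) := by
  refine ⟨(volume (Set.Ioc (0 : ℝ) (2 * Real.pi)))⁻¹, ?_⟩
  have h := AddCircle.measurePreserving_mk (2 * Real.pi) 0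
  rw [zero_add] at h
  have hm : Measurable (fun x : AddCircle (2 * Real.pi) => ((AddCircle.toCircle x : Circle) : ℂ)) :=
    (continuous_subtype_val.comp AddCircle.continuous_toCircle).measurable
  rw [unitCircleUniform, ProbabilityTheory.cond, Measure.map_smul, ← h.map_eq,
    Measure.map_map hm h.measurable]
  congr 2
  ext θ
  simp only [Function.comp_apply]
  rw [AddCircle.toCircle_apply_mk, Circle.coe_exp]
  congr 2
  push_cast
  field_simp

instance isProbabilityMeasure_unitCircleUniform : IsProbabilityMeasure unitCircleUniform := by
  have : IsProbabilityMeasure (cond (volume : Measure ℝ) (Set.Ioc 0 (2 * Real.pi))) := by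
    refine cond_isProbabilityMeasure_of_finite ?_ ?_
    · rw [Real.volume_Ioc]; simp [Real.pi_pos]
    · rw [Real.volume_Ioc]; exact ENNReal.ofReal_ne_top
  exact Measure.isProbabilityMeasure_map (by fun_prop)

theorem measurePreserving_mul_unitCircleUniform (u : ℝ) :
    MeasurePreserving (fun z : ℂ => Complex.exp (u * Complex.I) * z)
      unitCircleUniform unitCircleUniform := by
  have : Fact (0 < 2 * Real.pi) := ⟨Real.two_pi_pos⟩
  obtain ⟨c, hc⟩ := unitCircleUniform_eq
  have hm : Measurable (fun x : AddCircle (2 * Real.pi) => ((AddCircle.toCircle x : Circle) : ℂ)) :=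
    (continuous_subtype_val.comp AddCircle.continuous_toCircle).measurable
  have hmul : Measurable (fun z : ℂ => Complex.exp (u * Complex.I) * z) := by fun_prop
  refine ⟨hmul, ?_⟩
  have hadd := measurePreserving_add_left (volume : Measure (AddCircle (2 * Real.pi)))
    (u : AddCircle (2 * Real.pi))
  rw [hc, Measure.map_smul, Measure.map_map hmul hm]
  conv_rhs => rw [← hadd.map_eq, Measure.map_map hm hadd.measurable]
  congr 2
  ext x
  simp only [Function.comp_apply]
  rw [AddCircle.toCircle_add, AddCircle.toCircle_apply_mk, Circle.coe_mul, Circle.coe_exp]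
  congr 3
  push_cast
  field_simp

theorem ae_norm_unitCircleUniform : ∀ᵐ z ∂unitCircleUniform, ‖z‖ = 1 := by
  rw [unitCircleUniform, ae_map_iff (by fun_prop) (measurableSet_eq_fun (by fun_prop) (by fun_prop))]
  exact Eventually.of_forall fun θ => Complex.norm_exp_ofReal_mul_I θ

theorem isToral_pi (σ : Type*) [Fintype σ] :
    IsToral (Measure.pi (fun _ : σ => unitCircleUniform)) where
  rotation i u := by
    have h := measurePreserving_pi (fun _ : σ => unitCircleUniform) (fun _ => unitCircleUniform)
      (f := fun j => if j = i then (fun z : ℂ => Complex.exp (u * Complex.I) * z) else id)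
      (fun j => by
        split_ifs
        · exact measurePreserving_mul_unitCircleUniform u
        · exact MeasurePreserving.id _)
    convert h using 1
    ext z j
    by_cases hj : j = i
    · subst hj; simp [torusRotation]
    · simp [torusRotation, hj]
  ae_norm := by
    rw [ae_all_iff]
    intro i
    exact (measurePreserving_eval (fun _ : σ => unitCircleUniform) i).quasiMeasurePreserving.ae
      ae_norm_unitCircleUniform

end CircleMeasure

/-! ### Characteristic function of the limit law. -/

section Gaussian

open ComplexConjugate

theorem charFun_stdComplexNormal (t : ℂ) :
    charFun stdComplexNormal t = (Real.exp (-(‖t‖ ^ 2 / 4)) : ℂ) := by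
  rw [charFun_apply, stdComplexNormal, integral_map (by fun_prop) (by fun_prop)]
  have h1 : ∀ p : ℝ × ℝ, Complex.exp (inner ℝ ((p.1 : ℂ) + (p.2 : ℂ) * Complex.I) t * Complex.I)
      = Complex.exp (t.re * p.1 * Complex.I) * Complex.exp (t.im * p.2 * Complex.I) := by
    intro p
    rw [← Complex.exp_add, Complex.inner]
    congr 1
    simp
    ring
  simp_rw [h1]
  rw [integral_prod_mul (fun x : ℝ => Complex.exp (t.re * x * Complex.I))
    (fun x : ℝ => Complex.exp (t.im * x * Complex.I)), ← charFun_apply_real, ← charFun_apply_real,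
    charFun_gaussianReal, charFun_gaussianReal, ← Complex.exp_add, Complex.ofReal_exp]
  congr 1
  rw [← Complex.normSq_eq_norm_sq, Complex.normSq_apply]
  push_cast
  ring

end Gaussian

/-! ### Replacing the full sum by a sum over a large subset. -/

section TorusApprox

open ComplexConjugate

variable {σ α : Type*} [Fintype σ] {ν : Measure (σ → ℂ)} [IsProbabilityMeasure ν]

theorem norm_exp_mul_I_sub_le (a b : ℝ) :
    ‖Complex.exp (a * Complex.I) - Complex.exp (b * Complex.I)‖ ≤ |a - b| := by
  have h := Real.norm_exp_I_mul_ofReal_sub_one_le (x := a - b)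
  have h2 : Complex.exp (a * Complex.I) - Complex.exp (b * Complex.I)
      = Complex.exp (b * Complex.I) * (Complex.exp (Complex.I * (a - b : ℝ)) - 1) := by
    rw [mul_sub, ← Complex.exp_add, mul_one]
    congr 2
    push_cast
    ring
  rw [h2, norm_mul, Complex.norm_exp_ofReal_mul_I, one_mul]
  exact h

/-- Since e^{ix} is 1-Lipschitz, the difference is at most the L¹ norm of the discarded sum times
‖t‖. By orthogonality its L² norm is the square root of the number of discarded terms. -/
theorem norm_integral_exp_torusSum_sub_subset_le (hν : IsToral ν) {S A : Finset α}
    (hSA : S ⊆ A) {e : α → σ → ℕ} (hinj : Set.InjOn e A) (t : ℂ) :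
    ‖∫ z, Complex.exp (torusSum A e t z * Complex.I) ∂ν
        - ∫ z, Complex.exp (torusSum S e t z * Complex.I) ∂ν‖
      ≤ ‖t‖ * Real.sqrt ((A \ S).card) := by
  have hi : ∀ T : Finset α, Integrable (fun z => Complex.exp (torusSum T e t z * Complex.I)) ν :=
    fun T => integrable_of_continuous_of_bound hν (by fun_prop) 1 (fun z hz => by
      rw [Complex.norm_exp_ofReal_mul_I])
  set V : (σ → ℂ) → ℂ := fun z => ∑ a ∈ A \ S,
    torusMonomial (e a) z * conj (torusMonomial 0 z) with hV
  have hVc : Continuous V := by simp only [hV]; fun_prop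
  have hVb : ∀ z : σ → ℂ, (∀ i, ‖z i‖ = 1) → ‖V z‖ ≤ (A \ S).card := by
    intro z hz
    rw [← nsmul_one]
    refine (norm_sum_le _ _).trans (Finset.sum_le_card_nsmul _ _ _ fun x _ => ?_)
    rw [norm_mul, RCLike.norm_conj, norm_torusMonomial _ hz, norm_torusMonomial _ hz, one_mul]
  have hV2 : ∫ z, ‖V z‖ ∂ν ≤ Real.sqrt ((A \ S).card) := by
    refine (integral_norm_le_sqrt_integral_sq (MemLp.of_bound hVc.aestronglyMeasurable _
      (hν.ae_norm.mono hVb))).trans (Real.sqrt_le_sqrt ?_)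
    simp only [hV]
    rw [integral_norm_sq_sum_torusMonomial hν (A \ S) e (fun _ => 0)]
    norm_cast
    refine Finset.card_le_card_of_injOn (fun x => x.1) ?_ ?_
    · intro x hx
      exact (Finset.mem_product.1 (Finset.mem_filter.1 hx).1).1
    · rintro ⟨a, b⟩ hx ⟨a', b'⟩ hx' h
      simp only [Finset.coe_filter, Set.mem_ofPred_eq, Finset.mem_product, Finset.mem_sdiff,
        add_zero] at hx hx' h
      have h1 := hinj hx.1.1.1 hx.1.2.1 hx.2
      have h2 := hinj hx'.1.1.1 hx'.1.2.1 hx'.2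
      rw [← h1, ← h2, h]
  rw [← integral_sub (hi A) (hi S)]
  refine (norm_integral_le_integral_norm _).trans ?_
  have hpt : ∀ z, ‖Complex.exp (torusSum A e t z * Complex.I)
      - Complex.exp (torusSum S e t z * Complex.I)‖ ≤ ‖t‖ * ‖V z‖ := by
    intro z
    refine (norm_exp_mul_I_sub_le _ _).trans ?_
    have h0 : torusMonomial (0 : σ → ℕ) z = 1 := by simp [torusMonomial]
    have h1 : torusSum A e t z - torusSum S e t z = (conj t * V z).re := by
      simp only [hV, h0, map_one, mul_one]
      rw [torusSum, torusSum, ← Complex.sub_re, ← mul_sub, ← Finset.sum_sdiff hSA,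
        add_sub_cancel_right]
    rw [h1]
    refine (Complex.abs_re_le_norm _).trans_eq ?_
    rw [norm_mul, RCLike.norm_conj]
  calc _ ≤ ∫ z, ‖t‖ * ‖V z‖ ∂ν :=
        integral_mono ((hi A).sub (hi S)).norm
          ((integrable_of_continuous_of_bound hν hVc _ hVb).norm.const_mul _) hpt
    _ ≤ _ := by
        rw [integral_const_mul]
        gcongr

theorem abs_exp_neg_sub_exp_neg_le {a b : ℝ} (ha : 0 ≤ a) (hab : a ≤ b) :
    |Real.exp (-a) - Real.exp (-b)| ≤ b - a := by
  have h1 : Real.exp (-b) ≤ Real.exp (-a) := Real.exp_le_exp.2 (by linarith)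
  rw [abs_of_nonneg (by linarith)]
  have h2 := Real.add_one_le_exp (-(b - a))
  have h3 : Real.exp (-b) = Real.exp (-a) * Real.exp (-(b - a)) := by
    rw [← Real.exp_add]; ring_nf
  have h4 : Real.exp (-a) ≤ 1 := Real.exp_le_one_iff.2 (by linarith)
  have h5 := Real.exp_pos (-a)
  rw [h3]
  nlinarith

/-- The central limit theorem on the torus for a family approximated by a subfamily. -/
theorem norm_integral_exp_torusSum_sub_le_of_subset (hν : IsToral ν) {S A : Finset α}
    (hSA : S ⊆ A) {e : α → σ → ℕ} {p : α → σ} (hinj : Set.InjOn e A)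
    (hp : ∀ a ∈ S, e a (p a) ≠ 0)
    (hpp : ∀ a ∈ S, ∀ b ∈ S, e b (p a) ≠ 0 → e b (p a) = e a (p a)) (t : ℂ) {η : ℝ}
    (h1 : 1 ≤ η * A.card) (hS : (A.card : ℝ) ≤ S.card + η * A.card)
    (hR : ((linkedOffDiag S e p).card : ℝ) ≤ η * (A.card : ℝ) ^ 2)
    (hN : ((nontrivialQuads S e).card : ℝ) ≤ η * (A.card : ℝ) ^ 2) :
    ‖∫ z, Complex.exp (torusSum A e ((Real.sqrt A.card : ℂ)⁻¹ * t) z * Complex.I) ∂ν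
        - (Real.exp (-(‖t‖ ^ 2 / 4)) : ℂ)‖
      ≤ ‖t‖ * Real.sqrt η + ‖t‖ ^ 2 * Real.sqrt (5 * η) + ‖t‖ ^ 2 * η / 4 := by
  set n : ℝ := (A.card : ℝ) with hn
  have hn0 : 0 < n := by
    rcases Nat.eq_zero_or_pos A.card with h | h
    · rw [hn, h] at h1; norm_num at h1
    · rw [hn]; exact_mod_cast h
  set T : ℂ := (Real.sqrt n : ℂ)⁻¹ * t with hT
  have hTn : ‖T‖ = ‖t‖ / Real.sqrt n := by
    rw [hT, norm_mul, norm_inv, Complex.norm_real, Real.norm_of_nonneg (Real.sqrt_nonneg _)]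
    ring
  have hTsq : ‖T‖ ^ 2 = ‖t‖ ^ 2 / n := by
    rw [hTn, div_pow, Real.sq_sqrt hn0.le]
  have hSn : (S.card : ℝ) + (A \ S).card = n := by
    rw [hn, ← Finset.card_sdiff_add_card_eq_card hSA]; push_cast; ring
  have hS' : ((A \ S).card : ℝ) ≤ η * n := by linarith
  have hSle : (S.card : ℝ) ≤ n := by
    have : (0 : ℝ) ≤ (A \ S).card := by positivity
    linarith
  have e1 := norm_integral_exp_torusSum_sub_subset_le hν hSA hinj T
  have e2 := norm_integral_exp_torusSum_sub_le hν
    (hinj.mono (by exact_mod_cast hSA)) hp hpp T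
  have b1 : ‖T‖ * Real.sqrt ((A \ S).card) ≤ ‖t‖ * Real.sqrt η := by
    rw [hTn, div_mul_eq_mul_div, mul_div_assoc, ← Real.sqrt_div (by positivity)]
    gcongr
    rwa [div_le_iff₀ hn0]
  have b2 : ‖T‖ ^ 2 * Real.sqrt (2 * (S.card + (linkedOffDiag S e p).card : ℝ)
          + (nontrivialQuads S e).card) ≤ ‖t‖ ^ 2 * Real.sqrt (5 * η) := by
    rw [hTsq, div_mul_eq_mul_div, mul_div_assoc]
    refine mul_le_mul_of_nonneg_left ?_ (by positivity)
    rw [div_le_iff₀ hn0]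
    refine Real.sqrt_le_iff.2 ⟨by positivity, ?_⟩
    have hη : 0 ≤ η := by
      by_contra hneg
      nlinarith
    rw [mul_pow, Real.sq_sqrt (by positivity)]
    -- From 1 ≤ η n, the diagonal term n is itself at most η n². Hence 2(n + η n²) + η n² ≤ 5 η n²,
    -- the source of the constant 5.
    have : n ≤ η * n ^ 2 := by nlinarith
    linarith
  have b3 : ‖((Real.exp (-(‖T‖ ^ 2 * S.card / 4)) : ℝ) : ℂ) - (Real.exp (-(‖t‖ ^ 2 / 4)) : ℂ)‖
      ≤ ‖t‖ ^ 2 * η / 4 := by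
    rw [← Complex.ofReal_sub, Complex.norm_real, Real.norm_eq_abs, hTsq]
    have h5 : ‖t‖ ^ 2 / n * S.card / 4 = ‖t‖ ^ 2 / 4 * (S.card / n) := by ring
    have h6 : (S.card : ℝ) / n ≤ 1 := by rw [div_le_one hn0]; exact hSle
    have h7 : 1 - (S.card : ℝ) / n ≤ η := by
      rw [sub_le_iff_le_add, ← sub_le_iff_le_add', le_div_iff₀ hn0]
      nlinarith
    refine (abs_exp_neg_sub_exp_neg_le (by positivity) ?_).trans ?_
    · rw [h5]
      exact mul_le_of_le_one_right (by positivity) h6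
    · rw [h5]
      have : (0 : ℝ) ≤ ‖t‖ ^ 2 / 4 := by positivity
      nlinarith
  calc _ = ‖(∫ z, Complex.exp (torusSum A e T z * Complex.I) ∂ν
        - ∫ z, Complex.exp (torusSum S e T z * Complex.I) ∂ν)
        + (∫ z, Complex.exp (torusSum S e T z * Complex.I) ∂ν
          - (Real.exp (-(‖T‖ ^ 2 * S.card / 4)) : ℂ))
        + (((Real.exp (-(‖T‖ ^ 2 * S.card / 4)) : ℝ) : ℂ) - (Real.exp (-(‖t‖ ^ 2 / 4)) : ℂ))‖ := by
        congr 1; ring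
    _ ≤ _ := norm_add₃_le.trans (by linarith)

end TorusApprox

/-! ### Exponents of primes in a factorization. -/

section Valuation

variable {k : Type*} [Field k]

/-- The exponent of `P` in the factorization of `F`. -/
def primeVal (P : MonicPrime k) (F : k[X]) : ℕ := (normalizedFactors F).count P.1

theorem primeVal_mul (P : MonicPrime k) {F G : k[X]} (hF : F ≠ 0) (hG : G ≠ 0) :
    primeVal P (F * G) = primeVal P F + primeVal P G := by
  rw [primeVal, normalizedFactors_mul hF hG, Multiset.count_add]; rfl

theorem primeVal_ne_zero_iff (P : MonicPrime k) {F : k[X]} (hF : F ≠ 0) :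
    primeVal P F ≠ 0 ↔ P.1 ∣ F := by
  rw [primeVal, Multiset.count_ne_zero, mem_normalizedFactors_iff' hF]
  exact ⟨fun h => h.2.2, fun h => ⟨P.2.2, P.2.1.normalize_eq_self, h⟩⟩

theorem primeVal_le_one (P : MonicPrime k) {F : k[X]} (hF : F ≠ 0) (h : ¬ P.1 ^ 2 ∣ F) :
    primeVal P F ≤ 1 := by
  by_contra hlt
  refine h ?_
  have h1 : Multiset.replicate 2 P.1 ≤ normalizedFactors F :=
    Multiset.le_count_iff_replicate_le.1 (by unfold primeVal at hlt; omega)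
  have h2 := Multiset.prod_dvd_prod_of_le h1
  rw [Multiset.prod_replicate] at h2
  exact h2.trans (prod_normalizedFactors hF).dvd

theorem eq_prod_pow_primeVal {F : k[X]} (hF : F.Monic) (s : Finset (MonicPrime k))
    (hs : ∀ P : MonicPrime k, P.1 ∣ F → P ∈ s) : F = ∏ P ∈ s, P.1 ^ primeVal P F := by
  have h1 : (normalizedFactors F).prod = F := by
    rw [prod_normalizedFactors_eq hF.ne_zero, hF.normalize_eq_self]
  conv_lhs => rw [← h1, Finset.prod_multiset_count]
  simp only [primeVal]
  rw [← Finset.prod_image (s := s) (g := fun P : MonicPrime k => P.1)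
    (f := fun P => P ^ (normalizedFactors F).count P) (fun _ _ _ _ h => Subtype.ext h)]
  refine Finset.prod_subset ?_ ?_
  · intro P hP
    rw [Multiset.mem_toFinset] at hP
    have hirr := irreducible_of_normalized_factor P hP
    have hm : P.Monic := by
      simpa [normalize_normalized_factor P hP] using Polynomial.monic_normalize hirr.ne_zero
    exact Finset.mem_image.2 ⟨⟨P, hm, hirr⟩, hs _ (dvd_of_mem_normalizedFactors hP), rfl⟩
  · intro P _ hP
    rw [Multiset.mem_toFinset] at hP
    rw [Multiset.count_eq_zero_of_notMem hP, pow_zero]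

theorem eq_of_primeVal_eq {F G : k[X]} (hF : F.Monic) (hG : G.Monic) (s : Finset (MonicPrime k))
    (hs : ∀ P : MonicPrime k, P.1 ∣ F → P ∈ s) (hs' : ∀ P : MonicPrime k, P.1 ∣ G → P ∈ s)
    (h : ∀ P ∈ s, primeVal P F = primeVal P G) : F = G := by
  rw [eq_prod_pow_primeVal hF s hs, eq_prod_pow_primeVal hG s hs']
  exact Finset.prod_congr rfl fun P hP => by rw [h P hP]

theorem exists_monicPrime_dvd {F : k[X]} (hF : F.natDegree ≠ 0) :
    ∃ P : MonicPrime k, P.1 ∣ F := by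
  have h0 : F ≠ 0 := by rintro rfl; simp at hF
  have hu : ¬ IsUnit F := fun h => hF (Polynomial.natDegree_eq_zero_of_isUnit h)
  obtain ⟨p, hp, hpF⟩ := WfDvdMonoid.exists_irreducible_factor hu h0
  refine ⟨⟨normalize p, Polynomial.monic_normalize hp.ne_zero,
    (normalize_associated p).symm.irreducible hp⟩, ?_⟩
  exact (normalize_associated p).dvd.trans hpF

end Valuation
end

noncomputable section

open Classical UniqueFactorizationMonoid

/-! ### From Steinhaus functions to the torus. -/

section Steinhaus

open ComplexConjugate

variable {k : Type*} [Field k] [Finite k] {Ω : Type*} [MeasurableSpace Ω] {μ : Measure Ω}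
  [IsProbabilityMeasure μ] {f : k[X] → Ω → ℂ}

variable (k) in
/-- The exponents of the primes of degree at most `N` in the factorization of `F`. -/
def primeExponents (N : ℕ) (F : k[X]) (P : {P // P ∈ primesIoc k 0 N}) : ℕ := primeVal P.1 F

theorem mem_primesIoc_of_dvd {N : ℕ} {F : k[X]} (hF : F.Monic ∧ F.natDegree ≤ N)
    {P : MonicPrime k} (hP : P.1 ∣ F) : P ∈ primesIoc k 0 N :=
  mem_primesIoc.2 ⟨monicPrime_natDegree_pos P,
    (Polynomial.natDegree_le_of_dvd hP hF.1.ne_zero).trans hF.2⟩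

theorem eq_of_primeExponents_add_eq {N : ℕ} {F G F' G' : k[X]} (hF : F.Monic ∧ F.natDegree ≤ N)
    (hG : G.Monic ∧ G.natDegree ≤ N) (hF' : F'.Monic ∧ F'.natDegree ≤ N)
    (hG' : G'.Monic ∧ G'.natDegree ≤ N)
    (h : primeExponents k N F + primeExponents k N G
      = primeExponents k N F' + primeExponents k N G') : F * G = F' * G' := by
  have hdvd : ∀ {F G : k[X]}, (F.Monic ∧ F.natDegree ≤ N) → (G.Monic ∧ G.natDegree ≤ N) →
      ∀ P : MonicPrime k, P.1 ∣ F * G → P ∈ primesIoc k 0 N := by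
    intro F G hF hG P hP
    rcases P.2.2.prime.dvd_or_dvd hP with h | h
    · exact mem_primesIoc_of_dvd hF h
    · exact mem_primesIoc_of_dvd hG h
  refine eq_of_primeVal_eq (hF.1.mul hG.1) (hF'.1.mul hG'.1) (primesIoc k 0 N) (hdvd hF hG)
    (hdvd hF' hG') fun P hP => ?_
  rw [primeVal_mul _ hF.1.ne_zero hG.1.ne_zero, primeVal_mul _ hF'.1.ne_zero hG'.1.ne_zero]
  exact congrFun h ⟨P, hP⟩

theorem primeExponents_injOn {N : ℕ} {A : Finset k[X]} (hA : ∀ F ∈ A, F.Monic ∧ F.natDegree ≤ N) :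
    Set.InjOn (primeExponents k N) A := by
  intro F hF G hG h
  exact eq_of_primeVal_eq (hA F hF).1 (hA G hG).1 (primesIoc k 0 N)
    (fun P hP => mem_primesIoc_of_dvd (hA F hF) hP) (fun P hP => mem_primesIoc_of_dvd (hA G hG) hP)
    fun P hP => congrFun h ⟨P, hP⟩

omit [IsProbabilityMeasure μ] in
theorem IsSteinhaus.eq_torusMonomial (hf : IsSteinhaus f μ) {N : ℕ} {F : k[X]}
    (hF : F.Monic ∧ F.natDegree ≤ N) (ω : Ω) :
    f F ω = torusMonomial (primeExponents k N F)
      (fun P : {P // P ∈ primesIoc k 0 N} => f P.1.1 ω) := by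
  conv_lhs => rw [eq_prod_pow_primeVal hF.1 (primesIoc k 0 N)
    (fun P hP => mem_primesIoc_of_dvd hF hP)]
  rw [hf.multiplicative, torusMonomial, ← Finset.prod_coe_sort]
  rfl

omit [Finite k] in
theorem IsSteinhaus.map_eq_pi (hf : IsSteinhaus f μ) (s : Finset (MonicPrime k)) :
    μ.map (fun ω (P : {P // P ∈ s}) => f P.1.1 ω)
      = Measure.pi (fun _ : {P // P ∈ s} => unitCircleUniform) := by
  have h1 : iIndepFun (fun P : {P // P ∈ s} => f P.1.1) μ :=
    hf.indep.precomp (g := fun P : {P // P ∈ s} => P.1) Subtype.val_injective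
  have h2 := (iIndepFun_iff_map_fun_eq_pi_map (f := fun P : {P // P ∈ s} => f P.1.1)
    (fun P => (hf.measurable P.1).aemeasurable)).1 h1
  rw [h2]
  congr 1
  ext1 P
  exact hf.law P.1

omit [IsProbabilityMeasure μ] in
theorem IsSteinhaus.measurable_monic (hf : IsSteinhaus f μ) {F : k[X]} (hF : F.Monic) :
    Measurable (f F) := by
  have h : f F = fun ω => torusMonomial (primeExponents k F.natDegree F)
      (fun P : {P // P ∈ primesIoc k 0 F.natDegree} => f P.1.1 ω) := by
    ext ω
    exact hf.eq_torusMonomial ⟨hF, le_rfl⟩ ω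
  rw [h]
  exact (continuous_torusMonomial _).measurable.comp
    (measurable_pi_lambda _ fun P => hf.measurable P.1)

omit [IsProbabilityMeasure μ] in
theorem IsSteinhaus.measurable_normalizedSum (hf : IsSteinhaus f μ) {A : Finset k[X]}
    (hA : ∀ F ∈ A, F.Monic) : Measurable (normalizedSum f A) := by
  unfold normalizedSum
  exact (Finset.measurable_fun_sum A fun F hF => hf.measurable_monic (hA F hF)).const_mul _

theorem IsSteinhaus.charFun_normalizedSum (hf : IsSteinhaus f μ) {N : ℕ} {A : Finset k[X]}
    (hA : ∀ F ∈ A, F.Monic ∧ F.natDegree ≤ N) (t : ℂ) :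
    charFun (μ.map (normalizedSum f A)) t
      = ∫ z, Complex.exp (torusSum A (primeExponents k N) ((Real.sqrt A.card : ℂ)⁻¹ * t) z
          * Complex.I) ∂(Measure.pi (fun _ : {P // P ∈ primesIoc k 0 N} => unitCircleUniform)) := by
  have hm : Measurable (fun ω (P : {P // P ∈ primesIoc k 0 N}) => f P.1.1 ω) :=
    measurable_pi_lambda _ fun P => hf.measurable P.1
  rw [charFun_apply, integral_map
    (hf.measurable_normalizedSum fun F hF => (hA F hF).1).aemeasurable (by fun_prop),
    ← hf.map_eq_pi, integral_map hm.aemeasurable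
      (by fun_prop : Continuous _).aestronglyMeasurable]
  congr 1
  ext ω
  congr 3
  rw [Complex.inner, torusSum, normalizedSum, map_mul, map_mul, map_inv₀,
    Complex.conj_ofReal]
  have : ∑ F ∈ A, torusMonomial (primeExponents k N F)
      (fun P : {P // P ∈ primesIoc k 0 N} => f P.1.1 ω) = ∑ F ∈ A, f F ω :=
    Finset.sum_congr rfl fun F hF => (hf.eq_torusMonomial (hA F hF) ω).symm
  rw [this, ← Complex.conj_re]
  congr 1
  simp
  ring

/-- The nontrivial solutions of `F₁ F₂ = G₁ G₂`. -/
def nontrivialProducts (S : Finset k[X]) : Finset ((k[X] × k[X]) × (k[X] × k[X])) :=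
  ((S ×ˢ S) ×ˢ (S ×ˢ S)).filter (fun x => x.1.1 * x.1.2 = x.2.1 * x.2.2 ∧
    x.1.1 ≠ x.2.1 ∧ x.1.1 ≠ x.2.2)

/-- The pairs `(F, G)` with `F ≠ G` and `p F ∣ G`. -/
def dividingPairs (S : Finset k[X]) (p : k[X] → MonicPrime k) : Finset (k[X] × k[X]) :=
  (S ×ˢ S).filter (fun x => x.1 ≠ x.2 ∧ (p x.1).1 ∣ x.2)

/-- The quantitative central limit theorem for sums of a Steinhaus function. -/
theorem IsSteinhaus.norm_charFun_sub_le (hf : IsSteinhaus f μ) {N : ℕ} (hN1 : 1 ≤ N)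
    {S A : Finset k[X]} (hSA : S ⊆ A) (hA : ∀ F ∈ A, F.Monic ∧ F.natDegree ≤ N)
    (p : k[X] → MonicPrime k) (hp : ∀ F ∈ S, (p F).1 ∣ F)
    (hpp : ∀ F ∈ S, ∀ G ∈ S, (p F).1 ∣ G → primeVal (p F) G = primeVal (p F) F) (t : ℂ) {η : ℝ}
    (h1 : 1 ≤ η * A.card) (hS : (A.card : ℝ) ≤ S.card + η * A.card)
    (hR : ((dividingPairs S p).card : ℝ) ≤ η * (A.card : ℝ) ^ 2)
    (hN : ((nontrivialProducts S).card : ℝ) ≤ η * (A.card : ℝ) ^ 2) :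
    ‖charFun (μ.map (normalizedSum f A)) t - charFun stdComplexNormal t‖
      ≤ ‖t‖ * Real.sqrt η + ‖t‖ ^ 2 * Real.sqrt (5 * η) + ‖t‖ ^ 2 * η / 4 := by
  -- The coordinate map must be total with values in primes of degree at most N. The prime X,
  -- available since N ≥ 1, serves as the value where p F is not such a prime, which never happens
  -- on S.
  have hX : (⟨Polynomial.X, Polynomial.monic_X, Polynomial.irreducible_X⟩ : MonicPrime k)
      ∈ primesIoc k 0 N := by
    rw [mem_primesIoc, Polynomial.natDegree_X]; omega
  set p' : k[X] → {P // P ∈ primesIoc k 0 N} := fun F =>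
    if h : p F ∈ primesIoc k 0 N then ⟨p F, h⟩ else ⟨_, hX⟩ with hp'
  have hp'eq : ∀ F ∈ S, (p' F).1 = p F := by
    intro F hF
    have h : p F ∈ primesIoc k 0 N := mem_primesIoc_of_dvd (hA F (hSA hF)) (hp F hF)
    simp [hp', h]
  have hm : ∀ F ∈ S, F ≠ 0 := fun F hF => (hA F (hSA hF)).1.ne_zero
  have hval : ∀ F ∈ S, ∀ G, primeExponents k N G (p' F) = primeVal (p F) G := by
    intro F hF G
    rw [primeExponents, hp'eq F hF]
  rw [hf.charFun_normalizedSum hA, charFun_stdComplexNormal]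
  refine norm_integral_exp_torusSum_sub_le_of_subset (isToral_pi _) hSA (p := p')
    (primeExponents_injOn hA) ?_ ?_ t h1 hS ?_ ?_
  · intro F hF
    rw [hval F hF, primeVal_ne_zero_iff _ (hm F hF)]
    exact hp F hF
  · intro F hF G hG
    rw [hval F hF, hval F hF, primeVal_ne_zero_iff _ (hm G hG)]
    exact hpp F hF G hG
  · refine le_trans ?_ hR
    norm_cast
    refine Finset.card_le_card fun x hx => ?_
    simp only [linkedOffDiag, dividingPairs, Finset.mem_filter, Finset.mem_product] at hx ⊢
    refine ⟨hx.1, hx.2.1, ?_⟩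
    rw [← primeVal_ne_zero_iff _ (hm _ hx.1.2), ← hval _ hx.1.1]
    exact hx.2.2
  · refine le_trans ?_ hN
    norm_cast
    refine Finset.card_le_card fun x hx => ?_
    simp only [nontrivialQuads, nontrivialProducts, Finset.mem_filter, Finset.mem_product] at hx ⊢
    refine ⟨hx.1, ?_, hx.2.2⟩
    exact eq_of_primeExponents_add_eq (hA _ (hSA hx.1.1.1)) (hA _ (hSA hx.1.1.2))
      (hA _ (hSA hx.1.2.1)) (hA _ (hSA hx.1.2.2)) hx.2.1

end Steinhaus
end

noncomputable section

open Classical UniqueFactorizationMonoid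

/-! ### Pairs sharing a large prime, and exceptional elements of an interval. -/

section Exceptional

variable {k : Type*} [Field k] [Finite k]

/-- A prime of degree d with D < d ≤ h + 1 divides exactly a proportion q^(-d) of the ball. A prime
of larger degree cannot divide two distinct elements, so it yields no pair. -/
theorem card_dividingPairs_le {K : k[X]} {h D : ℕ} {S : Finset k[X]}
    (hS : S ⊆ polyBall K (h + 1)) (p : k[X] → MonicPrime k) (hp : ∀ F ∈ S, (p F).1 ∣ F)
    (hD : ∀ F ∈ S, D < (p F).1.natDegree) :
    ((dividingPairs S p).card : ℝ)
      ≤ ((Nat.card k : ℝ) ^ (D + 1))⁻¹ * ((polyBall K (h + 1)).card : ℝ) ^ 2 := by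
  set A := polyBall K (h + 1)
  have hq := two_le_natCard_real k
  have hA : (A.card : ℝ) = (Nat.card k : ℝ) ^ (h + 1) := by
    rw [card_polyBall]; push_cast; rfl
  have h1 : ∀ F ∈ S, ((S.filter (fun G => F ≠ G ∧ (p F).1 ∣ G)).card : ℝ)
      ≤ (Nat.card k : ℝ) ^ (h + 1) * ((Nat.card k : ℝ) ^ (D + 1))⁻¹ := by
    intro F hF
    by_cases hd : (p F).1.natDegree ≤ h + 1
    · calc ((S.filter (fun G => F ≠ G ∧ (p F).1 ∣ G)).card : ℝ)
          ≤ ((A.filter ((p F).1 ∣ ·)).card : ℝ) := by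
            norm_cast
            refine Finset.card_le_card fun G hG => ?_
            rw [Finset.mem_filter] at hG ⊢
            exact ⟨hS hG.1, hG.2.2⟩
        _ = _ := card_filter_dvd_polyBall_real (p F).2.1 K hd
        _ ≤ _ := by
            gcongr
            · linarith
            · exact hD F hF
    · have : S.filter (fun G => F ≠ G ∧ (p F).1 ∣ G) = ∅ := by
        refine Finset.filter_eq_empty_iff.2 fun G hG hFG => hd ?_
        exact (natDegree_lt_of_dvd_of_mem_polyBall (hS hF) (hS hG) hFG.1 (hp F hF) hFG.2).le
      rw [this, Finset.card_empty]
      push_cast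
      positivity
  have h2 : (dividingPairs S p).card
      = ∑ F ∈ S, (S.filter (fun G => F ≠ G ∧ (p F).1 ∣ G)).card := by
    rw [dividingPairs, Finset.card_filter, Finset.sum_product]
    exact Finset.sum_congr rfl fun F _ => by rw [Finset.card_filter]
  rw [h2]
  push_cast
  refine (Finset.sum_le_card_nsmul _ _ _ h1).trans ?_
  rw [nsmul_eq_mul, ← hA]
  have : (S.card : ℝ) ≤ A.card := by exact_mod_cast Finset.card_le_card hS
  calc (S.card : ℝ) * (A.card * ((Nat.card k : ℝ) ^ (D + 1))⁻¹)
      ≤ A.card * (A.card * ((Nat.card k : ℝ) ^ (D + 1))⁻¹) := by gcongr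
    _ = _ := by ring

/-- If 2 deg P ≤ h + 1 the count of multiples of P² is exact, and the sum of |P|^(-2) converges.
Otherwise at most one element is divisible by P². The number of these larger primes of degree at
most h is of order q^h / h, and the limit h rather than h + 1 saves a factor q. -/
theorem card_filter_sq_dvd_le (K : k[X]) (D h : ℕ) :
    (((polyBall K (h + 1)).filter (fun F => ∃ P : MonicPrime k, D < P.1.natDegree ∧
      P.1.natDegree ≤ h ∧ P.1 ^ 2 ∣ F)).card : ℝ)
      ≤ (Nat.card k : ℝ) ^ (h + 1) *
        (2 * ((Nat.card k : ℝ) ^ (D + 1))⁻¹ + 4 / (Nat.card k * (h + 2))) := by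
  set A := polyBall K (h + 1) with hA
  have hq := two_le_natCard_real k
  have hq0 := natCard_real_pos k
  have h1 : A.filter (fun F => ∃ P : MonicPrime k, D < P.1.natDegree ∧
      P.1.natDegree ≤ h ∧ P.1 ^ 2 ∣ F) ⊆
      (primesIoc k D h).biUnion (fun P => A.filter (P.1 ^ 2 ∣ ·)) := by
    intro F hF
    obtain ⟨hFA, P, hP1, hP2, hP3⟩ := Finset.mem_filter.1 hF
    exact Finset.mem_biUnion.2 ⟨P, mem_primesIoc.2 ⟨hP1, hP2⟩, Finset.mem_filter.2 ⟨hFA, hP3⟩⟩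
  have h2 : ∀ P ∈ primesIoc k D h, ((A.filter (P.1 ^ 2 ∣ ·)).card : ℝ)
      ≤ (Nat.card k : ℝ) ^ (h + 1) * invNorm P ^ 2
        + if h + 1 < 2 * P.1.natDegree then 1 else 0 := by
    intro P _
    have hdeg : (P.1 ^ 2).natDegree = 2 * P.1.natDegree := Polynomial.natDegree_pow _ _
    split_ifs with hd
    · have h3 : ((A.filter (P.1 ^ 2 ∣ ·)).card : ℝ) ≤ 1 := by
        exact_mod_cast card_filter_dvd_polyBall_le_one K (by omega)
      have : 0 ≤ (Nat.card k : ℝ) ^ (h + 1) * invNorm P ^ 2 := by positivity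
      linarith
    · have := card_filter_dvd_polyBall_real (P.2.1.pow 2) K (x := h + 1) (by omega)
      rw [hA, this, hdeg, add_zero, invNorm, ← inv_pow, ← inv_pow, ← pow_mul, mul_comm 2]
  have h3 : ∑ P ∈ primesIoc k D h, (if h + 1 < 2 * P.1.natDegree then (1 : ℝ) else 0)
      ≤ (Nat.card k : ℝ) ^ (h + 1) * (4 / (Nat.card k * (h + 2))) := by
    rw [sum_primesIoc_eq]
    have h4 : ∀ n ∈ Finset.Ioc D h, ∑ P ∈ primesEq k n,
        (if h + 1 < 2 * P.1.natDegree then (1 : ℝ) else 0)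
        ≤ (Nat.card k : ℝ) ^ n * (2 / (h + 2)) := by
      intro n hn
      have hn0 : n ≠ 0 := by have := Finset.mem_Ioc.1 hn; omega
      rw [Finset.sum_congr rfl fun P hP => by rw [mem_primesEq.1 hP], Finset.sum_const,
        nsmul_eq_mul]
      split_ifs with hd
      · rw [mul_one]
        refine (card_primesEq_le hn0).trans ?_
        rw [div_eq_mul_inv]
        gcongr
        rw [← inv_div]
        refine inv_anti₀ (by positivity) ?_
        rw [div_le_iff₀ (by norm_num)]
        have : (h : ℝ) + 2 ≤ 2 * n := by exact_mod_cast (by omega : h + 2 ≤ 2 * n)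
        linarith
      · rw [mul_zero]; positivity
    have hgeo : ∀ m : ℕ, ∑ n ∈ Finset.Ioc 0 m, (Nat.card k : ℝ) ^ n ≤ 2 * (Nat.card k : ℝ) ^ m := by
      intro m
      induction m with
      | zero => simp
      | succ m ih =>
        rw [Finset.sum_Ioc_succ_top (Nat.zero_le m), pow_succ]
        have : 0 < (Nat.card k : ℝ) ^ m := by positivity
        nlinarith
    refine (Finset.sum_le_sum h4).trans ?_
    rw [← Finset.sum_mul]
    calc _ ≤ (∑ n ∈ Finset.Ioc 0 h, (Nat.card k : ℝ) ^ n) * (2 / (h + 2)) := by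
          gcongr
          exact Nat.zero_le D
      _ ≤ (2 * (Nat.card k : ℝ) ^ h) * (2 / (h + 2)) := by
          gcongr
          exact hgeo h
      _ = _ := by
          rw [pow_succ]
          field_simp
          norm_num
  calc _ ≤ ∑ P ∈ primesIoc k D h, ((A.filter (P.1 ^ 2 ∣ ·)).card : ℝ) := by
        exact_mod_cast (Finset.card_le_card h1).trans Finset.card_biUnion_le
    _ ≤ _ := Finset.sum_le_sum h2
    _ = (Nat.card k : ℝ) ^ (h + 1) * ∑ P ∈ primesIoc k D h, invNorm P ^ 2
        + ∑ P ∈ primesIoc k D h, (if h + 1 < 2 * P.1.natDegree then (1 : ℝ) else 0) := by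
        rw [Finset.sum_add_distrib, Finset.mul_sum]
    _ ≤ (Nat.card k : ℝ) ^ (h + 1) * (2 * ((Nat.card k : ℝ) ^ (D + 1))⁻¹)
        + (Nat.card k : ℝ) ^ (h + 1) * (4 / (Nat.card k * (h + 2))) := by
        gcongr
        exact sum_invNorm_sq_le D h
    _ = _ := by ring

/-- Chebyshev's inequality: such F have ω = 0 on primes with degree in (D, (h+1)/2], while mean and
variance bound are both governed by M. The cut (h+1)/2 is what the second moment bound requires. -/
theorem card_filter_smooth_le (K : k[X]) {D h : ℕ} {L : ℝ} (hL0 : 0 < L)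
    (hL : L ≤ ∑ P ∈ primesIoc k D ((h + 1) / 2), invNorm P) :
    (((polyBall K (h + 1)).filter (fun F => ∀ P : MonicPrime k, D < P.1.natDegree →
      ¬ P.1 ∣ F)).card : ℝ) ≤ (Nat.card k : ℝ) ^ (h + 1) * L⁻¹ := by
  set M := ∑ P ∈ primesIoc k D ((h + 1) / 2), invNorm P with hM
  have h1 := sum_omegaOn_sub_sq_le (primesIoc k D ((h + 1) / 2)) (y := (h + 1) / 2) (x := h + 1)
    (fun P hP => (mem_primesIoc.1 hP).2) (by omega) K
  rw [← hM] at h1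
  set B := (polyBall K (h + 1)).filter (fun F => ∀ P : MonicPrime k, D < P.1.natDegree →
      ¬ P.1 ∣ F)
  have h2 : (B.card : ℝ) * M ^ 2 ≤ (Nat.card k : ℝ) ^ (h + 1) * M := by
    refine le_trans ?_ h1
    calc (B.card : ℝ) * M ^ 2 = ∑ F ∈ B, (0 - M) ^ 2 := by
          rw [Finset.sum_const, nsmul_eq_mul]; ring
      _ = ∑ F ∈ B, ((omegaOn (primesIoc k D ((h + 1) / 2)) F : ℝ) - M) ^ 2 := by
          refine Finset.sum_congr rfl fun F hF => ?_
          have : omegaOn (primesIoc k D ((h + 1) / 2)) F = 0 := by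
            rw [omegaOn, Finset.card_eq_zero]
            exact Finset.filter_eq_empty_iff.2 fun P hP =>
              (Finset.mem_filter.1 hF).2 P (mem_primesIoc.1 hP).1
          rw [this]; simp
      _ ≤ _ := Finset.sum_le_sum_of_subset_of_nonneg (Finset.filter_subset _ _)
          fun _ _ _ => sq_nonneg _
  have hM0 : 0 < M := hL0.trans_le hL
  have h3 : (B.card : ℝ) * M ≤ (Nat.card k : ℝ) ^ (h + 1) := by
    have : (B.card : ℝ) * M * M ≤ (Nat.card k : ℝ) ^ (h + 1) * M := by linarith [h2, sq M]
    exact le_of_mul_le_mul_right this hM0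
  rw [← div_eq_mul_inv, le_div_iff₀ hL0]
  exact (mul_le_mul_of_nonneg_left hL (Nat.cast_nonneg _)).trans h3

/-- The number of primes of degree at most `y` dividing `F`, with exponents capped at `2`. -/
def cappedOmega (y : ℕ) (F : k[X]) : ℕ :=
  omegaOn (primesIoc k 0 y) F + ((primesIoc k 0 y).filter (·.1 ^ 2 ∣ F)).card

/-- A prime dividing A or B divides AB, and one dividing both has its square dividing AB. Exponents
capped at 2 suffice because only products of two factors are considered. -/
theorem omegaOn_add_le_cappedOmega (y : ℕ) (A B : k[X]) :
    omegaOn (primesIoc k 0 y) A + omegaOn (primesIoc k 0 y) B ≤ cappedOmega y (A * B) := by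
  rw [omegaOn, omegaOn, cappedOmega, omegaOn, ← Finset.card_union_add_card_inter]
  refine Nat.add_le_add (Finset.card_le_card fun P hP => ?_) (Finset.card_le_card fun P hP => ?_)
  · rw [Finset.mem_union, Finset.mem_filter, Finset.mem_filter] at hP
    rw [Finset.mem_filter]
    rcases hP with h | h
    · exact ⟨h.1, h.2.mul_right _⟩
    · exact ⟨h.1, h.2.mul_left _⟩
  · rw [Finset.mem_inter, Finset.mem_filter, Finset.mem_filter] at hP
    rw [Finset.mem_filter, sq]
    exact ⟨hP.1.1, mul_dvd_mul hP.1.2 hP.2.2⟩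

/-- The mean of ω is at most 1 + log N, so exceeding m forces ω to be Δ above its mean or the number
τ of squared primes to be at least Δ. Chebyshev bounds the first event and Markov the second. -/
theorem card_filter_lt_cappedOmega_le (K : k[X]) {h m N : ℕ} {Δ : ℝ} (hΔ : 0 < Δ) (hN : h + 1 ≤ N)
    (hm : 1 + Real.log N + 2 * Δ ≤ m) :
    (((polyBall K (h + 1)).filter (fun F => m < cappedOmega ((h + 1) / 2) F)).card : ℝ)
      ≤ (Nat.card k : ℝ) ^ (h + 1) * ((1 + Real.log N) / Δ ^ 2 + 1 / Δ) := by
  set y := (h + 1) / 2 with hy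
  set A := polyBall K (h + 1) with hA
  set L := ∑ P ∈ primesIoc k 0 y, invNorm P with hL
  set ω := fun F : k[X] => (omegaOn (primesIoc k 0 y) F : ℝ) with hω
  set τ := fun F : k[X] => (((primesIoc k 0 y).filter (·.1 ^ 2 ∣ F)).card : ℝ) with hτ
  have hLN : L ≤ 1 + Real.log N := by
    refine (sum_invNorm_le_log y).trans ?_
    rcases Nat.eq_zero_or_pos y with h0 | h0
    · rw [h0]; simp
      exact Real.log_natCast_nonneg N
    · gcongr
      omega
  have hq := two_le_natCard_real k
  have h1 : ∑ F ∈ A, (ω F - L) ^ 2 ≤ (Nat.card k : ℝ) ^ (h + 1) * L :=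
    sum_omegaOn_sub_sq_le (primesIoc k 0 y) (y := y) (x := h + 1)
      (fun P hP => (mem_primesIoc.1 hP).2) (by omega) K
  have h2 : ∑ F ∈ A, τ F ≤ (Nat.card k : ℝ) ^ (h + 1) := by
    have : ∀ F, τ F = ∑ P ∈ primesIoc k 0 y, if P.1 ^ 2 ∣ F then (1 : ℝ) else 0 := by
      intro F; simp [hτ]
    simp_rw [this]
    rw [Finset.sum_comm]
    calc _ = ∑ P ∈ primesIoc k 0 y, (Nat.card k : ℝ) ^ (h + 1) * invNorm P ^ 2 := by
          refine Finset.sum_congr rfl fun P hP => ?_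
          have hdeg : (P.1 ^ 2).natDegree = 2 * P.1.natDegree := Polynomial.natDegree_pow _ _
          have hPy := (mem_primesIoc.1 hP).2
          have := card_filter_dvd_polyBall_real (P.2.1.pow 2) K (x := h + 1) (by omega)
          rw [Finset.sum_boole, hA, this, hdeg, invNorm, ← inv_pow, ← inv_pow, ← pow_mul,
            mul_comm 2]
      _ ≤ (Nat.card k : ℝ) ^ (h + 1) * 1 := by
          rw [← Finset.mul_sum]
          refine mul_le_mul_of_nonneg_left ((sum_invNorm_sq_le 0 y).trans ?_) (by positivity)
          rw [zero_add, pow_one, ← div_eq_mul_inv, div_le_one (by linarith)]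
          exact hq
      _ = _ := mul_one _
  have h3 : ∀ F ∈ A.filter (fun F => m < cappedOmega y F),
      1 ≤ (ω F - L) ^ 2 / Δ ^ 2 + τ F / Δ := by
    intro F hF
    have hF' := (Finset.mem_filter.1 hF).2
    have h4 : (m : ℝ) ≤ ω F + τ F := by
      simp only [hω, hτ]
      exact_mod_cast hF'.le
    have hτ0 : 0 ≤ τ F := by simp only [hτ]; positivity
    by_cases h5 : Δ ≤ τ F
    · have : 1 ≤ τ F / Δ := by rwa [one_le_div hΔ]
      have : 0 ≤ (ω F - L) ^ 2 / Δ ^ 2 := by positivity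
      linarith
    · have h6 : Δ ≤ ω F - L := by linarith
      have : 1 ≤ (ω F - L) ^ 2 / Δ ^ 2 := by
        rw [one_le_div (by positivity)]
        gcongr
      have : 0 ≤ τ F / Δ := by positivity
      linarith
  have hτ0 : ∀ F, 0 ≤ τ F := fun F => by simp only [hτ]; positivity
  calc _ = ∑ F ∈ A.filter (fun F => m < cappedOmega y F), (1 : ℝ) := by simp
    _ ≤ ∑ F ∈ A.filter (fun F => m < cappedOmega y F), ((ω F - L) ^ 2 / Δ ^ 2 + τ F / Δ) :=
        Finset.sum_le_sum h3
    _ ≤ ∑ F ∈ A, ((ω F - L) ^ 2 / Δ ^ 2 + τ F / Δ) :=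
        Finset.sum_le_sum_of_subset_of_nonneg (Finset.filter_subset _ _) fun F _ _ => by
          have := hτ0 F; positivity
    _ = (∑ F ∈ A, (ω F - L) ^ 2) / Δ ^ 2 + (∑ F ∈ A, τ F) / Δ := by
        rw [Finset.sum_add_distrib, Finset.sum_div, Finset.sum_div]
    _ ≤ ((Nat.card k : ℝ) ^ (h + 1) * (1 + Real.log N)) / Δ ^ 2
        + (Nat.card k : ℝ) ^ (h + 1) / Δ := by
        gcongr
        exact h1.trans (by gcongr)
    _ = _ := by ring

end Exceptional

/-! ### Nontrivial solutions of F₁F₂ = G₁G₂ in an interval. -/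

section Energy

variable {k : Type*} [Field k] [Finite k]

/-- Split F₁ as AB along the divisibility F₁ ∣ G₁G₂, with A ∣ G₁ and B ∣ G₂, normalized to be monic.
Then A is common to F₁ ≠ G₁ and B to F₁ ≠ G₂, so both have degree at most h; with deg A + deg B = N
this bounds deg A from both sides. -/
theorem exists_quadruple {K : k[X]} {N h : ℕ} (hK : K.Monic) (hKN : K.natDegree = N)
    (hh : h + 1 ≤ N) {F₁ F₂ G₁ G₂ : k[X]} (hF₁ : F₁ ∈ polyBall K (h + 1))
    (hG₁ : G₁ ∈ polyBall K (h + 1)) (hG₂ : G₂ ∈ polyBall K (h + 1)) (he : F₁ * F₂ = G₁ * G₂)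
    (h1 : F₁ ≠ G₁) (h2 : F₁ ≠ G₂) :
    ∃ a ∈ Finset.Icc (N - h) h, ∃ A ∈ polyBall (Polynomial.X ^ a : k[X]) a,
      ∃ D ∈ polyBall A (a + h + 1 - N), ∃ B ∈ polyBall (K /ₘ A) (h + 1 - a),
      ∃ C ∈ polyBall (K /ₘ A) (h + 1 - a),
        F₁ = A * B ∧ F₂ = C * D ∧ G₁ = A * C ∧ G₂ = B * D := by
  obtain ⟨mF, dF⟩ := monic_natDegree_of_mem_polyBall hK (by omega) hF₁
  obtain ⟨mG, dG⟩ := monic_natDegree_of_mem_polyBall hK (by omega) hG₁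
  obtain ⟨mG', dG'⟩ := monic_natDegree_of_mem_polyBall hK (by omega) hG₂
  obtain ⟨A₀, B₀, hA₀, hB₀, hAB₀⟩ := exists_dvd_and_dvd_of_dvd_mul (Dvd.intro _ he)
  have hA₀0 : A₀ ≠ 0 := by rintro rfl; rw [zero_mul] at hAB₀; exact mF.ne_zero hAB₀
  set c := A₀.leadingCoeff with hc
  have hc0 : c ≠ 0 := Polynomial.leadingCoeff_ne_zero.2 hA₀0
  obtain ⟨A, hAdef⟩ : ∃ A, A = A₀ * Polynomial.C c⁻¹ := ⟨_, rfl⟩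
  obtain ⟨B, hBdef⟩ : ∃ B, B = Polynomial.C c * B₀ := ⟨_, rfl⟩
  have hcc : Polynomial.C c⁻¹ * Polynomial.C c = 1 := by
    rw [← Polynomial.C_mul, inv_mul_cancel₀ hc0, Polynomial.C_1]
  have hAm : A.Monic := by rw [hAdef]; exact Polynomial.monic_mul_leadingCoeff_inv hA₀0
  have hAB : F₁ = A * B := by
    rw [hAdef, hBdef, hAB₀]
    linear_combination (-(A₀ * B₀)) * hcc
  have hBm : B.Monic := by rw [hAB] at mF; exact hAm.of_mul_monic_left mF
  obtain ⟨C, hC⟩ : A ∣ G₁ := by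
    refine Dvd.dvd.trans ⟨Polynomial.C c, ?_⟩ hA₀
    rw [hAdef]; linear_combination (-A₀) * hcc
  obtain ⟨D, hD⟩ : B ∣ G₂ := by
    refine Dvd.dvd.trans ⟨Polynomial.C c⁻¹, ?_⟩ hB₀
    rw [hBdef]; linear_combination (-B₀) * hcc
  have hF₂ : F₂ = C * D := by
    refine mul_left_cancel₀ mF.ne_zero ?_
    rw [he, hC, hD, hAB]; ring
  have hdeg : A.natDegree + B.natDegree = N := by
    rw [← hAm.natDegree_mul hBm, ← hAB, dF, hKN]
  have ha : A.natDegree < h + 1 :=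
    natDegree_lt_of_dvd_of_mem_polyBall hF₁ hG₁ h1 ⟨B, hAB⟩ ⟨C, hC⟩
  have hb : B.natDegree < h + 1 :=
    natDegree_lt_of_dvd_of_mem_polyBall hF₁ hG₂ h2 ⟨A, by rw [hAB, mul_comm]⟩ ⟨D, hD⟩
  refine ⟨A.natDegree, Finset.mem_Icc.2 (by omega), A, mem_polyBall_X_pow hAm, D, ?_, B, ?_, C, ?_,
    hAB, hF₂, hC, hD⟩
  -- G₂ = BD is close to F₁ = BA. Dividing by B, of degree N - a, places D near A; centring D at A
  -- rather than K /ₘ B makes its ball independent of B.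
  · have h3 : B * D ∈ polyBall (B * A) (h + 1) := by
      rw [← hD, mul_comm, ← hAB, mem_polyBall]
      exact sub_degree_lt_of_mem_polyBall hG₂ hF₁
    rw [mul_mem_polyBall_iff hBm (by omega), Polynomial.mul_divByMonic_cancel_left _ hBm] at h3
    convert h3 using 2
    omega
  · rw [← mul_mem_polyBall_iff hAm (by omega), ← hAB]; exact hF₁
  · rw [← mul_mem_polyBall_iff hAm (by omega), ← hC]; exact hG₁

/-- A weighted bound for the number of nontrivial solutions of `F₁ F₂ = G₁ G₂` in an interval. -/
theorem card_nontrivialProducts_le {K : k[X]} {N h : ℕ} (hK : K.Monic) (hKN : K.natDegree = N)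
    (hh : h + 1 ≤ N) {S : Finset k[X]} (hS : S ⊆ polyBall K (h + 1)) {w : k[X] → ℝ}
    (hw : ∀ F, 0 ≤ w F) {κ : ℝ}
    (hκ : ∀ A B : k[X], A * B ∈ S → 1 ≤ κ * (w A * w B)) {s : ℕ → ℝ} (hs0 : ∀ x, 0 ≤ s x)
    (hanti : ∀ x y, 1 ≤ x → x ≤ y → s y ≤ s x)
    (hs : ∀ (C : k[X]) (x : ℕ), 1 ≤ x → x ≤ h + 1 →
      ∑ F ∈ polyBall C x, w F ≤ (Nat.card k : ℝ) ^ x * s x) :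
    ((nontrivialProducts S).card : ℝ) ≤ κ ^ 2 * ((Nat.card k : ℝ) ^ (3 * (h + 1)) /
      (Nat.card k : ℝ) ^ N * ∑ a ∈ Finset.Icc (N - h) h, s (a + h + 1 - N) ^ 2
        * s (h + 1 - a) ^ 2) := by
  set Q : Finset (Σ _ : ℕ, Σ _ : k[X], k[X] × (k[X] × k[X])) :=
    (Finset.Icc (N - h) h).sigma fun a => (polyBall (Polynomial.X ^ a : k[X]) a).sigma fun A =>
      polyBall A (a + h + 1 - N) ×ˢ (polyBall (K /ₘ A) (h + 1 - a) ×ˢ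
        polyBall (K /ₘ A) (h + 1 - a)) with hQ
  set g : (Σ _ : ℕ, Σ _ : k[X], k[X] × (k[X] × k[X])) → ((k[X] × k[X]) × (k[X] × k[X])) :=
    fun x => ((x.2.1 * x.2.2.2.1, x.2.2.2.2 * x.2.2.1), (x.2.1 * x.2.2.2.2, x.2.2.2.1 * x.2.2.1))
    with hg
  set Q' := Q.filter (fun x => x.2.1 * x.2.2.2.1 ∈ S ∧ x.2.2.2.2 * x.2.2.1 ∈ S) with hQ'
  have hsub : nontrivialProducts S ⊆ Q'.image g := by
    rintro ⟨⟨F₁, F₂⟩, G₁, G₂⟩ hx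
    simp only [nontrivialProducts, Finset.mem_filter, Finset.mem_product] at hx
    obtain ⟨⟨⟨hF₁, hF₂⟩, hG₁, hG₂⟩, he, h1, h2⟩ := hx
    obtain ⟨a, ha, A, hA, D, hD, B, hB, C, hC, rfl, rfl, rfl, rfl⟩ :=
      exists_quadruple hK hKN hh (hS hF₁) (hS hG₁) (hS hG₂) he h1 h2
    refine Finset.mem_image.2 ⟨⟨a, A, D, B, C⟩, ?_, rfl⟩
    rw [hQ', Finset.mem_filter, hQ, Finset.mem_sigma, Finset.mem_sigma, Finset.mem_product,
      Finset.mem_product]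
    exact ⟨⟨ha, hA, hD, hB, hC⟩, hF₁, hF₂⟩
  have hq0 := natCard_real_pos k
  set q : ℝ := (Nat.card k : ℝ) with hqdef
  have hterm : ∀ a ∈ Finset.Icc (N - h) h, ∑ A ∈ polyBall (Polynomial.X ^ a : k[X]) a,
      ∑ y ∈ polyBall A (a + h + 1 - N) ×ˢ (polyBall (K /ₘ A) (h + 1 - a) ×ˢ
        polyBall (K /ₘ A) (h + 1 - a)), κ ^ 2 * (w A * (w y.1 * (w y.2.1 * w y.2.2)))
      ≤ κ ^ 2 * (q ^ (3 * (h + 1)) / q ^ N * (s (a + h + 1 - N) ^ 2 * s (h + 1 - a) ^ 2)) := by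
    intro a ha
    obtain ⟨ha1, ha2⟩ := Finset.mem_Icc.1 ha
    have h1 : ∀ A : k[X], ∑ y ∈ polyBall A (a + h + 1 - N) ×ˢ (polyBall (K /ₘ A) (h + 1 - a) ×ˢ
        polyBall (K /ₘ A) (h + 1 - a)), κ ^ 2 * (w A * (w y.1 * (w y.2.1 * w y.2.2)))
        = κ ^ 2 * (w A * ((∑ F ∈ polyBall A (a + h + 1 - N), w F) *
          ((∑ F ∈ polyBall (K /ₘ A) (h + 1 - a), w F) *
            (∑ F ∈ polyBall (K /ₘ A) (h + 1 - a), w F)))) := by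
      intro A
      rw [← Finset.mul_sum, ← Finset.mul_sum, Finset.sum_mul_sum, ← Finset.sum_product',
        Finset.sum_mul_sum, ← Finset.sum_product']
    have hsn : ∀ (C : k[X]) (x : ℕ), 0 ≤ ∑ F ∈ polyBall C x, w F := fun C x =>
      Finset.sum_nonneg fun F _ => hw F
    have hb1 := fun C : k[X] => hs C (a + h + 1 - N) (by omega) (by omega)
    have hb2 := fun C : k[X] => hs C (h + 1 - a) (by omega) (by omega)
    have hb3 := hs (Polynomial.X ^ a) a (by omega) (by omega)
    -- The ball of A is at least as large as that of D, so its average may be replaced by the larger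
    -- s₁. The bound then depends on two radii only.
    have hsa := hanti (a + h + 1 - N) a (by omega) (by omega)
    set s₁ := s (a + h + 1 - N)
    set s₂ := s (h + 1 - a)
    have hs₁ : 0 ≤ s₁ := hs0 _
    have hs₂ : 0 ≤ s₂ := hs0 _
    simp_rw [h1]
    rw [← Finset.mul_sum]
    refine mul_le_mul_of_nonneg_left ?_ (by positivity)
    calc _ ≤ ∑ A ∈ polyBall (Polynomial.X ^ a : k[X]) a, w A *
          ((q ^ (a + h + 1 - N) * s₁) * ((q ^ (h + 1 - a) * s₂) * (q ^ (h + 1 - a) * s₂))) := by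
          refine Finset.sum_le_sum fun A _ => mul_le_mul_of_nonneg_left ?_ (hw A)
          refine mul_le_mul (hb1 A) ?_ (mul_nonneg (hsn _ _) (hsn _ _)) (by positivity)
          exact mul_le_mul (hb2 _) (hb2 _) (hsn _ _) (by positivity)
      _ ≤ (q ^ a * s₁) *
          ((q ^ (a + h + 1 - N) * s₁) * ((q ^ (h + 1 - a) * s₂) * (q ^ (h + 1 - a) * s₂))) := by
          rw [← Finset.sum_mul]
          refine mul_le_mul_of_nonneg_right (hb3.trans ?_) (by positivity)
          gcongr
      _ = _ := by
          -- The four radii sum to 3(h + 1) - N whatever a is, so every degree a has the same main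
          -- factor.
          have hp : q ^ (3 * (h + 1)) = q ^ a * q ^ (a + h + 1 - N) * q ^ (h + 1 - a)
              * q ^ (h + 1 - a) * q ^ N := by
            rw [← pow_add, ← pow_add, ← pow_add, ← pow_add]; congr 1; omega
          rw [hp]
          field_simp
  calc ((nontrivialProducts S).card : ℝ) ≤ Q'.card := by
        exact_mod_cast (Finset.card_le_card hsub).trans Finset.card_image_le
    _ = ∑ x ∈ Q', (1 : ℝ) := by simp
    _ ≤ ∑ x ∈ Q', κ ^ 2 * (w x.2.1 * (w x.2.2.1 * (w x.2.2.2.1 * w x.2.2.2.2))) := by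
        refine Finset.sum_le_sum fun x hx => ?_
        obtain ⟨-, hx1, hx2⟩ := Finset.mem_filter.1 hx
        have e := one_le_mul_of_one_le_of_one_le (hκ _ _ hx1) (hκ _ _ hx2)
        linarith
    _ ≤ ∑ x ∈ Q, κ ^ 2 * (w x.2.1 * (w x.2.2.1 * (w x.2.2.2.1 * w x.2.2.2.2))) :=
        Finset.sum_le_sum_of_subset_of_nonneg (Finset.filter_subset _ _) fun x _ _ =>
          mul_nonneg (sq_nonneg _) (mul_nonneg (hw _) (mul_nonneg (hw _)
            (mul_nonneg (hw _) (hw _))))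
    _ = ∑ a ∈ Finset.Icc (N - h) h, ∑ A ∈ polyBall (Polynomial.X ^ a : k[X]) a,
        ∑ y ∈ polyBall A (a + h + 1 - N) ×ˢ (polyBall (K /ₘ A) (h + 1 - a) ×ˢ
        polyBall (K /ₘ A) (h + 1 - a)), κ ^ 2 * (w A * (w y.1 * (w y.2.1 * w y.2.2))) := by
        rw [hQ, Finset.sum_sigma]
        exact Finset.sum_congr rfl fun a _ => Finset.sum_sigma _ _ _
    _ ≤ _ := by
        refine (Finset.sum_le_sum hterm).trans_eq ?_
        rw [← Finset.mul_sum, ← Finset.mul_sum]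

theorem card_nontrivialProducts_le_linear {K : k[X]} {N h : ℕ} (hK : K.Monic)
    (hKN : K.natDegree = N) (hh : h + 1 ≤ N) {S : Finset k[X]} (hS : S ⊆ polyBall K (h + 1)) :
    ((nontrivialProducts S).card : ℝ) ≤ (Nat.card k : ℝ) ^ (3 * (h + 1)) /
      (Nat.card k : ℝ) ^ N * N := by
  have h1 := card_nontrivialProducts_le hK hKN hh hS (w := fun _ => 1) (fun _ => zero_le_one)
    (κ := 1) (fun _ _ _ => by norm_num) (s := fun _ => 1) (fun _ => zero_le_one)
    (fun _ _ _ _ => le_rfl) (fun C x _ _ => by simp [card_polyBall])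
  refine h1.trans ?_
  simp only [one_pow, one_mul, Finset.sum_const, nsmul_eq_mul, mul_one, Nat.card_Icc]
  gcongr
  omega

/-- Weights 2^(-ω) on the four factors cost 2^m for each of the products AB and CD, hence 4^m, and
save a factor of order J / x on each pair of averages over balls of radius x. -/
theorem card_nontrivialProducts_le_sieve {K : k[X]} {N h m J : ℕ} (hK : K.Monic)
    (hKN : K.natDegree = N) (hh : h + 1 ≤ N) (hNh : N ≤ 2 * h) {S : Finset k[X]}
    (hS : S ⊆ polyBall K (h + 1))
    (hm : ∀ F ∈ S, cappedOmega ((h + 1) / 2) F ≤ m) (hJ : Even J)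
    (hJN : 4 * Real.log N + 8 ≤ J) :
    ((nontrivialProducts S).card : ℝ) ≤ 4 ^ m * ((Nat.card k : ℝ) ^ (3 * (h + 1)) /
      (Nat.card k : ℝ) ^ N * ((Real.exp 4 + 1) ^ 4 * J ^ 2 *
        (2 * (1 + Real.log N) / (2 * h + 2 - N : ℕ)))) := by
  have hJ2 : 2 ≤ J := by
    have : (2 : ℝ) ≤ J := by
      have := Real.log_natCast_nonneg N
      linarith
    exact_mod_cast this
  have h1 := card_nontrivialProducts_le hK hKN hh hS
    (w := fun F => (1 / 2 : ℝ) ^ omegaOn (primesIoc k 0 ((h + 1) / 2)) F) (fun _ => by positivity)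
    (κ := 2 ^ m) (fun A B hAB => by
      have h2 := (omegaOn_add_le_cappedOmega ((h + 1) / 2) A B).trans (hm _ hAB)
      rw [← pow_add]
      calc (1 : ℝ) = 2 ^ m * (1 / 2) ^ m := by rw [← mul_pow]; norm_num
        _ ≤ _ := by
          gcongr 2 ^ m * ?_
          exact pow_le_pow_of_le_one (by norm_num) (by norm_num) h2)
    (s := fun x => (Real.exp 4 + 1) * Real.sqrt (J / x)) (fun _ => by positivity)
    (fun x y hx hxy => by
      have : (0 : ℝ) < x := by exact_mod_cast hx
      gcongr)
    (fun C x hx hxh => sum_half_pow_omegaOn_le_sqrt hJ hJN hx (hxh.trans hh)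
      ((Nat.div_le_div hxh hJ2 (by norm_num))) C)
  refine h1.trans ?_
  rw [← pow_mul, mul_comm m 2, pow_mul]
  norm_num only
  refine mul_le_mul_of_nonneg_left ?_ (by positivity)
  refine mul_le_mul_of_nonneg_left ?_ (by positivity)
  set M := 2 * h + 2 - N with hM
  have hM0 : (0 : ℝ) < M := by exact_mod_cast (by omega : 0 < M)
  -- The two radii x = a + h + 1 - N and x' = h + 1 - a have constant sum M, so 1/(x x') = (1/x +
  -- 1/x')/M. Summation over a gives two harmonic sums.
  have hterm : ∀ a ∈ Finset.Icc (N - h) h,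
      ((Real.exp 4 + 1) * Real.sqrt (J / (a + h + 1 - N : ℕ))) ^ 2
        * ((Real.exp 4 + 1) * Real.sqrt (J / (h + 1 - a : ℕ))) ^ 2
      = (Real.exp 4 + 1) ^ 4 * J ^ 2 / M *
        (((a + h + 1 - N : ℕ) : ℝ)⁻¹ + ((h + 1 - a : ℕ) : ℝ)⁻¹) := by
    intro a ha
    obtain ⟨ha1, ha2⟩ := Finset.mem_Icc.1 ha
    have hx : (0 : ℝ) < (a + h + 1 - N : ℕ) := by exact_mod_cast (by omega)
    have hx' : (0 : ℝ) < (h + 1 - a : ℕ) := by exact_mod_cast (by omega)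
    have hsum : (M : ℝ) = (a + h + 1 - N : ℕ) + (h + 1 - a : ℕ) := by
      exact_mod_cast (by omega : M = (a + h + 1 - N) + (h + 1 - a))
    rw [mul_pow, mul_pow, Real.sq_sqrt (by positivity), Real.sq_sqrt (by positivity)]
    rw [hsum] at hM0 ⊢
    field_simp
    ring
  rw [Finset.sum_congr rfl hterm, ← Finset.mul_sum, Finset.sum_add_distrib]
  have hH : ∑ n ∈ Finset.Icc 1 N, ((n : ℝ))⁻¹ ≤ 1 + Real.log N := by
    have := harmonic_le_one_add_log N
    rw [harmonic_eq_sum_Icc] at this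
    push_cast at this
    exact this
  have hs1 : ∑ a ∈ Finset.Icc (N - h) h, ((a + h + 1 - N : ℕ) : ℝ)⁻¹ ≤ 1 + Real.log N := by
    refine le_trans ?_ hH
    rw [← Finset.sum_image (s := Finset.Icc (N - h) h) (g := fun a => a + h + 1 - N)
      (f := fun n : ℕ => (n : ℝ)⁻¹)]
    · refine Finset.sum_le_sum_of_subset_of_nonneg ?_ fun _ _ _ => by positivity
      intro n hn
      obtain ⟨a, ha, rfl⟩ := Finset.mem_image.1 hn
      rw [Finset.mem_Icc] at ha ⊢
      omega
    · intro a ha b hb hab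
      simp only [Finset.coe_Icc, Set.mem_Icc] at ha hb hab
      omega
  have hs2 : ∑ a ∈ Finset.Icc (N - h) h, ((h + 1 - a : ℕ) : ℝ)⁻¹ ≤ 1 + Real.log N := by
    refine le_trans ?_ hH
    rw [← Finset.sum_image (s := Finset.Icc (N - h) h) (g := fun a => h + 1 - a)
      (f := fun n : ℕ => (n : ℝ)⁻¹)]
    · refine Finset.sum_le_sum_of_subset_of_nonneg ?_ fun _ _ _ => by positivity
      intro n hn
      obtain ⟨a, ha, rfl⟩ := Finset.mem_image.1 hn
      rw [Finset.mem_Icc] at ha ⊢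
      omega
    · intro a ha b hb hab
      simp only [Finset.coe_Icc, Set.mem_Icc] at ha hb hab
      omega
  calc _ ≤ (Real.exp 4 + 1) ^ 4 * J ^ 2 / M * ((1 + Real.log N) + (1 + Real.log N)) := by
        gcongr
    _ = _ := by ring

end Energy
end

noncomputable section

open Classical UniqueFactorizationMonoid
open scoped Topology

/-! ### Regular elements and the criterion for the limit law. -/

section Regular

variable {k : Type*} [Field k] [Finite k]

/-- The elements of an interval which have a prime factor of degree exceeding `D`, and no
repeated prime factor whose degree lies in `(D, h]`. -/
def regularSet (K : k[X]) (h D : ℕ) : Finset k[X] :=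
  (polyBall K (h + 1)).filter (fun F => (∃ P : MonicPrime k, D < P.1.natDegree ∧ P.1 ∣ F) ∧
    ∀ P : MonicPrime k, D < P.1.natDegree → P.1.natDegree ≤ h → ¬ P.1 ^ 2 ∣ F)

theorem card_polyBall_le_card_regularSet (K : k[X]) (h D : ℕ) :
    ((polyBall K (h + 1)).card : ℝ) ≤ (regularSet K h D).card
      + ((polyBall K (h + 1)).filter (fun F => ∀ P : MonicPrime k, D < P.1.natDegree →
          ¬ P.1 ∣ F)).card
      + ((polyBall K (h + 1)).filter (fun F => ∃ P : MonicPrime k, D < P.1.natDegree ∧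
          P.1.natDegree ≤ h ∧ P.1 ^ 2 ∣ F)).card := by
  norm_cast
  refine (Finset.card_le_card ?_).trans ((Finset.card_union_le _ _).trans
    (Nat.add_le_add_right (Finset.card_union_le _ _) _))
  intro F hF
  simp only [regularSet, Finset.mem_union, Finset.mem_filter, hF, true_and]
  by_cases h1 : ∀ P : MonicPrime k, D < P.1.natDegree → ¬ P.1 ∣ F
  · exact Or.inl (Or.inr h1)
  by_cases h2 : ∃ P : MonicPrime k, D < P.1.natDegree ∧ P.1.natDegree ≤ h ∧ P.1 ^ 2 ∣ F
  · exact Or.inr h2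
  push Not at h1
  exact Or.inl (Or.inl ⟨h1, fun P hP hP' hP'' => h2 ⟨P, hP, hP', hP''⟩⟩)

theorem card_real_polyBall (K : k[X]) (x : ℕ) :
    ((polyBall K x).card : ℝ) = (Nat.card k : ℝ) ^ x := by
  rw [card_polyBall]; push_cast; rfl

theorem card_polyBall_le_card_regularSet_of_lt (K : k[X]) {h D : ℕ} {L : ℝ} (hL0 : 0 < L)
    (hL : L ≤ ∑ P ∈ primesIoc k D ((h + 1) / 2), invNorm P) :
    ((polyBall K (h + 1)).card : ℝ) ≤ (regularSet K h D).card
      + (L⁻¹ + 2 * ((Nat.card k : ℝ) ^ (D + 1))⁻¹ + 4 / (Nat.card k * (h + 2)))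
        * (polyBall K (h + 1)).card := by
  have h1 := card_polyBall_le_card_regularSet K h D
  have h2 := card_filter_smooth_le K hL0 hL
  have h3 := card_filter_sq_dvd_le K D h
  rw [card_real_polyBall] at h1 ⊢
  linarith

theorem card_polyBall_le_card_regularSet_zero {K : k[X]} (hK : K.Monic) {h : ℕ}
    (hh : h + 1 ≤ K.natDegree) :
    ((polyBall K (h + 1)).card : ℝ) ≤ (regularSet K h 0).card
      + (2 * (Nat.card k : ℝ)⁻¹ + 4 / (Nat.card k * (h + 2))) * (polyBall K (h + 1)).card := by
  have h1 := card_polyBall_le_card_regularSet K h 0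
  have h3 := card_filter_sq_dvd_le K 0 h
  have h2 : (polyBall K (h + 1)).filter (fun F => ∀ P : MonicPrime k, 0 < P.1.natDegree →
      ¬ P.1 ∣ F) = ∅ := by
    refine Finset.filter_eq_empty_iff.2 fun F hF hcon => ?_
    obtain ⟨-, h4⟩ := monic_natDegree_of_mem_polyBall hK hh hF
    obtain ⟨P, hP⟩ := exists_monicPrime_dvd (F := F) (by omega)
    exact hcon P (monicPrime_natDegree_pos P) hP
  rw [h2, Finset.card_empty] at h1
  rw [card_real_polyBall] at h1 ⊢
  rw [zero_add, pow_one] at h3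
  push_cast at h1
  linarith

universe u in
/-- Almost all elements of an interval are regular as `q ^ h → ∞`. -/
theorem exists_regularSet {ε : ℝ} (hε : 0 < ε) :
    ∃ M : ℕ, ∀ (k : Type u) [Field k] [Finite k] (K : k[X]) (h : ℕ), K.Monic →
      h + 1 ≤ K.natDegree → M ≤ Nat.card k ^ h →
      ∃ D : ℕ, ((Nat.card k : ℝ) ^ (D + 1))⁻¹ ≤ ε ∧
        ((polyBall K (h + 1)).card : ℝ) ≤ (regularSet K h D).card
          + ε * (polyBall K (h + 1)).card := by
  -- D controls primes just above the cut, H₁ makes the prime sum beyond D at least 3/ε, H₂ controls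
  -- squares of large primes, and Q is the threshold for large q. The term 2 * D in H ensures D ≤ (h
  -- + 1) / 2.
  obtain ⟨D, hD⟩ : ∃ D : ℕ, (1 / 2 : ℝ) ^ D < ε / 3 :=
    exists_pow_lt_of_lt_one (by positivity) (by norm_num)
  obtain ⟨H₁, hH₁⟩ := exists_nat_ge (Real.exp (3 / ε + 9 + Real.log D))
  obtain ⟨H₂, hH₂⟩ := exists_nat_ge (6 / ε)
  obtain ⟨Q, hQ⟩ := exists_nat_ge (4 / ε)
  set H := 2 * D + 2 * H₁ + H₂ + 1 with hH
  refine ⟨(Q + 1) ^ H, fun k _ _ K h hK hh hM => ?_⟩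
  have hq := two_le_natCard_real k
  have hq0 := natCard_real_pos k
  rcases le_or_gt H h with hhH | hhH
  · refine ⟨D, ?_, ?_⟩
    · calc ((Nat.card k : ℝ) ^ (D + 1))⁻¹ ≤ ((2 : ℝ) ^ D)⁻¹ := by
            refine inv_anti₀ (by positivity) ?_
            calc (2 : ℝ) ^ D ≤ (Nat.card k : ℝ) ^ D := by gcongr
              _ ≤ _ := pow_le_pow_right₀ (by linarith) (by omega)
        _ = (1 / 2 : ℝ) ^ D := by rw [one_div, inv_pow]
        _ ≤ ε := by linarith
    · have hL : 3 / ε ≤ ∑ P ∈ primesIoc k D ((h + 1) / 2), invNorm P := by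
        refine le_trans ?_ (log_sub_log_le_sum_invNorm (k := k) (by omega))
        have : 3 / ε + 9 + Real.log D ≤ Real.log (((h + 1) / 2 : ℕ) + 1) := by
          rw [Real.le_log_iff_exp_le (by positivity)]
          have : (H₁ : ℝ) ≤ ((h + 1) / 2 : ℕ) + 1 := by exact_mod_cast (by omega)
          linarith
        linarith
      refine (card_polyBall_le_card_regularSet_of_lt K (by positivity) hL).trans ?_
      gcongr
      have e1 : (3 / ε)⁻¹ = ε / 3 := by rw [inv_div]
      have e2 : 2 * ((Nat.card k : ℝ) ^ (D + 1))⁻¹ ≤ ε / 3 := by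
        calc 2 * ((Nat.card k : ℝ) ^ (D + 1))⁻¹ ≤ 2 * ((2 : ℝ) ^ (D + 1))⁻¹ := by gcongr
          _ = (1 / 2 : ℝ) ^ D := by rw [pow_succ, one_div, inv_pow]; field_simp
          _ ≤ _ := hD.le
      have e3 : 4 / (Nat.card k * ((h : ℝ) + 2)) ≤ ε / 3 := by
        have : 6 / ε ≤ h + 2 := by
          have : (H₂ : ℝ) ≤ h := by exact_mod_cast (by omega)
          linarith
        rw [div_le_iff₀ hε] at this
        rw [div_le_iff₀ (by positivity)]
        nlinarith
      linarith
  -- Here h < H, so q^h ≥ (Q + 1)^H forces q > Q. With D = 0 every element has an admissible prime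
  -- and only repeated factors are lost, a proportion O(1/q).
  · have hcard : Q + 1 ≤ Nat.card k := by
      by_contra hlt
      have hlt' : Nat.card k < Q + 1 := by omega
      have h1 : Nat.card k ^ h ≤ Nat.card k ^ (H - 1) :=
        Nat.pow_le_pow_right (Nat.card_pos) (by omega)
      have h2 : Nat.card k ^ (H - 1) ≤ (Q + 1) ^ (H - 1) := Nat.pow_le_pow_left hlt'.le _
      have h3 : 1 < Q + 1 := lt_of_lt_of_le one_lt_natCard hlt'.le
      have h4 : (Q + 1) ^ (H - 1) < (Q + 1) ^ H := Nat.pow_lt_pow_right h3 (by omega)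
      omega
    have hcard' : 4 / ε ≤ Nat.card k := by
      have : (Q : ℝ) + 1 ≤ Nat.card k := by exact_mod_cast hcard
      linarith
    have h4 : 4 * (Nat.card k : ℝ)⁻¹ ≤ ε := by
      rw [div_le_iff₀ hε] at hcard'
      rw [← div_eq_mul_inv, div_le_iff₀ hq0]
      linarith
    refine ⟨0, ?_, ?_⟩
    · rw [zero_add, pow_one]
      have : 0 ≤ (Nat.card k : ℝ)⁻¹ := by positivity
      linarith
    · refine (card_polyBall_le_card_regularSet_zero hK hh).trans ?_
      gcongr
      have : 4 / (Nat.card k * ((h : ℝ) + 2)) ≤ 2 * (Nat.card k : ℝ)⁻¹ := by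
        rw [div_le_iff₀ (by positivity)]
        have : 2 * (Nat.card k : ℝ)⁻¹ * (Nat.card k * ((h : ℝ) + 2)) = 2 * (h + 2) := by
          field_simp
        rw [this]
        have : (0 : ℝ) ≤ h := by positivity
        linarith
      linarith

/-- The interval around `K` has a large subset of regular elements with few nontrivial
multiplicative coincidences. -/
def IsApproximable (K : k[X]) (h : ℕ) (η : ℝ) : Prop :=
  ∃ (D : ℕ) (S : Finset k[X]), S ⊆ regularSet K h D ∧ ((Nat.card k : ℝ) ^ (D + 1))⁻¹ ≤ η ∧
    1 ≤ η * (Nat.card k : ℝ) ^ (h + 1) ∧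
    ((polyBall K (h + 1)).card : ℝ) ≤ S.card + η * (polyBall K (h + 1)).card ∧
    ((nontrivialProducts S).card : ℝ) ≤ η * (Nat.card k : ℝ) ^ (2 * (h + 1))

theorem IsApproximable.norm_charFun_sub_le {Ω : Type*} [MeasurableSpace Ω] {μ : Measure Ω}
    [IsProbabilityMeasure μ] {f : k[X] → Ω → ℂ} (hf : IsSteinhaus f μ) {K : k[X]} {h : ℕ} {η : ℝ}
    (hap : IsApproximable K h η) (hK : K.Monic) (hh : h + 1 ≤ K.natDegree) (t : ℂ) :
    ‖charFun (μ.map (normalizedSum f (polyBall K (h + 1)))) t - charFun stdComplexNormal t‖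
      ≤ ‖t‖ * Real.sqrt η + ‖t‖ ^ 2 * Real.sqrt (5 * η) + ‖t‖ ^ 2 * η / 4 := by
  obtain ⟨D, S, hS, hD, h1, hcard, hNT⟩ := hap
  set A := polyBall K (h + 1)
  have hA : (A.card : ℝ) = (Nat.card k : ℝ) ^ (h + 1) := card_real_polyBall K (h + 1)
  have hSA : S ⊆ A := hS.trans (Finset.filter_subset _ _)
  have hSex : ∀ F ∈ S, ∃ P : MonicPrime k, D < P.1.natDegree ∧ P.1 ∣ F := fun F hF =>
    (Finset.mem_filter.1 (hS hF)).2.1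
  have hmon : ∀ F ∈ A, F.Monic ∧ F.natDegree ≤ K.natDegree := fun F hF => by
    have := monic_natDegree_of_mem_polyBall hK hh hF
    exact ⟨this.1, this.2.le⟩
  set p : k[X] → MonicPrime k := fun F =>
    if hF : ∃ P : MonicPrime k, D < P.1.natDegree ∧ P.1 ∣ F then hF.choose
    else ⟨Polynomial.X, Polynomial.monic_X, Polynomial.irreducible_X⟩ with hp
  have hpspec : ∀ F ∈ S, D < (p F).1.natDegree ∧ (p F).1 ∣ F := by
    intro F hF
    simp only [hp, dif_pos (hSex F hF)]
    exact (hSex F hF).choose_spec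
  have hval : ∀ F ∈ S, ∀ P : MonicPrime k, D < P.1.natDegree → P.1.natDegree ≤ h → P.1 ∣ F →
      primeVal P F = 1 := by
    intro F hF P hP1 hP2 hP3
    have hF0 := (hmon F (hSA hF)).1.ne_zero
    have e1 := (primeVal_ne_zero_iff P hF0).2 hP3
    have e2 := primeVal_le_one P hF0 ((Finset.mem_filter.1 (hS hF)).2.2 P hP1 hP2)
    omega
  refine hf.norm_charFun_sub_le (N := K.natDegree) (by omega) hSA hmon p
    (fun F hF => (hpspec F hF).2) ?_ t (by rw [hA]; exact h1) hcard ?_ ?_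
  · intro F hF G hG hdvd
    obtain ⟨hp1, hp2⟩ := hpspec F hF
    -- If F ≠ G then p F divides their difference and has degree at most h, so regularity makes both
    -- exponents 1. A repeated prime of degree above h is harmless: it links F only to itself.
    by_cases hFG : F = G
    · rw [hFG]
    · have hlt := natDegree_lt_of_dvd_of_mem_polyBall (hSA hF) (hSA hG) hFG hp2 hdvd
      rw [hval F hF _ hp1 (by omega) hp2, hval G hG _ hp1 (by omega) hdvd]
  · refine (card_dividingPairs_le hSA p (fun F hF => (hpspec F hF).2)
      (fun F hF => (hpspec F hF).1)).trans ?_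
    gcongr
  · rw [hA, ← pow_mul, mul_comm (h + 1) 2]
    exact hNT

end Regular

/-! ### Convergence in distribution, and the linear range. -/

section Limits

/-- Lévy's continuity theorem applies to sequences, and sequences detect convergence along a
countably generated filter. -/
theorem tendsto_of_tendsto_charFun {ι : Type*} {l : Filter ι} [l.IsCountablyGenerated]
    {P : ι → ProbabilityMeasure ℂ} {P₀ : ProbabilityMeasure ℂ}
    (h : ∀ t, Tendsto (fun i => charFun (P i : Measure ℂ) t) l (𝓝 (charFun (P₀ : Measure ℂ) t))) :
    Tendsto P l (𝓝 P₀) := by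
  refine tendsto_of_seq_tendsto fun x hx => ?_
  exact ProbabilityMeasure.tendsto_iff_tendsto_charFun.2 fun t => (h t).comp hx

variable {ι : Type*} {l : Filter ι} {k : ι → Type*} [∀ i, Field (k i)] [∀ i, Finite (k i)]
  {N h : ι → ℕ} {K : ∀ i, (k i)[X]}

theorem tendstoInDistribution_of_isApproximable [l.IsCountablyGenerated]
    (hK : ∀ i, (K i).Monic ∧ (K i).natDegree = N i) (hh : ∀ i, 1 ≤ h i ∧ h i + 2 ≤ N i)
    {Ω : ι → Type*} [∀ i, MeasurableSpace (Ω i)]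
    {μ : ∀ i, Measure (Ω i)} [∀ i, IsProbabilityMeasure (μ i)]
    {f : ∀ i, (k i)[X] → Ω i → ℂ} (hf : ∀ i, IsSteinhaus (f i) (μ i))
    (hap : ∀ η : ℝ, 0 < η → ∀ᶠ i in l, IsApproximable (K i) (h i) η) :
    TendstoInDistribution (fun i => normalizedSum (f i) (polyInterval (N i) (K i) (h i))) l
      (fun z : ℂ => z) μ stdComplexNormal := by
  have hball : ∀ i, polyInterval (N i) (K i) (h i) = polyBall (K i) (h i + 1) := fun i =>
    polyInterval_eq_polyBall (hK i).1 (hK i).2 (by have := hh i; omega)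
  have hmeas : ∀ i, AEMeasurable (normalizedSum (f i) (polyInterval (N i) (K i) (h i))) (μ i) := by
    intro i
    rw [hball]
    exact ((hf i).measurable_normalizedSum fun F hF => (monic_natDegree_of_mem_polyBall (hK i).1
      (by have := hh i; have := (hK i).2; omega) hF).1).aemeasurable
  refine ⟨hmeas, by fun_prop, tendsto_of_tendsto_charFun fun t => ?_⟩
  simp only [ProbabilityMeasure.coe_mk, Measure.map_id']
  rw [tendsto_iff_norm_sub_tendsto_zero]
  have hcont : Tendsto (fun η : ℝ => ‖t‖ * Real.sqrt η + ‖t‖ ^ 2 * Real.sqrt (5 * η)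
      + ‖t‖ ^ 2 * η / 4) (𝓝[>] 0) (𝓝 0) := by
    have : Continuous (fun η : ℝ => ‖t‖ * Real.sqrt η + ‖t‖ ^ 2 * Real.sqrt (5 * η)
      + ‖t‖ ^ 2 * η / 4) := by fun_prop
    have h0 := (this.tendsto 0).mono_left (nhdsWithin_le_nhds (s := Set.Ioi 0))
    simpa using h0
  rw [Metric.tendsto_nhds]
  intro ε hε
  have hev : ∀ᶠ η : ℝ in 𝓝[>] 0, (‖t‖ * Real.sqrt η + ‖t‖ ^ 2 * Real.sqrt (5 * η)
      + ‖t‖ ^ 2 * η / 4 < ε) ∧ 0 < η :=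
    (hcont.eventually_lt_const hε).and self_mem_nhdsWithin
  obtain ⟨η, hη, hη0⟩ := hev.exists
  filter_upwards [hap η hη0] with i hi
  rw [dist_zero_right, norm_norm, hball]
  exact (hi.norm_charFun_sub_le (hf i) (hK i).1 (by have := hh i; have := (hK i).2; omega) t).trans_lt
    hη

theorem eventually_one_le_mul_pow (hq : Tendsto (fun i => Nat.card (k i) ^ h i) l atTop)
    {η : ℝ} (hη : 0 < η) : ∀ᶠ i in l, 1 ≤ η * (Nat.card (k i) : ℝ) ^ (h i + 1) := by
  obtain ⟨M, hM⟩ := exists_nat_ge (1 / η)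
  filter_upwards [hq.eventually_ge_atTop M] with i hi
  have h1 : (M : ℝ) ≤ (Nat.card (k i) : ℝ) ^ h i := by exact_mod_cast hi
  have h2 : (Nat.card (k i) : ℝ) ^ h i ≤ (Nat.card (k i) : ℝ) ^ (h i + 1) :=
    pow_le_pow_right₀ (by linarith [two_le_natCard_real (k i)]) (by omega)
  rw [← div_le_iff₀' hη]
  linarith

theorem eventually_isApproximable_linear
    (hK : ∀ i, (K i).Monic ∧ (K i).natDegree = N i) (hh : ∀ i, 1 ≤ h i ∧ h i + 2 ≤ N i)
    (hq : Tendsto (fun i => Nat.card (k i) ^ h i) l atTop)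
    (ho : (fun i => (Nat.card (k i) : ℝ) ^ (h i + 1)) =o[l]
        (fun i => (Nat.card (k i) : ℝ) ^ N i / (N i : ℝ))) {η : ℝ} (hη : 0 < η) :
    ∀ᶠ i in l, IsApproximable (K i) (h i) η := by
  obtain ⟨M, hM⟩ := exists_regularSet hη
  filter_upwards [hq.eventually_ge_atTop M, eventually_one_le_mul_pow hq hη,
    (isLittleO_iff.1 ho) hη] with i h1 h2 h3
  have hhi := hh i
  have hKi := hK i
  obtain ⟨D, hD, hcard⟩ := hM (k i) (K i) (h i) hKi.1 (by omega) h1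
  refine ⟨D, regularSet (K i) (h i) D, subset_rfl, hD, h2, hcard, ?_⟩
  refine (card_nontrivialProducts_le_linear hKi.1 hKi.2 (by omega)
    (Finset.filter_subset _ _)).trans ?_
  have hq0 := natCard_real_pos (k i)
  have hN0 : (0 : ℝ) < N i := by exact_mod_cast (by omega)
  set q : ℝ := (Nat.card (k i) : ℝ)
  rw [Real.norm_of_nonneg (by positivity), Real.norm_of_nonneg (by positivity)] at h3
  have h4 : q ^ (h i + 1) * N i / q ^ N i ≤ η := by
    rw [div_le_iff₀ (by positivity)]
    calc q ^ (h i + 1) * N i ≤ η * (q ^ N i / N i) * N i := by gcongr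
      _ = _ := by field_simp
  calc q ^ (3 * (h i + 1)) / q ^ N i * N i
      = (q ^ (h i + 1) * N i / q ^ N i) * q ^ (2 * (h i + 1)) := by ring
    _ ≤ _ := by gcongr

end Limits
end

noncomputable section

open Classical UniqueFactorizationMonoid
open scoped Topology

/-! ### The logarithmic range. -/

section LogRange

theorem tendsto_log_natCast : Tendsto (fun n : ℕ => Real.log n) atTop atTop :=
  Real.tendsto_log_atTop.comp tendsto_natCast_atTop_atTop

/-- The deviation Δ = (ε log n - 1)/2 is the one for which 1 + log n + 2Δ = (1 + ε) log n. -/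
theorem eventually_chebyshev_le {ε η : ℝ} (hε : 0 < ε) (hη : 0 < η) :
    ∀ᶠ n : ℕ in atTop, 0 < (ε * Real.log n - 1) / 2 ∧
      (1 + Real.log n) / ((ε * Real.log n - 1) / 2) ^ 2 + 1 / ((ε * Real.log n - 1) / 2) ≤ η := by
  have hΔ : Tendsto (fun n : ℕ => (ε * Real.log n - 1) / 2) atTop atTop :=
    (tendsto_atTop_add_const_right _ (-1) (tendsto_log_natCast.const_mul_atTop hε)).atTop_div_const
      (by norm_num)
  have hlim : Tendsto (fun x : ℝ => (1 + 1 / ε) * (x⁻¹ * x⁻¹) + (2 / ε + 1) * x⁻¹) atTop (𝓝 0) := by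
    have h := ((tendsto_inv_atTop_zero (𝕜 := ℝ)).mul tendsto_inv_atTop_zero).const_mul (1 + 1 / ε)
    have h' := (tendsto_inv_atTop_zero (𝕜 := ℝ)).const_mul (2 / ε + 1)
    simpa using h.add h'
  filter_upwards [hΔ.eventually_gt_atTop 0, (hlim.comp hΔ).eventually_le_const hη] with n h1 h2
  refine ⟨h1, ?_⟩
  simp only [Function.comp_apply] at h2
  set Δ := (ε * Real.log n - 1) / 2 with hΔdef
  have h3 : Real.log n = (2 * Δ + 1) / ε := by rw [hΔdef]; field_simp; ring
  refine le_trans (le_of_eq ?_) h2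
  rw [h3]
  field_simp
  ring

theorem eventually_log_pow_mul_rpow_le (C : ℝ) {δ η : ℝ} (hδ : 0 < δ) (hη : 0 < η) :
    ∀ᶠ n : ℕ in atTop,
      C * ((4 * Real.log n + 10) ^ 2 * (1 + Real.log n)) * (n : ℝ) ^ (-δ) ≤ η := by
  have hlim : Tendsto (fun n : ℕ => |C| * 392 / δ ^ 3 *
      ((δ * Real.log n) ^ 3 * Real.exp (-(δ * Real.log n)))) atTop (𝓝 0) := by
    have h := ((Real.tendsto_pow_mul_exp_neg_atTop_nhds_zero 3).comp
      (tendsto_log_natCast.const_mul_atTop hδ)).const_mul (|C| * 392 / δ ^ 3)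
    simpa using h
  filter_upwards [hlim.eventually_le_const hη, tendsto_log_natCast.eventually_ge_atTop 1,
    eventually_gt_atTop 0] with n h1 h2 h3
  refine le_trans ?_ h1
  have h4 : (n : ℝ) ^ (-δ) = Real.exp (-(δ * Real.log n)) := by
    rw [Real.rpow_def_of_pos (by exact_mod_cast h3)]
    ring_nf
  rw [h4]
  set u := Real.log n
  have h5 : (4 * u + 10) ^ 2 * (1 + u) ≤ 392 * u ^ 3 := by
    have e1 : (4 * u + 10) ^ 2 ≤ (14 * u) ^ 2 := by gcongr; linarith
    calc (4 * u + 10) ^ 2 * (1 + u) ≤ (14 * u) ^ 2 * (2 * u) := by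
          gcongr; linarith
      _ = _ := by ring
  have h6 : |C| * 392 / δ ^ 3 * ((δ * u) ^ 3 * Real.exp (-(δ * u)))
      = |C| * (392 * u ^ 3) * Real.exp (-(δ * u)) := by field_simp
  rw [h6]
  gcongr
  exact le_abs_self C

variable {ι : Type*} {l : Filter ι} {k : ι → Type*} [∀ i, Field (k i)] [∀ i, Finite (k i)]
  {N h : ι → ℕ} {K : ∀ i, (k i)[X]}

/-- The typical number of prime factors is about log N, so S loses little by requiring at most (1 +
ε) log N. The sieve bound is used when 2h + 2 - N is comparable with N, and the linear bound
otherwise. -/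
theorem eventually_isApproximable_log
    (hK : ∀ i, (K i).Monic ∧ (K i).natDegree = N i) (hh : ∀ i, 1 ≤ h i ∧ h i + 2 ≤ N i)
    (hlim : Tendsto h l atTop) {c : ℝ} (hc : 2 * Real.log 2 - 1 < c)
    (ho : (fun i => (Nat.card (k i) : ℝ) ^ (h i + 1)) =o[l]
        (fun i => (Nat.card (k i) : ℝ) ^ N i / (N i : ℝ) ^ c)) {η : ℝ} (hη : 0 < η) :
    ∀ᶠ i in l, IsApproximable (K i) (h i) η := by
  have hNlim : Tendsto N l atTop := tendsto_atTop_mono (fun i => by have := hh i; omega) hlim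
  have hq : Tendsto (fun i => Nat.card (k i) ^ h i) l atTop :=
    tendsto_atTop_mono (fun i => (Nat.lt_pow_self (one_lt_natCard (k := k i))).le) hlim
  have hlog2 : 0 < Real.log 2 := Real.log_pos (by norm_num)
  set δ := c - (2 * Real.log 2 - 1) with hδ
  have hδ0 : 0 < δ := by rw [hδ]; linarith
  -- With this ε, the factor 4^((1 + ε) log N) uses half of the margin δ. The power N^(-δ/2) left
  -- over absorbs the logarithms.
  set ε := δ / (4 * Real.log 2) with hε
  have hε0 : 0 < ε := by positivity
  obtain ⟨M, hM⟩ := exists_regularSet (half_pos hη)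
  have hd : ∀ᶠ d : ℕ in atTop, 4 * ((d : ℝ) * (1 / 2) ^ d) ≤ η := by
    have := (tendsto_self_mul_const_pow_of_lt_one (r := 1 / 2) (by norm_num)
      (by norm_num)).const_mul 4
    rw [mul_zero] at this
    exact this.eventually_le_const hη
  obtain ⟨d₀, hd₀⟩ := eventually_atTop.1 hd
  filter_upwards [hq.eventually_ge_atTop M, eventually_one_le_mul_pow hq hη,
    (isLittleO_iff.1 ho) zero_lt_one, hNlim.eventually (eventually_chebyshev_le hε0 (half_pos hη)),
    hNlim.eventually (eventually_log_pow_mul_rpow_le (16 * (Real.exp 4 + 1) ^ 4) (half_pos hδ0) hη),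
    hNlim.eventually_ge_atTop (4 * d₀)]
    with i h1 h2 h3 h4 h5 h6
  have hhi := hh i
  obtain ⟨hKm, hKN⟩ := hK i
  obtain ⟨D, hD, hcard⟩ := hM (k i) (K i) (h i) hKm (by omega) h1
  have hq2 := two_le_natCard_real (k i)
  have hq0 := natCard_real_pos (k i)
  have hA := card_real_polyBall (K i) (h i + 1)
  have hN0 : (0 : ℝ) < N i := by exact_mod_cast (by omega)
  have hlogN := Real.log_natCast_nonneg (N i)
  set n := N i with hn
  set q : ℝ := (Nat.card (k i) : ℝ) with hqdef
  set u := Real.log n with hu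
  obtain ⟨hΔ0, hΔ⟩ := h4
  set m := ⌈(1 + ε) * u⌉₊ with hm
  have hm1 : (1 + ε) * u ≤ m := Nat.le_ceil _
  have hm2 : (m : ℝ) ≤ (1 + ε) * u + 1 := (Nat.ceil_lt_add_one (by positivity)).le
  set J := 2 * ⌈2 * u + 4⌉₊ with hJ
  have hJ1 : 4 * u + 8 ≤ J := by
    rw [hJ]; push_cast; linarith [Nat.le_ceil (2 * u + 4)]
  have hJ2 : (J : ℝ) ≤ 4 * u + 10 := by
    rw [hJ]; push_cast; linarith [Nat.ceil_lt_add_one (by positivity : 0 ≤ 2 * u + 4)]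
  set S := (regularSet (K i) (h i) D).filter (fun F => cappedOmega ((h i + 1) / 2) F ≤ m) with hS
  have hSA : S ⊆ polyBall (K i) (h i + 1) :=
    (Finset.filter_subset _ _).trans (Finset.filter_subset _ _)
  refine ⟨D, S, Finset.filter_subset _ _, hD.trans (by linarith), h2, ?_, ?_⟩
  · have e1 := card_filter_lt_cappedOmega_le (K i) (h := h i) (m := m) (N := n) hΔ0 (by omega)
      (by linarith)
    have e2 : ((regularSet (K i) (h i) D).card : ℝ) ≤ S.card
        + ((polyBall (K i) (h i + 1)).filter
          (fun F => m < cappedOmega ((h i + 1) / 2) F)).card := by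
      rw [← Finset.card_filter_add_card_filter_not (s := regularSet (K i) (h i) D)
        (fun F => cappedOmega ((h i + 1) / 2) F ≤ m)]
      push_cast
      gcongr
      intro F hF
      rw [Finset.mem_filter] at hF ⊢
      exact ⟨(Finset.filter_subset _ _) hF.1, by omega⟩
    have e3 := mul_le_mul_of_nonneg_left hΔ (by positivity : 0 ≤ q ^ (h i + 1))
    rw [hA] at hcard ⊢
    linarith
  -- In the second case h + 1 < 3n/4, hence d = n - h - 1 exceeds n/4 and n q^(-d) is exponentially
  -- small without any sieve. Truncated subtraction is harmless: for n > 2h + 2 it gives 0, which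
  -- also falls in this case.
  · rcases le_or_gt n (2 * (2 * h i + 2 - n)) with hcase | hcase
    · refine (card_nontrivialProducts_le_sieve (m := m) (J := J) hKm hKN (by omega) (by omega) hSA
        (fun F hF => (Finset.mem_filter.1 hF).2) ⟨_, two_mul _⟩ hJ1).trans ?_
      have f1 : (4 : ℝ) ^ m ≤ 4 * (n : ℝ) ^ (2 * Real.log 2 * (1 + ε)) := by
        have hlog4 : Real.log 4 = 2 * Real.log 2 := by
          rw [show (4 : ℝ) = 2 ^ 2 by norm_num, Real.log_pow]; push_cast; ring
        calc (4 : ℝ) ^ m = (4 : ℝ) ^ (m : ℝ) := (Real.rpow_natCast _ _).symm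
          _ ≤ (4 : ℝ) ^ ((1 + ε) * u + 1) := Real.rpow_le_rpow_of_exponent_le (by norm_num) hm2
          _ = _ := by
            rw [Real.rpow_add (by norm_num), Real.rpow_one, Real.rpow_def_of_pos (by norm_num),
              Real.rpow_def_of_pos hN0, hlog4, ← hu, mul_comm]
            ring_nf
      have f2 : q ^ (h i + 1) / q ^ n ≤ (n : ℝ) ^ (-c) := by
        rw [Real.norm_of_nonneg (by positivity), Real.norm_of_nonneg (by positivity), one_mul] at h3
        rw [div_le_iff₀ (by positivity), Real.rpow_neg hN0.le, ← div_eq_inv_mul]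
        exact h3
      have f3 : 2 * (1 + u) / (2 * h i + 2 - n : ℕ) ≤ 4 * (1 + u) * (n : ℝ) ^ (-1 : ℝ) := by
        have e1 : (n : ℝ) ≤ 2 * (2 * h i + 2 - n : ℕ) := by exact_mod_cast hcase
        rw [Real.rpow_neg_one, ← div_eq_mul_inv, div_le_div_iff₀ (by linarith) hN0]
        nlinarith
      have f4 : (n : ℝ) ^ (2 * Real.log 2 * (1 + ε)) * (n : ℝ) ^ (-c) * (n : ℝ) ^ (-1 : ℝ)
          = (n : ℝ) ^ (-(δ / 2)) := by
        rw [← Real.rpow_add hN0, ← Real.rpow_add hN0]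
        congr 1
        have : Real.log 2 * ε = δ / 4 := by rw [hε]; field_simp
        linear_combination 2 * this + hδ
      calc 4 ^ m * (q ^ (3 * (h i + 1)) / q ^ n * ((Real.exp 4 + 1) ^ 4 * J ^ 2 *
            (2 * (1 + u) / (2 * h i + 2 - n : ℕ))))
          = 4 ^ m * (q ^ (h i + 1) / q ^ n * ((Real.exp 4 + 1) ^ 4 * J ^ 2 *
            (2 * (1 + u) / (2 * h i + 2 - n : ℕ)))) * q ^ (2 * (h i + 1)) := by ring
        _ ≤ (4 * (n : ℝ) ^ (2 * Real.log 2 * (1 + ε))) * ((n : ℝ) ^ (-c) *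
            ((Real.exp 4 + 1) ^ 4 * (4 * u + 10) ^ 2 * (4 * (1 + u) * (n : ℝ) ^ (-1 : ℝ))))
            * q ^ (2 * (h i + 1)) := by gcongr
        _ = (16 * (Real.exp 4 + 1) ^ 4 * ((4 * u + 10) ^ 2 * (1 + u)) *
            ((n : ℝ) ^ (2 * Real.log 2 * (1 + ε)) * (n : ℝ) ^ (-c) * (n : ℝ) ^ (-1 : ℝ)))
            * q ^ (2 * (h i + 1)) := by ring
        _ ≤ η * q ^ (2 * (h i + 1)) := by rw [f4]; gcongr
    · refine (card_nontrivialProducts_le_linear hKm hKN (by omega) hSA).trans ?_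
      obtain ⟨d, hd⟩ : ∃ d, n = h i + 1 + d := Nat.exists_eq_add_of_le (by omega)
      have hd1 : n ≤ 4 * d := by omega
      have hd2 := hd₀ d (by omega)
      have g1 : q ^ (3 * (h i + 1)) / q ^ n * n = n * (1 / q) ^ d * q ^ (2 * (h i + 1)) := by
        have : q ^ (3 * (h i + 1)) = q ^ (2 * (h i + 1)) * q ^ (h i + 1) := by
          rw [← pow_add]; congr 1; ring
        rw [this, hd, pow_add q (h i + 1) d, div_pow, one_pow]
        field_simp
      rw [g1]
      gcongr
      calc (n : ℝ) * (1 / q) ^ d ≤ (4 * d : ℕ) * (1 / 2) ^ d := by gcongr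
        _ = 4 * ((d : ℝ) * (1 / 2) ^ d) := by push_cast; ring
        _ ≤ η := hd2

end LogRange

/-! ### Reduction to countably generated filters. -/

section Filters

theorem MeasureTheory.TendstoInDistribution.mono_filter {ι E : Type*} {Ω : ι → Type*} {Ω' : Type*}
    [∀ i, MeasurableSpace (Ω i)] [MeasurableSpace Ω'] [TopologicalSpace E] [MeasurableSpace E]
    [OpensMeasurableSpace E] {X : ∀ i, Ω i → E} {l l' : Filter ι} {Z : Ω' → E}
    {μ : ∀ i, Measure (Ω i)} [∀ i, IsProbabilityMeasure (μ i)] {μ' : Measure Ω'}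
    [IsProbabilityMeasure μ'] (h : TendstoInDistribution X l' Z μ μ') (hl : l ≤ l') :
    TendstoInDistribution X l Z μ μ' :=
  ⟨h.forall_aemeasurable, h.aemeasurable_limit, h.tendsto.mono_left hl⟩

/-- Two limit conditions along a filter already hold along a coarser countably generated one. -/
theorem exists_countablyGenerated_of_tendsto_of_isLittleO {ι : Type*} {l : Filter ι} {a : ι → ℕ}
    {u v : ι → ℝ} (ha : Tendsto a l atTop) (hv : ∀ i, v i ≠ 0) (huv : u =o[l] v) :
    ∃ l' : Filter ι, l'.IsCountablyGenerated ∧ l ≤ l' ∧ Tendsto a l' atTop ∧ u =o[l'] v := by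
  refine ⟨comap a atTop ⊓ comap (fun i => u i / v i) (𝓝 0), inferInstance,
    le_inf ha.le_comap (isLittleO_iff_tendsto (fun i hi => absurd hi (hv i))|>.1 huv).le_comap,
    tendsto_comap.mono_left inf_le_left, ?_⟩
  exact (isLittleO_iff_tendsto fun i hi => absurd hi (hv i)).2 (tendsto_comap.mono_left inf_le_right)

end Filters
end


theorem mainTheorem3 {ι : Type*} (l : Filter ι)
    (k : ι → Type*) [∀ i, Field (k i)] [∀ i, Finite (k i)]
    (N h : ι → ℕ) (K : ∀ i, (k i)[X])
    (hN : ∀ i, 3 ≤ N i) (hK : ∀ i, (K i).Monic ∧ (K i).natDegree = N i)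
    (hh : ∀ i, 1 ≤ h i ∧ h i + 2 ≤ N i)
    (Ω : ι → Type*) [∀ i, MeasurableSpace (Ω i)]
    (μ : ∀ i, Measure (Ω i)) [∀ i, IsProbabilityMeasure (μ i)]
    (f : ∀ i, (k i)[X] → Ω i → ℂ) (hf : ∀ i, IsSteinhaus (f i) (μ i)) :
    -- case (a)
    (Tendsto (fun i => Nat.card (k i) ^ h i) l atTop →
      (fun i => (Nat.card (k i) : ℝ) ^ (h i + 1)) =o[l]
        (fun i => (Nat.card (k i) : ℝ) ^ N i / (N i : ℝ)) →
      TendstoInDistribution (fun i => normalizedSum (f i) (polyInterval (N i) (K i) (h i))) l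
        (fun z : ℂ => z) μ stdComplexNormal) ∧
    -- case (b)
    (Tendsto h l atTop →
      ∀ c : ℝ, 2 * Real.log 2 - 1 < c →
      (fun i => (Nat.card (k i) : ℝ) ^ (h i + 1)) =o[l]
        (fun i => (Nat.card (k i) : ℝ) ^ N i / (N i : ℝ) ^ c) →
      TendstoInDistribution (fun i => normalizedSum (f i) (polyInterval (N i) (K i) (h i))) l
        (fun z : ℂ => z) μ stdComplexNormal) := by
  have hN0 : ∀ i, (0 : ℝ) < N i := fun i => by
    have := hN i
    exact_mod_cast (by omega : 0 < N i)
  have hq0 : ∀ i, (0 : ℝ) < (Nat.card (k i) : ℝ) := fun i => natCard_real_pos (k i)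
  refine ⟨fun ha ho => ?_, fun ha c hc ho => ?_⟩
  -- The filter l is arbitrary, whereas Lévy's theorem needs sequences. Both hypotheses already hold
  -- along a coarser countably generated filter, and the limit restricts back to l.
  · obtain ⟨l', hl', hle, ha', ho'⟩ := exists_countablyGenerated_of_tendsto_of_isLittleO ha
      (fun i => (div_pos (pow_pos (hq0 i) _) (hN0 i)).ne') ho
    exact (tendstoInDistribution_of_isApproximable hK hh hf fun η hη =>
      eventually_isApproximable_linear hK hh ha' ho' hη).mono_filter hle
  · obtain ⟨l', hl', hle, ha', ho'⟩ := exists_countablyGenerated_of_tendsto_of_isLittleO ha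
      (fun i => (div_pos (pow_pos (hq0 i) _) (Real.rpow_pos_of_pos (hN0 i) c)).ne') ho
    exact (tendstoInDistribution_of_isApproximable hK hh hf fun η hη =>
      eventually_isApproximable_log hK hh ha' hc ho' hη).mono_filter hle
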